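/- Let $\mathbb{F}_q$ be a finite field of odd characteristic $p$, let $K=\mathbb{F}_q(t)$, let $d\ge 1$ be an integer coprime to $q$, and let $E_d/K$ be the elliptic curve $$E_d:\quad y^2=x\,(x^2+t^{2d}x-4t^{2d}).$$ For a place $v$ of $K$ with residue field $\mathbb{F}_v$, put $q_v=|\mathbb{F}_v|$, $\deg v=[\mathbb{F}_v:\mathbb{F}_q]$ and $a_v=q_v+1-|(\widetilde{E_d})_v(\mathbb{F}_v)|$, where $(\widetilde{E_d})_v$ is the plane cubic obtained by reducing a minimal $v$-integral Weierstrass model of $E_d$. The $L$-function of $E_d/K$ is the power series $$L(E_d/K,T)=\prod_{v\text{ good}}\left(1-a_vT^{\deg v}+q_vT^{2\deg v}\right)^{-1}\prod_{v\text{ bad}}\left(1-a_vT^{\deg v}\right)^{-1},$$ the product being over all places of $K$, of good and of bad reduction; it converges coefficientwise in $\mathbb{Z}[[T]]$. Let $Z_{2d}=\mathbb{Z}/2d\mathbb{Z}\smallsetminus\{0,d/2,d,3d/2\}$ if $d$ is even and $Z_{2d}=\mathbb{Z}/2d\mathbb{Z}\smallsetminus\{0,d\}$ if $d$ is odd, and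 let $\mathcal{O}_q(Z_{2d})$ be the set of orbits of multiplication by $q$ on $Z_{2d}$; write $|\mathbf{n}|$ for the length of an orbit $\mathbf{n}$. Fix a prime ideal $\mathfrak{P}$ above $p$ of the ring $\bar{\mathbb{Z}}$ of algebraic integers in $\bar{\mathbb{Q}}$. Let $\theta:(\bar{\mathbb{Z}}/\mathfrak{P})^\times\to\bar{\mathbb{Q}}^\times$ be the inverse of the isomorphism given by reduction modulo $\mathfrak{P}$ from the group of roots of unity of order prime to $p$ onto $(\bar{\mathbb{Z}}/\mathfrak{P})^\times$, and view finite fields of characteristic $p$ as subfields of $\bar{\mathbb{Z}}/\mathfrak{P}$. For $n\in Z_{2d}$ with orbit $\mathbf{n}$, put $Q=q^{|\mathbf{n}|}$, let $\theta_n=\theta^{(Q-1)n/2d}$ on $\mathbb{F}_Q^\times$, let $\lambda$ be the character of order $2$ of $\mathbb{F}_Q^\times$, and set $$\beta(n)=\theta_n^2(4)\cdot \mathbf{j}(\theta_n,\theta_n)\cdot \mathbf{j}(\lambda\theta_n^2,\theta_n^{-1}),\qquad \mathbf{j}(\chi_1,\chi_2)=-\sum_{x\in\mathbb{F}_Q}\chi_1(x)\chi_2(1-x),$$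 where the (nontrivial) characters are extended by $0$ at $0$. Then $$L(E_d/K,T)=(1-qT)\prod_{\mathbf{n}\in\mathcal{O}_q(Z_{2d})}\left(1-\beta(n)\,T^{|\mathbf{n}|}\right),$$ where $n$ is any representative of the orbit $\mathbf{n}$. In particular, if $2d\mid q-1$ and $\chi:\mathbb{F}_q^\times\to\bar{\mathbb{Q}}^\times$ is any character of exact order $2d$, then $$L(E_d/K,T)=(1-qT)\prod_{\substack{1\le n\le 2d-1\\ n\ne d/2,\,d,\,3d/2}}(1-B(n)\,T),\qquad B(n)=\chi^{2n}(4)\sum_{u\in\mathbb{F}_q}\sum_{v\in\mathbb{F}_q}\chi^n(u(1-u))\,\chi^{2n+d}(v)\,\chi^{-n}(1-v).$$ -/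

import Mathlib

open scoped PowerSeries.WithPiTopology

noncomputable section

namespace KummerL

/-! ### Places of `F(t)` and the `L`-function of a Weierstrass curve over `F(t)` -/

/-- A place of the rational function field `F(t)`: a discrete valuation ring of `F(t)` containing
the field of constants `F`. -/
structure Place (F : Type*) [Field F] where
  /-- The valuation ring of the place. -/
  ring : ValuationSubring (RatFunc F)
  isDVR : IsDiscreteValuationRing ring
  const_mem : ∀ c : F, RatFunc.C c ∈ ring

namespace Place

variable {F : Type*} [Field F] (v : Place F)

instance : IsDiscreteValuationRing v.ring := v.isDVR

/-- The residue field `F_v`. -/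
abbrev residueField : Type _ := IsLocalRing.ResidueField v.ring

/-- The embedding of the constant field `F` into `F_v`. -/
def constHom : F →+* v.residueField :=
  (IsLocalRing.residue v.ring).comp
    ((RatFunc.C : F →+* RatFunc F).codRestrict v.ring.toSubring v.const_mem)

/-- The degree `[F_v : F]` of a place. -/
def degree : ℕ :=
  letI := v.constHom.toAlgebra
  Module.finrank F v.residueField

/-- The number of `F_v`-rational points of the plane projective cubic over `F_v` obtained by
reducing a minimal `v`-integral Weierstrass model: the solutions of the affine equation (singular
or not), and the point at infinity. -/
def numPoints (W : WeierstrassCurve (RatFunc F)) : ℕ :=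
  Nat.card {P : v.residueField × v.residueField //
    ((W.minimal v.ring).reduction v.ring).toAffine.Equation P.1 P.2} + 1

/-- `a_v = |F_v| + 1 - |Ẽ_v(F_v)|`, at places of good and of bad reduction. -/
def trace (W : WeierstrassCurve (RatFunc F)) : ℤ :=
  (Nat.card v.residueField : ℤ) + 1 - (v.numPoints W : ℤ)

open Classical in
/-- The Euler factor at `v`: `(1 - a_v T^deg v + q_v T^(2 deg v))⁻¹` if the reduction is good and
`(1 - a_v T^deg v)⁻¹` if it is bad. -/
def eulerFactor (W : WeierstrassCurve (RatFunc F)) : PowerSeries ℤ :=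
  if (W.minimal v.ring).HasGoodReduction v.ring then
    PowerSeries.invOfUnit
      (1 - PowerSeries.C (v.trace W) * PowerSeries.X ^ v.degree
        + PowerSeries.C (Nat.card v.residueField : ℤ) * PowerSeries.X ^ (2 * v.degree)) 1
  else
    PowerSeries.invOfUnit (1 - PowerSeries.C (v.trace W) * PowerSeries.X ^ v.degree) 1

end Place

/-- The `L`-function of a Weierstrass curve over `F(t)`, as a power series: the product of the Euler
factors over all places, for the topology of coefficientwise (discrete) convergence. -/
def LFunction {F : Type*} [Field F] (W : WeierstrassCurve (RatFunc F)) : PowerSeries ℤ :=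
  ∏' v : Place F, v.eulerFactor W

/-- The curve `E_d : y² = x (x² + t^(2d) x - 4 t^(2d))` over `F(t)`. -/
def curveE (F : Type*) [Field F] (d : ℕ) : WeierstrassCurve (RatFunc F) where
  a₁ := 0
  a₂ := RatFunc.X ^ (2 * d)
  a₃ := 0
  a₄ := -4 * RatFunc.X ^ (2 * d)
  a₆ := 0

/-! ### The action of `q` on `ℤ/2dℤ` -/

/-- The orbit `{n, q n, q² n, …}` of `n`. -/
def orbit (q : ℕ) {D : ℕ} [NeZero D] (n : ZMod D) : Finset (ZMod D) :=
  open Classical in Finset.univ.filter fun m => ∃ k : ℕ, m = (q : ZMod D) ^ k * n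

theorem card_orbit_pos (q : ℕ) {D : ℕ} [NeZero D] (n : ZMod D) : 0 < (orbit q n).card :=
  Finset.card_pos.2 ⟨n, by simpa [orbit] using ⟨0, by simp⟩⟩

/-- The set of orbits of a subset `Z` of `ℤ/Dℤ`. -/
def orbits (q : ℕ) {D : ℕ} [NeZero D] (Z : Finset (ZMod D)) : Finset (Finset (ZMod D)) :=
  Z.image (orbit q)

/-- The set `Z_{2d}`. -/
def indexSet (d : ℕ) [NeZero d] : Finset (ZMod (2 * d)) :=
  if Even d then {0, ((d / 2 : ℕ) : ZMod (2 * d)), (d : ZMod (2 * d)),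
    ((3 * d / 2 : ℕ) : ZMod (2 * d))}ᶜ
  else {0, (d : ZMod (2 * d))}ᶜ

/-! ### The Teichmüller character attached to a prime of `ℤ̄` above `p` -/

/-- An algebraic closure of `ℚ`. -/
abbrev QBar : Type := AlgebraicClosure ℚ

/-- The ring of all algebraic integers. -/
abbrev ZBar : Type := integralClosure ℤ QBar

attribute [local instance] Ideal.Quotient.field

section Teichmuller

variable (p : ℕ) [hp : Fact p.Prime] (P : Ideal ZBar) [P.IsMaximal] [CharP (ZBar ⧸ P) p]

/-- The group of roots of unity in `ℤ̄` of order prime to `p`. -/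
def primeToRoots : Subgroup ZBarˣ where
  carrier := {ζ | ∃ m : ℕ, m.Coprime p ∧ ζ ^ m = 1}
  one_mem' := ⟨1, by simp⟩
  mul_mem' := by
    rintro a b ⟨m, hm, ha⟩ ⟨n, hn, hb⟩
    refine ⟨m * n, Nat.Coprime.mul_left hm hn, ?_⟩
    rw [mul_pow, pow_mul, ha, mul_comm m n, pow_mul b, hb]
    simp
  inv_mem' := by
    rintro a ⟨m, hm, ha⟩
    exact ⟨m, hm, by rw [inv_pow, ha, inv_one]⟩

/-- Reduction modulo `P` on the roots of unity of order prime to `p`. -/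
def reductionHom : primeToRoots p →* (ZBar ⧸ P)ˣ :=
  (Units.map (Ideal.Quotient.mk P : ZBar →* ZBar ⧸ P)).comp (primeToRoots p).subtype

theorem reductionHom_injective : Function.Injective (reductionHom p P) := by
  rw [injective_iff_map_eq_one]
  rintro ⟨ζ, m, hm, hζ⟩ h
  have h1 : Ideal.Quotient.mk P (ζ : ZBar) = 1 := by
    simpa [reductionHom] using congrArg Units.val h
  have hζ' : (ζ : ZBar) ^ m = 1 := by
    rw [← Units.val_pow_eq_pow_val, hζ, Units.val_one]
  by_contra hne
  have hne' : (ζ : ZBar) - 1 ≠ 0 := by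
    intro h0
    apply hne
    ext1
    ext1
    simpa using sub_eq_zero.1 h0
  have hs : ∑ i ∈ Finset.range m, (ζ : ZBar) ^ i = 0 := by
    have := geom_sum_mul (ζ : ZBar) m
    rw [hζ', sub_self] at this
    exact (mul_eq_zero.1 this).resolve_right hne'
  have hm0 : (m : ZBar ⧸ P) = 0 := by
    have := congrArg (Ideal.Quotient.mk P) hs
    simpa [map_sum, h1] using this
  have hdvd := (CharP.cast_eq_zero_iff (ZBar ⧸ P) p m).1 hm0
  exact hp.out.one_lt.ne' (Nat.dvd_one.1 (hm ▸ Nat.dvd_gcd hdvd dvd_rfl))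

theorem reductionHom_surjective : Function.Surjective (reductionHom p P) := by
  intro x
  obtain ⟨m, hm, hx⟩ : ∃ m : ℕ, m.Coprime p ∧ (x : ZBar ⧸ P) ^ m = 1 := by
    let _ : Algebra (ZMod p) (ZBar ⧸ P) := ZMod.algebra _ p
    have hint : IsIntegral ℤ (x : ZBar ⧸ P) := by
      obtain ⟨y, hy⟩ := Ideal.Quotient.mk_surjective (I := P) (x : ZBar ⧸ P)
      rw [← hy]
      have hyi : IsIntegral ℤ y := Algebra.IsIntegral.isIntegral y
      exact hyi.map (Ideal.Quotient.mk P).toIntAlgHom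
    have hint' : IsIntegral (ZMod p) (x : ZBar ⧸ P) := by
      obtain ⟨g, hg, hg0⟩ := hint
      refine ⟨g.map (Int.castRingHom (ZMod p)), hg.map _, ?_⟩
      rw [Polynomial.eval₂_map, RingHom.ext_int ((algebraMap (ZMod p) (ZBar ⧸ P)).comp
        (Int.castRingHom (ZMod p))) (algebraMap ℤ (ZBar ⧸ P))]
      exact hg0
    have := IntermediateField.adjoin.finiteDimensional hint'
    have : Finite (IntermediateField.adjoin (ZMod p) {(x : ZBar ⧸ P)}) :=
      Module.finite_of_finite (ZMod p)
    let _ := Fintype.ofFinite (IntermediateField.adjoin (ZMod p) {(x : ZBar ⧸ P)})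
    let y := IntermediateField.AdjoinSimple.gen (ZMod p) (x : ZBar ⧸ P)
    have hy0 : y ≠ 0 := by
      intro h
      have := congrArg Subtype.val h
      exact x.ne_zero (by simpa [y] using this)
    refine ⟨Fintype.card (IntermediateField.adjoin (ZMod p) {(x : ZBar ⧸ P)}) - 1, ?_, ?_⟩
    · obtain ⟨n, -, hn⟩ :=
        FiniteField.card (IntermediateField.adjoin (ZMod p) {(x : ZBar ⧸ P)}) p
      rw [hn]
      refine Nat.Coprime.symm ((Nat.Prime.coprime_iff_not_dvd hp.out).2 fun h => ?_)
      have h1 : p ∣ p ^ (n : ℕ) := dvd_pow_self p n.ne_zero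
      have h2 := (Nat.dvd_sub_iff_right (Nat.one_le_pow _ _ hp.out.pos) h1).1 h
      exact hp.out.one_lt.ne' (Nat.dvd_one.1 h2)
    · have := congrArg Subtype.val (FiniteField.pow_card_sub_one_eq_one y hy0)
      simpa [y] using this
  have hm0 : 0 < m := by
    rcases Nat.eq_zero_or_pos m with rfl | h
    · exact absurd (Nat.coprime_zero_left p |>.1 hm) hp.out.one_lt.ne'
    · exact h
  have : NeZero m := ⟨hm0.ne'⟩
  obtain ⟨ω, hω⟩ := HasEnoughRootsOfUnity.exists_primitiveRoot QBar m
  have hωi : IsIntegral ℤ ω := hω.isIntegral hm0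
  let ω' : ZBar := ⟨ω, hωi⟩
  have hω' : IsPrimitiveRoot ω' m :=
    IsPrimitiveRoot.of_map_of_injective (f := (integralClosure ℤ QBar).val)
      (by simpa [ω'] using hω) Subtype.val_injective
  have hprod := Polynomial.X_pow_sub_one_eq_prod hm0 hω'
  have hev := congrArg (Polynomial.eval₂ (Ideal.Quotient.mk P) (x : ZBar ⧸ P)) hprod
  rw [Polynomial.eval₂_finsetProd] at hev
  simp only [Polynomial.eval₂_sub, Polynomial.eval₂_pow, Polynomial.eval₂_X,
    Polynomial.eval₂_one, Polynomial.eval₂_C, hx, sub_self] at hev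
  obtain ⟨ξ, hξ, hξx⟩ := Finset.prod_eq_zero_iff.1 hev.symm
  have hξm : ξ ^ m = 1 := (Polynomial.mem_nthRootsFinset hm0 1).1 hξ
  refine ⟨⟨Units.ofPowEqOne ξ m hξm hm0.ne', m, hm, Units.pow_ofPowEqOne hξm hm0.ne'⟩, ?_⟩
  ext1
  simpa [reductionHom] using (sub_eq_zero.1 hξx).symm

/-- The isomorphism between the roots of unity of order prime to `p` in `ℤ̄` and `(ℤ̄/P)ˣ` given by
reduction modulo `P`. -/
def reductionEquiv : primeToRoots p ≃* (ZBar ⧸ P)ˣ :=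
  MulEquiv.ofBijective (reductionHom p P) ⟨reductionHom_injective p P, reductionHom_surjective p P⟩

/-- The Teichmüller character `θ` on `(ℤ̄/P)ˣ`, the inverse of reduction, extended by `θ(0) = 0`. -/
def teichmuller : MulChar (ZBar ⧸ P) QBar :=
  MulChar.ofUnitHom <|
    (Units.map ((integralClosure ℤ QBar).val : ZBar →* QBar)).comp <|
      (primeToRoots p).subtype.comp (reductionEquiv p P).symm.toMonoidHom

/-- The subfield `{x | x ^ (p ^ m) = x}` with `p ^ m` elements of `ℤ̄/P`, which is an algebraic
closure of `𝔽_p`. -/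
def finiteSubfield (m : ℕ) : Subfield (ZBar ⧸ P) :=
  (iterateFrobenius (ZBar ⧸ P) p m).eqLocusField (RingHom.id _)

instance finite_finiteSubfield (m : ℕ) [NeZero m] : Finite (finiteSubfield p P m) := by
  have h1 : 1 < p ^ m := Nat.one_lt_pow (NeZero.ne m) hp.out.one_lt
  refine Set.Finite.subset (Polynomial.rootSet_finite
    (Polynomial.X ^ (p ^ m) - Polynomial.X : Polynomial (ZBar ⧸ P)) (ZBar ⧸ P)) fun x hx => ?_
  have hx' : x ^ (p ^ m) = x := by
    simpa [finiteSubfield, RingHom.mem_eqLocusField, iterateFrobenius_def] using hx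
  rw [Polynomial.mem_rootSet]
  exact ⟨FiniteField.X_pow_card_sub_X_ne_zero _ h1, by simp [hx']⟩

instance fintype_finiteSubfield (m : ℕ) [NeZero m] : Fintype (finiteSubfield p P m) :=
  Fintype.ofFinite _

/-- The restriction of the Teichmüller character to the finite field with `p ^ m` elements. -/
def teichmullerOn (m : ℕ) : MulChar (finiteSubfield p P m) QBar :=
  MulChar.ofUnitHom <|
    (teichmuller p P).toUnitHom.comp (Units.map (finiteSubfield p P m).subtype.toMonoidHom)

open Classical in
/-- The character `λ` of order two of a finite field of odd characteristic, with `λ(0) = 0`. -/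
def quadChar (F : Type*) [Field F] [Fintype F] : MulChar F QBar :=
  (quadraticChar F).ringHomComp (Int.castRingHom QBar)

/-- The Jacobi sum `j(χ₁, χ₂) = - ∑_{x₁ + x₂ = 1} χ₁(x₁) χ₂(x₂)`, where characters vanish at `0`.
It is used below for nontrivial characters only, so that the value of the trivial character at `0`
plays no role. -/
def jac {F : Type*} [Field F] [Fintype F] (χ₁ χ₂ : MulChar F QBar) : QBar :=
  -jacobiSum χ₁ χ₂

/-- With `q = p ^ f`, `ℓ` the length of the orbit of `n` and `Q = q ^ ℓ`, the character
`θ_n = θ ^ ((Q - 1) n / 2d)` of the field with `Q` elements. The division is exact,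
as `Q n = n` in `ℤ/2dℤ`. -/
def thetaChar (f d : ℕ) [NeZero d] (n : ZMod (2 * d)) :
    MulChar (finiteSubfield p P (f * (orbit (p ^ f) n).card)) QBar :=
  teichmullerOn p P (f * (orbit (p ^ f) n).card) ^
    (((p ^ f) ^ (orbit (p ^ f) n).card - 1) * n.val / (2 * d))

/-- `β(n) = θ_n²(4) j(θ_n, θ_n) j(λ θ_n², θ_n⁻¹)`, the Jacobi sums being taken over the field with
`Q = q ^ |orbit of n|` elements, `q = p ^ f`. -/
def beta (f : ℕ) [NeZero f] (d : ℕ) [NeZero d] (n : ZMod (2 * d)) : QBar :=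
  haveI : NeZero (orbit (p ^ f) n).card := ⟨(card_orbit_pos _ n).ne'⟩
  (thetaChar p P f d n ^ 2) 4 * jac (thetaChar p P f d n) (thetaChar p P f d n) *
    jac (quadChar _ * thetaChar p P f d n ^ 2) (thetaChar p P f d n)⁻¹

end Teichmuller

/-- For a character `χ` of order `2d` of `F`, the sum
`B(n) = χ^{2n}(4) ∑_u ∑_v χ^n(u(1-u)) χ^{2n+d}(v) χ^{-n}(1-v)`. -/
def sumB {F : Type*} [Field F] [Fintype F] (d : ℕ) (χ : MulChar F QBar) (n : ℕ) : QBar :=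
  (χ ^ (2 * n)) 4 *
    ∑ u : F, ∑ v : F, (χ ^ n) (u * (1 - u)) * (χ ^ (2 * n + d)) v * (χ ^ n)⁻¹ (1 - v)

end KummerL

end

noncomputable section

namespace KummerL
open Polynomial

/-! ### Monic polynomials over a finite field -/

section Monics

variable (k : Type*) [Field k] [Finite k]

/-! A power series with constant term 1 over a domain of characteristic zero is determined by its
logarithmic derivative T A'/A (`HasLogDeriv.coeff_unique`), so it is enough to compare coefficients
of T^m for m ≥ 1. Let L be the extension of F of degree m. For the L-function the coefficient is a
sum over the points of the projective line over L: an affine point τ contributes minus the sum over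
x of the quadratic character λ of the cubic at τ, and infinity, where the reduction is split
multiplicative, contributes 1 (`sum_coeff_eq_sum_fiberSum`). On the other side 1 - qT gives -q^m,
and 1 - βT^e gives -e β^(m/e) when e divides m.

The sum over the fibres is computed by characters. The cubic depends on τ ≠ 0 only through s =
τ^(2d), so orthogonality (`sum_units_pow`) produces, for every χ with χ^(2d) = 1, the sum of χ(s)
λ(x(x² + sx - 4s)) over s and x. The cubic is linear in s, hence for χ ≠ 1 this sum equals B(χ) =
χ²(4) J(χ,χ) J(λχ²,χ⁻¹) (`sum_char_mul_cubicSum_of_ne_one`). The characters 1 and λ give |L| and 1.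
Characters of order four can occur only for even d, and then their total cancels the fibre at τ = 0.
There remains -q^m minus the sum of B(χ) over χ^(2d) = 1, χ^4 ≠ 1 (`sum_cubicSum_family`,
`LFunction_map_eq`).

To recognise the product, use that B(χ ∘ N) is a power of B(χ), by Hasse–Davenport
(`charB_normChar`), and that B(χ^q) = B(χ), by Frobenius (`charB_pow_char_pow`). The characters of L
in question are indexed by the n with q^m n = n, that is, by the orbits whose length divides m
(`sum_charB_familyChars`). The two minus signs in the Jacobi sums `jac` cancel, so β(n) is a value
of B.

Both Hasse–Davenport and the point counts over extensions come from Weil's device. A product of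
characters of resultants Res(g, f) is multiplicative in the monic polynomial g. Its generating
series has character sums over extensions as power sums (`irreducibleSum_resultantChar`) and is a
polynomial (`monicSum_resultantChar_eq_zero`): 1 + JT for a Jacobi sum, 1 + ST + qT² for a smooth
cubic. -/

theorem finite_monic_natDegree_eq (n : ℕ) : {g : k[X] | g.Monic ∧ g.natDegree = n}.Finite := by
  have : Finite (degreeLT k (n + 1)) := Module.finite_of_finite k
  refine Set.Finite.subset (Set.toFinite (degreeLT k (n + 1) : Set k[X])) ?_
  rintro g ⟨-, hg⟩
  rw [SetLike.mem_coe, mem_degreeLT]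
  exact lt_of_le_of_lt degree_le_natDegree (by rw [hg]; exact_mod_cast Nat.lt_succ_self n)

/-- The monic polynomials of degree `n` over a finite field. -/
def monicsOfDegree (n : ℕ) : Finset k[X] := (finite_monic_natDegree_eq k n).toFinset

variable {k} in
@[simp]
theorem mem_monicsOfDegree {n : ℕ} {g : k[X]} :
    g ∈ monicsOfDegree k n ↔ g.Monic ∧ g.natDegree = n := by
  simp [monicsOfDegree]

open Classical in
/-- The monic irreducible polynomials of degree at most `n` over a finite field. -/
def irreduciblesUpTo (n : ℕ) : Finset k[X] :=
  ((Finset.range (n + 1)).biUnion (monicsOfDegree k)).filter Irreducible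

variable {k} in
@[simp]
theorem mem_irreduciblesUpTo {n : ℕ} {g : k[X]} :
    g ∈ irreduciblesUpTo k n ↔ g.Monic ∧ Irreducible g ∧ g.natDegree ≤ n := by
  simp only [irreduciblesUpTo, Finset.mem_filter, Finset.mem_biUnion, Finset.mem_range,
    mem_monicsOfDegree, Nat.lt_succ_iff]
  grind

/-- The monic irreducible polynomials whose degree divides `m`. -/
def irreduciblesDvd (m : ℕ) : Finset k[X] :=
  (irreduciblesUpTo k m).filter fun g => g.natDegree ∣ m

variable {k} in
theorem mem_irreduciblesDvd {m : ℕ} (hm : m ≠ 0) {g : k[X]} :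
    g ∈ irreduciblesDvd k m ↔ g.Monic ∧ Irreducible g ∧ g.natDegree ∣ m := by
  simp only [irreduciblesDvd, Finset.mem_filter, mem_irreduciblesUpTo]
  exact ⟨fun h => ⟨h.1.1, h.1.2.1, h.2⟩,
    fun h => ⟨⟨h.1, h.2.1, Nat.le_of_dvd (Nat.pos_of_ne_zero hm) h.2.2⟩, h.2.2⟩⟩

theorem monicsOfDegree_zero : monicsOfDegree k 0 = {1} := by
  ext g
  simp only [mem_monicsOfDegree, Finset.mem_singleton]
  exact ⟨fun h => eq_one_of_monic_natDegree_zero h.1 h.2, fun h => by simp [h]⟩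

theorem sum_monicsOfDegree_one [Fintype k] {R : Type*} [AddCommMonoid R] (φ : k[X] → R) :
    ∑ g ∈ monicsOfDegree k 1, φ g = ∑ x : k, φ (X - C x) := by
  symm
  refine Finset.sum_bij (fun x _ => X - C x) (fun x _ => ?_) (fun x _ y _ h => ?_)
    (fun g hg => ?_) (fun _ _ => rfl)
  · simp [monic_X_sub_C]
  · simpa using h
  · rw [mem_monicsOfDegree] at hg
    refine ⟨-g.coeff 0, Finset.mem_univ _, ?_⟩
    conv_rhs => rw [hg.1.eq_X_add_C hg.2]
    simp

theorem sum_monicsOfDegree_two [Fintype k] {R : Type*} [AddCommMonoid R] (φ : k[X] → R) :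
    ∑ g ∈ monicsOfDegree k 2, φ g = ∑ w : k, ∑ u : k, φ (X ^ 2 + C u * X + C w) := by
  rw [← Finset.sum_product']
  symm
  have hdeg : ∀ u w : k, (X ^ 2 + C u * X + C w).natDegree = 2 := fun u w => by compute_degree!
  refine Finset.sum_bij (fun x _ => X ^ 2 + C x.2 * X + C x.1) (fun x _ => ?_)
    (fun x _ y _ h => ?_) (fun g hg => ?_) (fun _ _ => rfl)
  · rw [mem_monicsOfDegree]
    refine ⟨?_, hdeg _ _⟩
    rw [Monic, leadingCoeff, hdeg]
    simp
  · have h0 := congrArg (fun g => g.coeff 0) h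
    have h1 := congrArg (fun g => g.coeff 1) h
    simp [coeff_C, coeff_X_pow] at h0 h1
    exact Prod.ext h0 h1
  · rw [mem_monicsOfDegree] at hg
    refine ⟨(g.coeff 0, g.coeff 1), Finset.mem_univ _, ?_⟩
    have h2 : g.coeff 2 = 1 := by have := hg.1.coeff_natDegree; rwa [hg.2] at this
    conv_rhs => rw [g.as_sum_range_C_mul_X_pow, hg.2]
    simp [Finset.sum_range_succ, h2]
    ring

end Monics

/-! ### Newton's identities and vanishing sums over monic polynomials -/

section Counting

theorem map_pow_of_map_mul_monic {k : Type*} [Field k] {R : Type*} [CommRing R] {h : k[X] → R} (h1 : h 1 = 1)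
    (hmul : ∀ a b : k[X], a.Monic → b.Monic → h (a * b) = h a * h b) {a : k[X]} (ha : a.Monic)
    (j : ℕ) : h (a ^ j) = h a ^ j := by
  induction j with
  | zero => simpa using h1
  | succ j ih => rw [pow_succ, hmul _ _ (ha.pow j) ha, ih, pow_succ]

variable {k : Type*} [Field k] [Finite k]

-- The indices m being counted are j deg π with π^j dividing g and j ≥ 1, and the bound m ≤ n is
-- automatic because deg π^j ≤ deg g.
open UniqueFactorizationMonoid Classical in
theorem count_normalizedFactors_eq_card {k : Type*} [Field k] {n : ℕ} {g π : k[X]}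
    (hg : g.Monic) (hgn : g.natDegree = n) (hπ : Irreducible π) (hπm : π.Monic) :
    ((Finset.Icc 1 n).filter fun m => π.natDegree ∣ m ∧ π ^ (m / π.natDegree) ∣ g).card =
      (normalizedFactors g).count π := by
  have hd : 0 < π.natDegree := hπ.natDegree_pos
  have hiff : ∀ j : ℕ, π ^ j ∣ g ↔ j ≤ (normalizedFactors g).count π := fun j => by
    have := le_emultiplicity_iff_replicate_le_normalizedFactors (n := j) hπ hg.ne_zero
    rw [hπm.normalize_eq_self, ← Multiset.le_count_iff_replicate_le] at this
    rw [← this, pow_dvd_iff_le_emultiplicity]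
  have : (Finset.Icc 1 n).filter (fun m => π.natDegree ∣ m ∧ π ^ (m / π.natDegree) ∣ g) =
      (Finset.Icc 1 ((normalizedFactors g).count π)).image (fun j => π.natDegree * j) := by
    ext m
    simp only [Finset.mem_filter, Finset.mem_Icc, Finset.mem_image]
    constructor
    · rintro ⟨⟨h1, h2⟩, ⟨j, rfl⟩, h3⟩
      rw [Nat.mul_div_cancel_left _ hd, hiff] at h3
      exact ⟨j, ⟨Nat.pos_of_ne_zero (by rintro rfl; simp at h1), h3⟩, rfl⟩
    · rintro ⟨j, ⟨h1, h2⟩, rfl⟩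
      rw [← hiff] at h2
      refine ⟨⟨Nat.mul_pos hd h1, ?_⟩, dvd_mul_right _ _, by
        rwa [Nat.mul_div_cancel_left _ hd]⟩
      have := natDegree_le_of_dvd h2 hg.ne_zero
      rw [natDegree_pow, hgn] at this
      rwa [mul_comm]
  rw [this, Finset.card_image_of_injective _ (fun a b hab => Nat.eq_of_mul_eq_mul_left hd hab), Nat.card_Icc]
  simp

-- This is the polynomial analogue of log n = ∑ Λ(d) over d dividing n: each prime power π^j
-- dividing g contributes deg π. Grouping the prime powers by their degree m = j deg π gives the
-- shape needed for Newton's identities.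
open UniqueFactorizationMonoid in
theorem natDegree_eq_sum_irreducibles {n : ℕ} {g : k[X]} (hg : g ∈ monicsOfDegree k n) :
    open Classical in n = ∑ m ∈ Finset.Icc 1 n, ∑ π ∈ irreduciblesDvd k m,
      if π ^ (m / π.natDegree) ∣ g then π.natDegree else 0 := by
  classical
  rw [mem_monicsOfDegree] at hg
  obtain ⟨hg, hgn⟩ := hg
  have h1 : ∀ m ∈ Finset.Icc 1 n, (∑ π ∈ irreduciblesDvd k m,
      if π ^ (m / π.natDegree) ∣ g then π.natDegree else 0) =
      ∑ π ∈ irreduciblesUpTo k n,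
        if π.natDegree ∣ m ∧ π ^ (m / π.natDegree) ∣ g then π.natDegree else 0 := by
    intro m hm
    rw [Finset.mem_Icc] at hm
    have : irreduciblesDvd k m = (irreduciblesUpTo k n).filter fun π => π.natDegree ∣ m := by
      ext π
      rw [mem_irreduciblesDvd (by omega), Finset.mem_filter, mem_irreduciblesUpTo]
      exact ⟨fun h => ⟨⟨h.1, h.2.1, (Nat.le_of_dvd (by omega) h.2.2).trans hm.2⟩, h.2.2⟩,
        fun h => ⟨h.1.1, h.1.2.1, h.2⟩⟩
    rw [this, Finset.sum_filter]
    refine Finset.sum_congr rfl fun π _ => ?_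
    rw [ite_and]
  rw [Finset.sum_congr rfl h1, Finset.sum_comm]
  have h2 : ∀ π ∈ irreduciblesUpTo k n, (∑ m ∈ Finset.Icc 1 n,
      if π.natDegree ∣ m ∧ π ^ (m / π.natDegree) ∣ g then π.natDegree else 0) =
      (normalizedFactors g).count π * π.natDegree := by
    intro π hπ
    rw [mem_irreduciblesUpTo] at hπ
    rw [← Finset.sum_filter, Finset.sum_const, count_normalizedFactors_eq_card hg hgn hπ.2.1 hπ.1,
      smul_eq_mul]
  rw [Finset.sum_congr rfl h2]
  have h3 : (normalizedFactors g).prod = g := by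
    rw [prod_normalizedFactors_eq hg.ne_zero, hg.normalize_eq_self]
  have hmem : ∀ π ∈ normalizedFactors g, π.Monic ∧ Irreducible π ∧ π ∣ g := fun π hπ =>
    ⟨by
      rw [← normalize_normalized_factor π hπ]
      exact monic_normalize (irreducible_of_normalized_factor π hπ).ne_zero,
      irreducible_of_normalized_factor π hπ, dvd_of_mem_normalizedFactors hπ⟩
  rw [← hgn]
  conv_lhs => rw [← h3]
  rw [natDegree_multiset_prod_of_monic _ fun π hπ => (hmem π hπ).1, Finset.sum_multiset_map_count]
  refine Finset.sum_subset (fun π hπ => ?_) (fun π _ hπ => ?_)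
  · rw [Multiset.mem_toFinset] at hπ
    obtain ⟨a, b, c⟩ := hmem π hπ
    exact mem_irreduciblesUpTo.2 ⟨a, b, natDegree_le_of_dvd c hg.ne_zero⟩
  · rw [Multiset.mem_toFinset] at hπ
    simp [Multiset.count_eq_zero_of_notMem hπ]

/-- The sum of `h` over the monic polynomials of degree `n`. -/
def monicSum {R : Type*} [CommRing R] (h : k[X] → R) (n : ℕ) : R :=
  ∑ g ∈ monicsOfDegree k n, h g

/-- The power sums attached to a multiplicative function on monic polynomials. -/
def irreducibleSum {R : Type*} [CommRing R] (h : k[X] → R) (m : ℕ) : R :=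
  ∑ π ∈ irreduciblesDvd k m, (π.natDegree : R) * h π ^ (m / π.natDegree)

/-- Newton's identities for the coefficients of an `L`-series of a polynomial ring. -/
theorem natCast_mul_monicSum {R : Type*} [CommRing R] {h : k[X] → R} (h1 : h 1 = 1)
    (hmul : ∀ a b : k[X], a.Monic → b.Monic → h (a * b) = h a * h b) (n : ℕ) :
    (n : R) * monicSum h n =
      ∑ m ∈ Finset.Icc 1 n, monicSum h (n - m) * irreducibleSum h m := by
  classical
  have e1 : (n : R) * monicSum h n = ∑ g ∈ monicsOfDegree k n, ∑ m ∈ Finset.Icc 1 n,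
      ∑ π ∈ irreduciblesDvd k m,
        if π ^ (m / π.natDegree) ∣ g then (π.natDegree : R) * h g else 0 := by
    rw [monicSum, Finset.mul_sum]
    refine Finset.sum_congr rfl fun g hg => ?_
    conv_lhs => rw [natDegree_eq_sum_irreducibles hg]
    push_cast
    rw [Finset.sum_mul]
    refine Finset.sum_congr rfl fun m _ => ?_
    rw [Finset.sum_mul]
    refine Finset.sum_congr rfl fun π _ => ?_
    split_ifs <;> simp
  rw [e1, Finset.sum_comm]
  refine Finset.sum_congr rfl fun m hm => ?_
  rw [Finset.mem_Icc] at hm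
  rw [Finset.sum_comm, irreducibleSum, Finset.mul_sum]
  refine Finset.sum_congr rfl fun π hπ => ?_
  rw [mem_irreduciblesDvd (by omega)] at hπ
  obtain ⟨hπm, hπ, j, rfl⟩ := hπ
  rw [Nat.mul_div_cancel_left _ hπ.natDegree_pos, ← Finset.sum_filter, monicSum, Finset.sum_mul]
  symm
  -- The multiples of π^j of degree n are the products of π^j with the monic polynomials of degree n
  -- - j deg π.
  refine Finset.sum_bij (fun g _ => π ^ j * g) (fun g hg => ?_) (fun a _ b _ hab => ?_)
    (fun g hg => ?_) (fun g hg => ?_)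
  · rw [mem_monicsOfDegree] at hg
    rw [Finset.mem_filter, mem_monicsOfDegree]
    refine ⟨⟨(hπm.pow j).mul hg.1, ?_⟩, dvd_mul_right _ _⟩
    rw [(hπm.pow j).natDegree_mul hg.1, hπm.natDegree_pow, hg.2, mul_comm]
    omega
  · exact mul_left_cancel₀ (pow_ne_zero _ hπ.ne_zero) hab
  · rw [Finset.mem_filter, mem_monicsOfDegree] at hg
    obtain ⟨⟨h1, h2⟩, g', rfl⟩ := hg
    have hg' : g'.Monic := (hπm.pow j).of_mul_monic_left h1
    refine ⟨g', mem_monicsOfDegree.2 ⟨hg', ?_⟩, rfl⟩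
    rw [(hπm.pow j).natDegree_mul hg', hπm.natDegree_pow, mul_comm] at h2
    omega
  · rw [mem_monicsOfDegree] at hg
    rw [hmul _ _ (hπm.pow j) hg.1, map_pow_of_map_mul_monic h1 hmul hπm]
    ring

/-- Both g and X^(n - deg f) f are monic of degree n, and the weights c and 1 - c add up to 1, so
the leading coefficient stays 1. -/
theorem affine_mem_monicsOfDegree {f : k[X]} {n : ℕ} (hf : f.natDegree ≤ n) (hfm : f.Monic)
    (c : k) {g : k[X]} (hg : g ∈ monicsOfDegree k n) :
    C c * g + C (1 - c) * X ^ (n - f.natDegree) * f ∈ monicsOfDegree k n := by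
  set e : k[X] := X ^ (n - f.natDegree) * f with he
  have hem : e.Monic := (monic_X_pow _).mul hfm
  have hed : e.natDegree = n := by
    rw [he, (monic_X_pow _).natDegree_mul hfm, natDegree_X_pow]
    omega
  rw [mem_monicsOfDegree] at hg ⊢
  rw [mul_assoc, ← he]
  have hcoeff : (C c * g + C (1 - c) * e).coeff n = 1 := by
    have h1 : g.coeff n = 1 := by have := hg.1.coeff_natDegree; rwa [hg.2] at this
    have h2 : e.coeff n = 1 := by have := hem.coeff_natDegree; rwa [hed] at this
    rw [coeff_add, coeff_C_mul, coeff_C_mul, h1, h2]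
    ring
  have hle : (C c * g + C (1 - c) * e).natDegree ≤ n :=
    natDegree_add_le_of_degree_le ((natDegree_C_mul_le _ _).trans hg.2.le)
      ((natDegree_C_mul_le _ _).trans hed.le)
  exact ⟨monic_of_natDegree_le_of_coeff_eq_one n hle hcoeff,
    natDegree_eq_of_le_of_coeff_ne_zero hle (by rw [hcoeff]; exact one_ne_zero)⟩

/-- A function that is multiplied by a constant `ζ ≠ 1` under `g ↦ c g + (1 - c) X ^ (n - r) f`
has sum `0` over the monic polynomials of degree `n`. -/
theorem monicSum_eq_zero {R : Type*} [CommRing R] [IsDomain R] {h : k[X] → R} {f : k[X]} {n : ℕ}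
    (hf : f.natDegree ≤ n) (hfm : f.Monic) {c : k} (hc : c ≠ 0) {ζ : R} (hζ : ζ ≠ 1)
    (hh : ∀ g : k[X], g ∈ monicsOfDegree k n →
      h (C c * g + C (1 - c) * X ^ (n - f.natDegree) * f) = ζ * h g) : monicSum h n = 0 := by
  have key : ∀ (c : k) (g : k[X]), g ∈ monicsOfDegree k n →
      C c * g + C (1 - c) * X ^ (n - f.natDegree) * f ∈ monicsOfDegree k n :=
    fun c g hg => affine_mem_monicsOfDegree hf hfm c hg
  have hcc : (C c : k[X]) * C c⁻¹ = 1 := by rw [← C_mul, mul_inv_cancel₀ hc, C_1]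
  -- The substitution permutes the monic polynomials of degree n; its inverse is the same
  -- substitution with c⁻¹.
  have hsum : monicSum h n = ζ * monicSum h n := by
    conv_lhs => rw [monicSum]
    rw [monicSum, Finset.mul_sum]
    symm
    refine Finset.sum_bij' (fun g _ => C c * g + C (1 - c) * X ^ (n - f.natDegree) * f)
      (fun g _ => C c⁻¹ * g + C (1 - c⁻¹) * X ^ (n - f.natDegree) * f)
      (fun g hg => key c g hg) (fun g hg => key c⁻¹ g hg) (fun g _ => ?_) (fun g _ => ?_)
      (fun g hg => (hh g hg).symm)
    · simp only [C_sub, C_1]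
      linear_combination (g - X ^ (n - f.natDegree) * f) * hcc
    · simp only [C_sub, C_1]
      linear_combination (g - X ^ (n - f.natDegree) * f) * hcc
  have : (1 - ζ) * monicSum h n = 0 := by rw [sub_mul, one_mul, ← hsum, sub_self]
  exact (mul_eq_zero.1 this).resolve_left (sub_ne_zero.2 hζ.symm)

/-- Summing a function of the minimal polynomial over a finite extension. -/
theorem sum_minpoly_eq {L : Type*} [Field L] [Fintype L] [Algebra k L] {R : Type*} [CommRing R]
    (φ : k[X] → R) :
    ∑ x : L, φ (minpoly k x) =
      ∑ π ∈ irreduciblesDvd k (Module.finrank k L), (π.natDegree : R) * φ π := by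
  classical
  have hm : Module.finrank k L ≠ 0 := Module.finrank_pos.ne'
  have hint : ∀ x : L, IsIntegral k x := fun x => Algebra.IsIntegral.isIntegral x
  rw [← Finset.sum_fiberwise_of_maps_to (t := irreduciblesDvd k (Module.finrank k L))
    (g := fun x => minpoly k x) (fun x _ => (mem_irreduciblesDvd hm).2
      ⟨minpoly.monic (hint x), minpoly.irreducible (hint x), minpoly.degree_dvd (hint x)⟩)]
  refine Finset.sum_congr rfl fun π hπ => ?_
  rw [mem_irreduciblesDvd hm] at hπ
  rw [Finset.sum_congr rfl (g := fun _ => φ π) fun x hx => by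
    rw [(Finset.mem_filter.1 hx).2], Finset.sum_const, nsmul_eq_mul]
  congr 2
  -- Since deg π divides [L : k], π divides X^|L| - X and splits in L; it is separable, so exactly
  -- deg π elements of L have minimal polynomial π.
  have hdvd : π ∣ X ^ Nat.card L - X := by
    rw [Module.natCard_eq_pow_finrank (K := k)]
    exact (hπ.2.1.natDegree_dvd_iff_dvd_X_pow_card_pow_sub_X).1 hπ.2.2
  have hspl : (π.map (algebraMap k L)).Splits := by
    have h1 : ((X ^ Nat.card L - X : k[X]).map (algebraMap k L)).Splits := by
      have := FiniteField.isSplittingField_sub L k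
      rw [Nat.card_eq_fintype_card]
      exact this.splits
    refine h1.of_dvd ?_ (Polynomial.map_dvd _ hdvd)
    have : (X ^ Nat.card L - X : L[X]) ≠ 0 :=
      FiniteField.X_pow_card_sub_X_ne_zero _ (Finite.one_lt_card (α := L))
    simpa using this
  rw [← card_rootSet_eq_natDegree (PerfectField.separable_of_irreducible hπ.2.1) hspl,
    Fintype.card_subtype]
  congr 1
  ext x
  simp only [Finset.mem_filter, Finset.mem_univ, true_and]
  rw [mem_rootSet]
  constructor
  · rintro rfl
    exact ⟨hπ.1.ne_zero, minpoly.aeval k x⟩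
  · rintro ⟨-, h0⟩
    exact (minpoly.eq_of_irreducible_of_monic hπ.2.1 h0 hπ.1).symm

end Counting

end KummerL

end

noncomputable section

namespace KummerL
open Polynomial

/-! ### Norms and resultants -/

section Norm

variable {k : Type*} [Field k]

-- Both sides are the product of the values of f at the conjugates of x in an algebraic closure.
open IntermediateField IntermediateField.AdjoinSimple in
theorem norm_aeval_gen {L : Type*} [Field L] [Algebra k L] [FiniteDimensional k L]
    [Algebra.IsSeparable k L] (x : L) (f : k[X]) :
    Algebra.norm k (aeval (gen k x) f) = resultant (minpoly k x) f := by
  classical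
  let Ω := AlgebraicClosure k
  have hx : IsIntegral k x := Algebra.IsIntegral.isIntegral x
  have hsep : Algebra.IsSeparable k k⟮x⟯ := Algebra.isSeparable_tower_bot_of_isSeparable k k⟮x⟯ L
  have hmin : minpoly k (adjoin.powerBasis hx).gen = minpoly k x := by
    rw [adjoin.powerBasis_gen, minpoly_gen]
  apply FaithfulSMul.algebraMap_injective k Ω
  have hspl : ((minpoly k x).map (algebraMap k Ω)).Splits := IsAlgClosed.splits _
  have hmon : ((minpoly k x).map (algebraMap k Ω)).Monic := (minpoly.monic hx).map _
  have e := resultant_eq_prod_eval ((minpoly k x).map (algebraMap k Ω)) (f.map (algebraMap k Ω))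
    f.natDegree natDegree_map_le hspl
  rw [hmon.leadingCoeff, one_pow, one_mul, natDegree_map, resultant_map_map] at e
  rw [e, Algebra.norm_eq_prod_embeddings k Ω]
  let pb := adjoin.powerBasis hx
  have hroots : (((minpoly k x).map (algebraMap k Ω)).roots) =
      (((minpoly k x).map (algebraMap k Ω)).roots).toFinset.val := by
    rw [Multiset.toFinset_val, Multiset.dedup_eq_self.2]
    exact nodup_roots (Separable.map (Algebra.IsSeparable.isSeparable k x))
  rw [hroots, ← Finset.prod_eq_multiset_prod]
  refine Finset.prod_bij (fun σ _ => σ (gen k x)) (fun σ _ => ?_) (fun σ _ τ _ h => ?_)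
    (fun r hr => ?_) (fun σ _ => ?_)
  · rw [Multiset.mem_toFinset, mem_roots hmon.ne_zero, IsRoot, eval_map_algebraMap,
      ← minpoly_gen, aeval_algHom_apply, minpoly.aeval, map_zero]
  · apply pb.algHom_ext
    simpa [pb, adjoin.powerBasis_gen] using h
  · rw [Multiset.mem_toFinset, mem_roots hmon.ne_zero, IsRoot, eval_map_algebraMap] at hr
    refine ⟨pb.lift r (by rw [hmin, hr]), Finset.mem_univ _, ?_⟩
    have := pb.lift_gen r (by rw [hmin, hr])
    simpa [pb, adjoin.powerBasis_gen] using this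
  · rw [eval_map_algebraMap, aeval_algHom_apply]

-- Transitivity of the norm through k(x): the value f(x) already lies in k(x), so going up to L only
-- raises the norm to the power [L : k(x)].
open IntermediateField IntermediateField.AdjoinSimple in
theorem norm_aeval_eq_resultant_pow {L : Type*} [Field L] [Algebra k L] [FiniteDimensional k L]
    [Algebra.IsSeparable k L] (x : L) (f : k[X]) :
    Algebra.norm k (aeval x f) =
      resultant (minpoly k x) f ^ (Module.finrank k L / (minpoly k x).natDegree) := by
  have hx : IsIntegral k x := Algebra.IsIntegral.isIntegral x
  have h1 : aeval x f = algebraMap k⟮x⟯ L (aeval (gen k x) f) := by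
    rw [← aeval_algebraMap_apply, algebraMap_gen]
  have h2 : Module.finrank k L / (minpoly k x).natDegree = Module.finrank k⟮x⟯ L := by
    rw [← adjoin.finrank hx, ← Module.finrank_mul_finrank k k⟮x⟯ L,
      Nat.mul_div_cancel_left _ Module.finrank_pos]
  rw [h1, h2, ← Algebra.norm_norm (S := k⟮x⟯), Algebra.norm_algebraMap, map_pow, norm_aeval_gen]

variable {R : Type*} [CommRing R]

/-- The multiplicative function `g ↦ χ₁(Res(g, f₁)) χ₂(Res(g, f₂))` on monic polynomials. -/
def resultantChar (χ₁ χ₂ : MulChar k R) (f₁ f₂ g : k[X]) : R :=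
  χ₁ (resultant g f₁) * χ₂ (resultant g f₂)

theorem resultantChar_one (χ₁ χ₂ : MulChar k R) (f₁ f₂ : k[X]) :
    resultantChar χ₁ χ₂ f₁ f₂ 1 = 1 := by
  simp [resultantChar]

theorem resultant_mul_left_of_monic {a b : k[X]} (ha : a.Monic) (hb : b.Monic) (f : k[X]) :
    resultant (a * b) f = resultant a f * resultant b f := by
  rw [← resultant_mul_left a b f f.natDegree le_rfl, ha.natDegree_mul hb]

theorem resultantChar_mul (χ₁ χ₂ : MulChar k R) (f₁ f₂ : k[X]) (a b : k[X]) (ha : a.Monic)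
    (hb : b.Monic) : resultantChar χ₁ χ₂ f₁ f₂ (a * b) =
      resultantChar χ₁ χ₂ f₁ f₂ a * resultantChar χ₁ χ₂ f₁ f₂ b := by
  simp only [resultantChar, resultant_mul_left_of_monic ha hb, map_mul]
  ring

theorem resultantChar_X_sub_C (χ₁ χ₂ : MulChar k R) (f₁ f₂ : k[X]) (x : k) :
    resultantChar χ₁ χ₂ f₁ f₂ (X - C x) = χ₁ (f₁.eval x) * χ₂ (f₂.eval x) := by
  simp only [resultantChar, natDegree_X_sub_C, resultant_X_sub_C_left _ _ _ le_rfl]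

/-- Up to the formal degree n, the resultant with f depends only on the first polynomial modulo f,
and scaling that polynomial by c multiplies it by c^(deg f). -/
theorem resultant_C_mul_add {g p f : k[X]} {n : ℕ} {c : k}
    (hp : p.natDegree + f.natDegree ≤ n) (hg : g.natDegree = n)
    (hd : (C c * g + f * p).natDegree = n) :
    resultant (C c * g + f * p) f = c ^ f.natDegree * resultant g f := by
  rw [hd, resultant_add_mul_left _ _ _ _ _ hp le_rfl, resultant_C_mul_left, hg]

variable [Finite k]

/-- Each π is the minimal polynomial of deg π elements x of L, and the norm of f(x) is Res(π, f)
raised to [L : k] / deg π. Thus the power sums of the series are character sums over L. -/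
theorem irreducibleSum_resultantChar (χ₁ χ₂ : MulChar k R) (f₁ f₂ : k[X]) (L : Type*) [Field L]
    [Fintype L] [Algebra k L] :
    irreducibleSum (resultantChar χ₁ χ₂ f₁ f₂) (Module.finrank k L) =
      ∑ x : L, χ₁ (Algebra.norm k (aeval x f₁)) * χ₂ (Algebra.norm k (aeval x f₂)) := by
  rw [irreducibleSum, ← sum_minpoly_eq (L := L)
    fun π => resultantChar χ₁ χ₂ f₁ f₂ π ^ (Module.finrank k L / π.natDegree)]
  refine Finset.sum_congr rfl fun x _ => ?_
  simp only [resultantChar, norm_aeval_eq_resultant_pow, mul_pow, map_pow]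

/-- Replacing g by cg + (1 - c) X^(n - deg f) f multiplies g by c modulo f₁ and modulo f₂, because
both divide f. The summand is multiplied by the constant in `hχ`, which is not 1. -/
theorem monicSum_resultantChar_eq_zero [IsDomain R] (χ₁ χ₂ : MulChar k R) {f₁ f₂ f : k[X]}
    (hf : f.Monic) (h₁ : f₁ ∣ f) (h₂ : f₂ ∣ f) {c : k} (hc : c ≠ 0)
    (hχ : χ₁ c ^ f₁.natDegree * χ₂ c ^ f₂.natDegree ≠ 1) {n : ℕ} (hn : f.natDegree ≤ n) :
    monicSum (resultantChar χ₁ χ₂ f₁ f₂) n = 0 := by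
  refine monicSum_eq_zero hn hf hc hχ fun g hg => ?_
  have hg' := mem_monicsOfDegree.1 hg
  have hmem : (C c * g + C (1 - c) * X ^ (n - f.natDegree) * f).natDegree = n :=
    (mem_monicsOfDegree.1 (affine_mem_monicsOfDegree hn hf c hg)).2
  have key : ∀ f' : k[X], f' ∣ f →
      resultant (C c * g + C (1 - c) * X ^ (n - f.natDegree) * f) f' =
        c ^ f'.natDegree * resultant g f' := by
    rintro f' ⟨p, rfl⟩
    have hne := mul_ne_zero_iff.1 hf.ne_zero
    have hre : C (1 - c) * X ^ (n - (f' * p).natDegree) * (f' * p) =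
        f' * (C (1 - c) * X ^ (n - (f' * p).natDegree) * p) := by ring
    rw [hre] at hmem ⊢
    refine resultant_C_mul_add ?_ hg'.2 hmem
    have h3 : (C (1 - c) * X ^ (n - (f' * p).natDegree) * p).natDegree ≤
        (n - (f' * p).natDegree) + p.natDegree :=
      natDegree_mul_le.trans (Nat.add_le_add_right (natDegree_C_mul_X_pow_le _ _) _)
    have h4 := natDegree_mul hne.1 hne.2
    omega
  rw [resultantChar, key _ h₁, key _ h₂, resultantChar, map_mul, map_mul, map_pow, map_pow]
  ring

end Norm

end KummerL

end

noncomputable section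

namespace KummerL
open Polynomial

/-! ### Characters composed with the norm, and the Hasse–Davenport relation for Jacobi sums -/

section HasseDavenport

/-- The character `χ ∘ N` of a finite extension. -/
def normChar {k R : Type*} [Field k] [CommRing R] (L : Type*) [Field L] [Algebra k L]
    [FiniteDimensional k L] (χ : MulChar k R) : MulChar L R where
  toFun x := χ (Algebra.norm k x)
  map_one' := by simp
  map_mul' x y := by simp
  map_nonunit' x hx := by
    have : x = 0 := by simpa using hx
    simp [this, MulChar.map_zero]

variable {k : Type*} [Field k] {R : Type*} [CommRing R]
  {L : Type*} [Field L] [Algebra k L] [FiniteDimensional k L]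

@[simp]
theorem normChar_apply (χ : MulChar k R) (x : L) : normChar L χ x = χ (Algebra.norm k x) := rfl

theorem normChar_mul (χ ψ : MulChar k R) : normChar L (χ * ψ) = normChar L χ * normChar L ψ := by
  ext x
  simp

theorem normChar_one : normChar L (1 : MulChar k R) = 1 := by
  ext x
  rw [normChar_apply, MulChar.one_apply_coe, MulChar.one_apply]
  simp

theorem normChar_pow (χ : MulChar k R) (n : ℕ) : normChar L (χ ^ n) = normChar L χ ^ n := by
  induction n with
  | zero => simpa using normChar_one
  | succ n ih => rw [pow_succ, normChar_mul, ih, pow_succ]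

theorem normChar_inv (χ : MulChar k R) : normChar L χ⁻¹ = (normChar L χ)⁻¹ := by
  apply eq_inv_of_mul_eq_one_left
  rw [← normChar_mul, inv_mul_cancel, normChar_one]

theorem normChar_injective [Finite L] :
    Function.Injective (normChar L : MulChar k R → MulChar L R) := by
  have := Finite.of_injective _ (FaithfulSMul.algebraMap_injective k L)
  intro χ ψ h
  ext x
  obtain ⟨y, hy⟩ := FiniteField.norm_surjective k L (x : k)
  have := DFunLike.congr_fun h y
  rwa [normChar_apply, normChar_apply, hy] at this

variable [Fintype k] [Fintype L] [IsDomain R]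

/-- The Hasse–Davenport relation for Jacobi sums. -/
theorem neg_jacobiSum_normChar (χ₁ χ₂ : MulChar k R) (h : χ₁ * χ₂ ≠ 1) :
    -jacobiSum (normChar L χ₁) (normChar L χ₂) =
      (-jacobiSum χ₁ χ₂) ^ Module.finrank k L := by
  set H := resultantChar χ₁ χ₂ (X : k[X]) (1 - X) with hH
  have hdeg : (1 - X : k[X]).natDegree = 1 := by
    rw [← neg_sub, natDegree_neg, ← C_1, natDegree_X_sub_C]
  have h0 : monicSum H 0 = 1 := by
    rw [monicSum, monicsOfDegree_zero, Finset.sum_singleton, hH, resultantChar_one]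
  have h1 : monicSum H 1 = jacobiSum χ₁ χ₂ := by
    rw [monicSum, sum_monicsOfDegree_one, jacobiSum]
    refine Finset.sum_congr rfl fun x _ => ?_
    rw [hH, resultantChar_X_sub_C]
    simp
  -- X and 1 - X have degree 1 and divide X(X - 1), so the multiplier is (χ₁χ₂)(c), different from 1
  -- for some c. The series is 1 + JT, and Newton's identities make its power sums geometric with
  -- ratio -J.
  have h2 : ∀ n, 2 ≤ n → monicSum H n = 0 := by
    intro n hn
    obtain ⟨c, hc⟩ := MulChar.ne_one_iff.1 h
    refine monicSum_resultantChar_eq_zero χ₁ χ₂ (f := X * (X - C 1))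
      (monic_X.mul (monic_X_sub_C 1)) (dvd_mul_right _ _) ?_ c.ne_zero ?_ ?_
    · rw [← neg_sub, neg_dvd, C_1]
      exact dvd_mul_left _ _
    · rw [natDegree_X, hdeg, pow_one, pow_one]
      simpa using hc
    · rw [monic_X.natDegree_mul (monic_X_sub_C 1), natDegree_X, natDegree_X_sub_C]
      exact hn
  have hp : ∀ m, -irreducibleSum H (m + 1) = (-jacobiSum χ₁ χ₂) ^ (m + 1) := by
    have newton := natCast_mul_monicSum (resultantChar_one χ₁ χ₂ (X : k[X]) (1 - X))
      (resultantChar_mul χ₁ χ₂ (X : k[X]) (1 - X))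
    simp only [← hH] at newton
    intro m
    induction m with
    | zero =>
      have := newton 1
      simp [h0, h1] at this
      simp [this]
    | succ m ih =>
      have := newton (m + 2)
      rw [h2 _ (by omega), mul_zero, Finset.sum_Icc_succ_top (by omega),
        Finset.sum_Icc_succ_top (by omega)] at this
      rw [Finset.sum_eq_zero (s := Finset.Icc 1 m) fun i hi => by
        rw [Finset.mem_Icc] at hi
        rw [h2 _ (by omega), zero_mul]] at this
      have e1 : m + 2 - (m + 1) = 1 := by omega
      rw [e1, show m + 1 + 1 = m + 2 from rfl, Nat.sub_self, h0, h1] at this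
      rw [pow_succ, ← ih]
      linear_combination this
  have e : jacobiSum (normChar L χ₁) (normChar L χ₂) = irreducibleSum H (Module.finrank k L) := by
    rw [hH, irreducibleSum_resultantChar, jacobiSum]
    refine Finset.sum_congr rfl fun x _ => ?_
    simp
  obtain ⟨m, hm⟩ : ∃ m, Module.finrank k L = m + 1 :=
    Nat.exists_eq_succ_of_ne_zero Module.finrank_pos.ne'
  rw [e, hm, hp]

end HasseDavenport

/-! ### Quadratic characters -/

section Quadratic

variable {k : Type*} [Field k] [Fintype k] [DecidableEq k]

/-- Euler's criterion on both sides: N(x) is x to the power (|L| - 1)/(|k| - 1), and (|k| - 1)/2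
times this exponent is (|L| - 1)/2. The equality in L lifts to integers since the values are 0 or ±1
and the characteristic is not 2. -/
theorem normChar_quadraticChar (hk : ringChar k ≠ 2) (L : Type*) [Field L] [Fintype L]
    [DecidableEq L] [Algebra k L] : normChar L (quadraticChar k) = quadraticChar L := by
  have hchar : ringChar L = ringChar k := (Algebra.ringChar_eq k L).symm
  ext x
  rw [normChar_apply]
  set y : L := (x : L)
  have hinj := Int.cast_injOn_of_ringChar_ne_two (R := L) (by rwa [hchar])
  apply hinj
  · rcases quadraticChar_isQuadratic k (Algebra.norm k y) with h | h | h <;> simp [h]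
  · rcases quadraticChar_isQuadratic L y with h | h | h <;> simp [h]
  rw [quadraticChar_eq_pow_of_char_ne_two' (by rwa [hchar]),
    ← map_intCast (algebraMap k L), quadraticChar_eq_pow_of_char_ne_two' hk, map_pow,
    FiniteField.algebraMap_norm_eq_pow_sum, ← pow_mul]
  congr 1
  have h1 : Fintype.card L = Fintype.card k ^ Module.finrank k L := Module.card_eq_pow_finrank
  have h2 : Odd (Fintype.card k) := Nat.odd_iff.2 (FiniteField.odd_card_of_char_ne_two hk)
  obtain ⟨j, hj⟩ := h2
  rw [h1, Nat.card_eq_fintype_card, hj]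
  have h4 := geom_sum_mul_add (2 * j) (Module.finrank k L)
  have h5 : (2 * j + 1) / 2 = j := by omega
  rw [h5, ← h4]
  set S := ∑ i ∈ Finset.range (Module.finrank k L), (2 * j + 1) ^ i
  rw [show S * (2 * j) = 2 * (S * j) by ring]
  omega

theorem sum_comp_sq (hk : ringChar k ≠ 2) {R : Type*} [CommRing R] (g : k → R) :
    ∑ y : k, g (y ^ 2) = ∑ s : k, (1 + (quadraticChar k s : R)) * g s := by
  rw [← Finset.sum_fiberwise (s := Finset.univ) (g := fun y : k => y ^ 2)]
  refine Finset.sum_congr rfl fun s _ => ?_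
  rw [Finset.sum_congr rfl (g := fun _ => g s) fun y hy => by rw [(Finset.mem_filter.1 hy).2],
    Finset.sum_const, nsmul_eq_mul]
  have := quadraticChar_card_sqrts hk s
  congr 1
  rw [add_comm, ← Int.cast_one, ← Int.cast_add, ← this]
  simp only [Int.cast_natCast]
  congr 2
  ext y
  simp

/-- Passing to s = y² introduces the weight 1 + λ(s). The first part sums to 0; after s = Dw the
second is λ(-1) J(λ, λ), and J(λ, λ) = -λ(-1). -/
theorem sum_quadraticChar_sq_sub (hk : ringChar k ≠ 2) {D : k} (hD : D ≠ 0) :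
    ∑ y : k, quadraticChar k (y ^ 2 - D) = -1 := by
  rw [sum_comp_sq hk fun s => quadraticChar k (s - D)]
  simp only [add_mul, one_mul, Int.cast_id, Finset.sum_add_distrib]
  have h1 : ∑ s : k, quadraticChar k (s - D) = 0 := by
    rw [← quadraticChar_sum_zero hk]
    exact Fintype.sum_equiv (Equiv.subRight D) _ _ fun _ => rfl
  have h2 : ∑ s : k, quadraticChar k s * quadraticChar k (s - D) =
      quadraticChar k (-1) * jacobiSum (quadraticChar k) (quadraticChar k) := by
    rw [jacobiSum, Finset.mul_sum, ← Fintype.sum_equiv (Equiv.mulLeft₀ D hD)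
      (fun w => quadraticChar k (D * w) * quadraticChar k (D * w - D)) _ fun _ => rfl]
    refine Finset.sum_congr rfl fun w _ => ?_
    have e : D * w - D = D * (-1 * (1 - w)) := by ring
    rw [e, map_mul, map_mul, map_mul]
    have := quadraticChar_sq_one hD
    linear_combination (quadraticChar k w * quadraticChar k (-1) * quadraticChar k (1 - w)) * this
  have h3 : jacobiSum (quadraticChar k) (quadraticChar k) = -quadraticChar k (-1) := by
    have := jacobiSum_nontrivial_inv (quadraticChar_ne_one hk)
    rwa [(quadraticChar_isQuadratic k).inv] at this
  rw [h1, h2, h3, zero_add, mul_neg, ← sq, quadraticChar_sq_one (neg_ne_zero.2 one_ne_zero)]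

theorem sum_quadraticChar_quadratic (hk : ringChar k ≠ 2) {A B C : k} (hA : A ≠ 0)
    (hD : B ^ 2 - 4 * A * C ≠ 0) :
    ∑ x : k, quadraticChar k (A * x ^ 2 + B * x + C) = -quadraticChar k A := by
  have h2 : (2 : k) ≠ 0 := Ring.two_ne_zero hk
  have h2A : 2 * A ≠ 0 := mul_ne_zero h2 hA
  have e : ∀ x : k, quadraticChar k (A * x ^ 2 + B * x + C) =
      quadraticChar k A * quadraticChar k ((2 * A * x + B) ^ 2 - (B ^ 2 - 4 * A * C)) := by
    intro x
    have : (2 * A * x + B) ^ 2 - (B ^ 2 - 4 * A * C) = 2 ^ 2 * A * (A * x ^ 2 + B * x + C) := by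
      ring
    rw [this, map_mul, map_mul, quadraticChar_sq_one' h2]
    have := quadraticChar_sq_one hA
    linear_combination -(quadraticChar k (A * x ^ 2 + B * x + C)) * this
  have e2 : ∑ x : k, quadraticChar k ((2 * A * x + B) ^ 2 - (B ^ 2 - 4 * A * C)) =
      ∑ y : k, quadraticChar k (y ^ 2 - (B ^ 2 - 4 * A * C)) :=
    Fintype.sum_equiv ((Equiv.mulLeft₀ (2 * A) h2A).trans (Equiv.addRight B)) _ _ fun _ => rfl
  rw [Finset.sum_congr rfl fun x _ => e x, ← Finset.mul_sum, e2, sum_quadraticChar_sq_sub hk hD]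
  ring

end Quadratic

end KummerL

end

noncomputable section

namespace KummerL

/-! ### Logarithmic derivatives of power series -/

section LogDeriv

open PowerSeries

variable {R : Type*} [CommRing R]

/-- `S` is the logarithmic derivative `X A' / A` of the power series `A`. -/
def HasLogDeriv (A S : R⟦X⟧) : Prop := X * derivative R A = A * S

theorem HasLogDeriv.mul {A B S T : R⟦X⟧} (hA : HasLogDeriv A S) (hB : HasLogDeriv B T) :
    HasLogDeriv (A * B) (S + T) := by
  unfold HasLogDeriv at *
  rw [Derivation.leibniz, smul_eq_mul, smul_eq_mul]
  linear_combination B * hA + A * hB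

theorem hasLogDeriv_one : HasLogDeriv (1 : R⟦X⟧) 0 := by
  simp [HasLogDeriv]

theorem HasLogDeriv.prod {ι : Type*} (s : Finset ι) {A S : ι → R⟦X⟧}
    (h : ∀ i ∈ s, HasLogDeriv (A i) (S i)) : HasLogDeriv (∏ i ∈ s, A i) (∑ i ∈ s, S i) := by
  classical
  induction s using Finset.induction_on with
  | empty => simpa using hasLogDeriv_one
  | insert a s ha ih =>
    rw [Finset.prod_insert ha, Finset.sum_insert ha]
    exact (h a (Finset.mem_insert_self a s)).mul
      (ih fun i hi => h i (Finset.mem_insert_of_mem hi))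

theorem HasLogDeriv.of_mul_eq_one {A B S : R⟦X⟧} (hA : HasLogDeriv A S) (hAB : A * B = 1) :
    HasLogDeriv B (-S) := by
  unfold HasLogDeriv at *
  have h := congrArg (derivative R) hAB
  rw [Derivation.leibniz, smul_eq_mul, smul_eq_mul, derivative_one] at h
  linear_combination (X * B) * h - (X * derivative R B) * hAB - B ^ 2 * hA - S * B * hAB

/-- Chain rule for the operator T d/dT under the substitution of T^e for T. -/
theorem X_mul_derivative_expand (e : ℕ) (he : e ≠ 0) (A : R⟦X⟧) :
    X * derivative R (expand e he A) = (e : R⟦X⟧) * expand e he (X * derivative R A) := by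
  ext n
  rw [show (e : R⟦X⟧) = C (e : R) by simp, coeff_C_mul]
  rcases n with - | n
  · simp [zero_pow he]
  · rw [coeff_succ_X_mul, coeff_derivative, coeff_expand, coeff_expand]
    split_ifs with h
    · obtain ⟨j, hj⟩ := h
      rw [hj, Nat.mul_div_cancel_left _ (Nat.pos_of_ne_zero he)]
      rcases j with - | j
      · omega
      · rw [coeff_succ_X_mul, coeff_derivative]
        have : ((n : R) + 1) = e * ((j : R) + 1) := by exact_mod_cast congrArg (Nat.cast (R := R)) hj
        rw [this]
        ring
    · simp

theorem HasLogDeriv.expand {A S : R⟦X⟧} (hA : HasLogDeriv A S) (e : ℕ) (he : e ≠ 0) :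
    HasLogDeriv (expand e he A) ((e : R⟦X⟧) * expand e he S) := by
  unfold HasLogDeriv at *
  rw [X_mul_derivative_expand, hA, map_mul]
  ring

theorem HasLogDeriv.map {R' : Type*} [CommRing R'] (φ : R →+* R') {A S : R⟦X⟧}
    (hA : HasLogDeriv A S) : HasLogDeriv (A.map φ) (S.map φ) := by
  unfold HasLogDeriv at *
  rw [← map_mul, ← hA, map_mul, map_X]
  congr 1
  ext n
  simp [coeff_derivative]

theorem HasLogDeriv.coeff_eq {A S : R⟦X⟧} (hA : HasLogDeriv A S) (n : ℕ) :
    (n : R) * coeff n A = ∑ i ∈ Finset.HasAntidiagonal.antidiagonal n, coeff i.1 A * coeff i.2 S := by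
  have := congrArg (coeff n) hA
  rw [← coeff_mul, ← this]
  rcases n with - | n
  · simp
  · rw [coeff_succ_X_mul, coeff_derivative]
    push_cast
    ring

theorem HasLogDeriv.coeff_zero {A S : R⟦X⟧} (hA : HasLogDeriv A S)
    (h0 : constantCoeff A = 1) : coeff 0 S = 0 := by
  have := hA.coeff_eq 0
  simpa [h0] using this.symm

/-- The first coefficients of a power series with constant coefficient `1` are determined by those
of its logarithmic derivative. -/
theorem HasLogDeriv.coeff_unique [IsDomain R] [CharZero R] {A B S T : R⟦X⟧}
    (hA : HasLogDeriv A S) (hB : HasLogDeriv B T) (hA0 : constantCoeff A = 1)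
    (hB0 : constantCoeff B = 1) {N : ℕ} (hST : ∀ n ≤ N, coeff n S = coeff n T) :
    ∀ n ≤ N, coeff n A = coeff n B := by
  intro n
  induction n using Nat.strong_induction_on with
  | _ n ih =>
    intro hn
    rcases Nat.eq_zero_or_pos n with rfl | hpos
    · rw [coeff_zero_eq_constantCoeff, hA0, hB0]
    · apply mul_left_cancel₀ (Nat.cast_ne_zero (R := R).2 hpos.ne')
      rw [hA.coeff_eq, hB.coeff_eq]
      refine Finset.sum_congr rfl fun i hi => ?_
      rw [Finset.HasAntidiagonal.mem_antidiagonal] at hi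
      -- In the recursion n aₙ = ∑ aᵢ sₙ₋ᵢ the only term containing aₙ itself carries s₀, which is
      -- 0.
      rcases Nat.eq_zero_or_pos i.2 with h0 | h0
      · rw [h0, hA.coeff_zero hA0, hB.coeff_zero hB0, mul_zero, mul_zero]
      · rw [ih i.1 (by omega) (by omega), hST i.2 (by omega)]

theorem hasLogDeriv_one_sub (a : R) :
    HasLogDeriv (1 - C a * X) (mk fun m => if m = 0 then 0 else -a ^ m) := by
  unfold HasLogDeriv
  have hd : derivative R (1 - C a * X) = -C a := by
    rw [map_sub, Derivation.leibniz, derivative_one, derivative_X, derivative_C]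
    simp
  ext n
  rw [hd, sub_mul, one_mul, mul_assoc, map_sub, coeff_C_mul, mul_neg, map_neg, mul_comm X (C a),
    coeff_C_mul]
  rcases n with - | - | n
  · simp
  · simp
  · rw [coeff_succ_X_mul, coeff_X]
    simp [pow_succ]
    ring

end LogDeriv

/-! ### Newton's identities as a logarithmic derivative -/

section Newton

open PowerSeries

theorem hasLogDeriv_mk_monicSum {k : Type*} [Field k] [Finite k] {R : Type*} [CommRing R]
    {h : Polynomial k → R} (h1 : h 1 = 1)
    (hmul : ∀ a b : Polynomial k, a.Monic → b.Monic → h (a * b) = h a * h b) :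
    HasLogDeriv (mk (monicSum h)) (mk fun m => if m = 0 then 0 else irreducibleSum h m) := by
  unfold HasLogDeriv
  ext n
  have e : coeff n (X * derivative R (mk (monicSum h))) = n * monicSum h n := by
    rcases n with - | n
    · simp
    · rw [coeff_succ_X_mul, coeff_derivative, coeff_mk]
      push_cast
      ring
  rw [e, natCast_mul_monicSum h1 hmul, coeff_mul, ← Finset.Nat.sum_antidiagonal_swap]
  simp only [Prod.fst_swap, Prod.snd_swap, coeff_mk]
  rw [Finset.Nat.sum_antidiagonal_eq_sum_range_succ
    (fun i j => monicSum h j * if i = 0 then 0 else irreducibleSum h i)]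
  refine Finset.sum_subset_zero_on_sdiff (fun i hi => ?_) (fun i hi => ?_) (fun i hi => ?_)
  · rw [Finset.mem_Icc] at hi
    exact Finset.mem_range.2 (by omega)
  · rw [Finset.mem_sdiff, Finset.mem_range, Finset.mem_Icc] at hi
    rw [if_pos (by omega), mul_zero]
  · rw [Finset.mem_Icc] at hi
    rw [if_neg (by omega)]

end Newton

end KummerL

end

noncomputable section

namespace KummerL
open Polynomial

/-! ### Point counts on `y² = x (x² + a x + b)` over extensions of a finite field -/

section Cubic

variable {k : Type*} [Field k] [Fintype k] [DecidableEq k]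

/-- The sum of the values `λ(x (x² + a x + b))` of the quadratic character. -/
def cubicSum (a b : k) : ℤ := ∑ x : k, quadraticChar k (x * (x ^ 2 + a * x + b))

/-- The polynomial `X (X² + a X + b)`. -/
def cubicPoly {k : Type*} [Field k] (a b : k) : k[X] := X * (X ^ 2 + C a * X + C b)

theorem natDegree_quadratic {k : Type*} [Field k] (a b : k) :
    (X ^ 2 + C a * X + C b).natDegree = 2 := by
  compute_degree!

theorem monic_quadratic {k : Type*} [Field k] (a b : k) : (X ^ 2 + C a * X + C b).Monic := by
  rw [Monic, leadingCoeff, natDegree_quadratic]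
  simp

theorem monic_cubicPoly {k : Type*} [Field k] (a b : k) : (cubicPoly a b).Monic :=
  monic_X.mul (monic_quadratic a b)

theorem natDegree_cubicPoly {k : Type*} [Field k] (a b : k) : (cubicPoly a b).natDegree = 3 := by
  rw [cubicPoly, monic_X.natDegree_mul (monic_quadratic a b), natDegree_X, natDegree_quadratic]

/-- The right side is a quadratic form in u - a and w - b. As a quadratic polynomial in u - a it has
leading coefficient b and discriminant (w - b)² (a² - 4b), which makes the character sum over u
computable. -/
theorem resultant_quadratic_quadratic {k : Type*} [Field k] (u w a b : k) :
    resultant (X ^ 2 + C u * X + C w) (X ^ 2 + C a * X + C b) =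
      b * (u - a) ^ 2 - a * (w - b) * (u - a) + (w - b) ^ 2 := by
  rw [natDegree_quadratic, natDegree_quadratic, resultant]
  have h : sylvester (X ^ 2 + C u * X + C w) (X ^ 2 + C a * X + C b) 2 2 =
      !![b, 0, w, 0; a, b, u, w; 1, a, 1, u; 0, 1, 0, 1] := by
    ext i j
    fin_cases i <;> fin_cases j <;>
      simp [sylvester, Fin.addCases, coeff_X, coeff_C]
  rw [h, Matrix.det_succ_row_zero]
  simp [Fin.sum_univ_succ, Matrix.det_fin_three, Matrix.submatrix, Fin.succAbove]
  ring

theorem resultant_quadratic_cubicPoly {k : Type*} [Field k] (u w a b : k) :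
    resultant (X ^ 2 + C u * X + C w) (cubicPoly a b) =
      w * (b * (u - a) ^ 2 - a * (w - b) * (u - a) + (w - b) ^ 2) := by
  have h1 : resultant (X ^ 2 + C u * X + C w) (X : k[X]) = w := by
    have := resultant_X_sub_C_right (X ^ 2 + C u * X + C w) 2 0 (natDegree_quadratic u w).le
    rw [C_0, sub_zero] at this
    rw [natDegree_quadratic, natDegree_X, this]
    simp
  have h2 := resultant_mul_right (X ^ 2 + C u * X + C w) X (X ^ 2 + C a * X + C b) 2
    (natDegree_quadratic u w).le
  have h3 := resultant_quadratic_quadratic u w a b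
  rw [natDegree_quadratic] at h1 h3
  rw [h1, h3] at h2
  rw [natDegree_cubicPoly, ← h2, natDegree_quadratic, natDegree_quadratic, natDegree_X]
  rfl

/-- For fixed w ≠ b the sum over u is that of a quadratic polynomial with nonzero discriminant,
giving -λ(b) λ(w). For w = b the quadratic degenerates to by² and there is an extra q. Summing over
w kills the first part and leaves q. -/
theorem monicSum_cubic_two (hk : ringChar k ≠ 2) {a b : k} (hb : b ≠ 0)
    (hab : a ^ 2 - 4 * b ≠ 0) :
    monicSum (resultantChar (quadraticChar k) 1 (cubicPoly a b) 1) 2 = Fintype.card k := by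
  rw [monicSum, sum_monicsOfDegree_two]
  have e : ∀ w u : k, resultantChar (quadraticChar k) 1 (cubicPoly a b) 1
      (X ^ 2 + C u * X + C w) = quadraticChar k w *
        quadraticChar k (b * (u - a) ^ 2 + -(a * (w - b)) * (u - a) + (w - b) ^ 2) := by
    intro w u
    rw [resultantChar, resultant_quadratic_cubicPoly, natDegree_quadratic, resultant_one_right]
    rw [map_mul]
    simp [sub_eq_add_neg]
  have inner : ∀ w : k, ∑ u : k, resultantChar (quadraticChar k) 1 (cubicPoly a b) 1
      (X ^ 2 + C u * X + C w) =
        -quadraticChar k b * quadraticChar k w + if w = b then (Fintype.card k : ℤ) else 0 := by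
    intro w
    have e2 : ∑ u : k, quadraticChar k
          (b * (u - a) ^ 2 + -(a * (w - b)) * (u - a) + (w - b) ^ 2) =
        ∑ y : k, quadraticChar k (b * y ^ 2 + -(a * (w - b)) * y + (w - b) ^ 2) :=
      Fintype.sum_equiv (Equiv.subRight a) _ _ fun _ => rfl
    rw [Finset.sum_congr rfl fun u _ => e w u, ← Finset.mul_sum, e2]
    split_ifs with hw
    · subst hw
      have : ∀ y : k, quadraticChar k (w * y ^ 2 + -(a * (w - w)) * y + (w - w) ^ 2) =
          quadraticChar k w * (1 - if y = 0 then 1 else 0) := by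
        intro y
        simp only [sub_self, mul_zero, neg_zero, zero_mul, add_zero, ne_eq, OfNat.ofNat_ne_zero,
          not_false_eq_true, zero_pow, map_mul]
        split_ifs with hy
        · simp [hy]
        · rw [quadraticChar_sq_one' hy]
          ring
      rw [Finset.sum_congr rfl fun y _ => this y, ← Finset.mul_sum, Finset.sum_sub_distrib]
      simp only [Finset.sum_const, Finset.card_univ, mul_one, Finset.sum_ite_eq',
        Finset.mem_univ, if_true, nsmul_eq_mul]
      have := quadraticChar_sq_one hb
      linear_combination ((Fintype.card k : ℤ)) * this
    · have hwb : w - b ≠ 0 := sub_ne_zero.2 hw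
      rw [sum_quadraticChar_quadratic hk hb]
      · ring
      · have : (-(a * (w - b))) ^ 2 - 4 * b * (w - b) ^ 2 = (w - b) ^ 2 * (a ^ 2 - 4 * b) := by ring
        rw [this]
        exact mul_ne_zero (pow_ne_zero _ hwb) hab
  rw [Finset.sum_congr rfl fun w _ => inner w, Finset.sum_add_distrib, ← Finset.mul_sum,
    quadraticChar_sum_zero hk]
  simp

/-- From degree 3 on the coefficients vanish: for a nonsquare c the multiplier is λ(c)³ = -1,
because the cubic has odd degree. Hence the numerator of the zeta function has the form 1 - aT +
qT². -/
theorem mk_monicSum_cubic (hk : ringChar k ≠ 2) {a b : k} (hb : b ≠ 0)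
    (hab : a ^ 2 - 4 * b ≠ 0) :
    PowerSeries.mk (monicSum (resultantChar (quadraticChar k) 1 (cubicPoly a b) 1)) =
      1 + PowerSeries.C (cubicSum a b) * PowerSeries.X +
        PowerSeries.C (Fintype.card k : ℤ) * PowerSeries.X ^ 2 := by
  ext n
  rw [PowerSeries.coeff_mk, map_add, map_add, PowerSeries.coeff_C_mul, PowerSeries.coeff_C_mul,
    PowerSeries.coeff_one, PowerSeries.coeff_X, PowerSeries.coeff_X_pow]
  rcases n with - | - | - | n
  · rw [monicSum, monicsOfDegree_zero, Finset.sum_singleton, resultantChar_one]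
    simp
  · rw [monicSum, sum_monicsOfDegree_one]
    simp only [resultantChar_X_sub_C]
    simp [cubicSum, cubicPoly]
  · rw [monicSum_cubic_two hk hb hab]
    simp
  · obtain ⟨c, hc⟩ := quadraticChar_exists_neg_one' hk
    rw [monicSum_resultantChar_eq_zero _ _ (monic_cubicPoly a b) dvd_rfl (one_dvd _)
      c.ne_zero ?_ (by rw [natDegree_cubicPoly]; omega)]
    · simp
    · rw [hc, natDegree_cubicPoly]
      simp

theorem irreducibleSum_cubic (hk : ringChar k ≠ 2) (a b : k) (L : Type*) [Field L] [Fintype L]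
    [DecidableEq L] [Algebra k L] :
    irreducibleSum (resultantChar (quadraticChar k) 1 (cubicPoly a b) 1) (Module.finrank k L) =
      cubicSum (algebraMap k L a) (algebraMap k L b) := by
  rw [irreducibleSum_resultantChar, cubicSum]
  refine Finset.sum_congr rfl fun x _ => ?_
  rw [map_one, map_one, map_one, mul_one, ← normChar_quadraticChar hk L, normChar_apply]
  simp [cubicPoly]

/-- The logarithmic derivative of `1 - a T + q T²`, where `1 + q - a` is the number of points of
`y² = x (x² + a x + b)`, counts points over extensions. -/
theorem hasLogDeriv_cubic (hk : ringChar k ≠ 2) {a b : k} (hb : b ≠ 0)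
    (hab : a ^ 2 - 4 * b ≠ 0) :
    ∃ S : PowerSeries ℤ, HasLogDeriv (1 - PowerSeries.C (-cubicSum a b) * PowerSeries.X +
        PowerSeries.C (Fintype.card k : ℤ) * PowerSeries.X ^ 2) S ∧
      ∀ (L : Type) [Field L] [Fintype L] [DecidableEq L] [Algebra k L],
        PowerSeries.coeff (Module.finrank k L) S =
          cubicSum (algebraMap k L a) (algebraMap k L b) := by
  refine ⟨PowerSeries.mk fun m => if m = 0 then 0 else irreducibleSum
    (resultantChar (quadraticChar k) 1 (cubicPoly a b) 1) m, ?_, ?_⟩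
  · have := hasLogDeriv_mk_monicSum (resultantChar_one (quadraticChar k) 1 (cubicPoly a b) 1)
      (resultantChar_mul (quadraticChar k) 1 (cubicPoly a b) 1)
    rw [mk_monicSum_cubic hk hb hab] at this
    rw [map_neg, neg_mul, sub_neg_eq_add]
    exact this
  · intro L _ _ _ _
    rw [PowerSeries.coeff_mk, if_neg Module.finrank_pos.ne', irreducibleSum_cubic hk]

end Cubic

end KummerL

end

noncomputable section

namespace KummerL

/-! ### Character sums of the family `y² = x (x² + s x - 4 s)` -/

section CharSum

theorem equiv_mulLeft₀_apply {G : Type*} [GroupWithZero G] (a : G) (ha : a ≠ 0) (x : G) :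
    Equiv.mulLeft₀ a ha x = a * x := rfl

variable {L : Type*} [Field L] [Fintype L]

theorem quadChar_apply [DecidableEq L] (x : L) : quadChar L x = (quadraticChar L x : QBar) := by
  rw [quadChar, MulChar.ringHomComp_apply, eq_intCast]
  congr!

theorem quadChar_sq : quadChar L ^ 2 = 1 := by
  classical
  ext x
  rw [MulChar.pow_apply_coe, quadChar_apply, MulChar.one_apply_coe]
  exact_mod_cast quadraticChar_sq_one x.ne_zero

theorem quadChar_inv : (quadChar L)⁻¹ = quadChar L := by
  rw [inv_eq_iff_mul_eq_one, ← sq, quadChar_sq]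

theorem quadChar_ne_one (hL : ringChar L ≠ 2) : quadChar L ≠ 1 := by
  classical
  obtain ⟨a, ha⟩ := quadraticChar_exists_neg_one' hL
  refine MulChar.ne_one_iff.2 ⟨a, ?_⟩
  rw [quadChar_apply, ha]
  norm_num

theorem quadChar_sq_apply {x : L} (hx : x ≠ 0) : quadChar L x * quadChar L x = 1 := by
  have := DFunLike.congr_fun (quadChar_sq (L := L)) x
  rw [MulChar.pow_apply' _ two_ne_zero, MulChar.one_apply (isUnit_iff_ne_zero.2 hx)] at this
  rwa [← sq]

theorem eq_quadChar_of_sq_eq_one {χ : MulChar L QBar} (h : χ ^ 2 = 1) (h1 : χ ≠ 1) :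
    χ = quadChar L := by
  classical
  have hsq : ∀ y : L, y ≠ 0 → χ (y ^ 2) = 1 := fun y hy => by
    have := DFunLike.congr_fun h y
    rwa [MulChar.pow_apply' _ two_ne_zero, MulChar.one_apply (isUnit_iff_ne_zero.2 hy),
      ← map_pow] at this
  obtain ⟨a, ha⟩ := MulChar.ne_one_iff.1 h1
  have ha' : χ a = -1 := by
    have := hsq a a.ne_zero
    rw [map_pow] at this
    have h0 : (χ a - 1) * (χ a + 1) = 0 := by linear_combination this
    exact eq_neg_of_add_eq_zero_left ((mul_eq_zero.1 h0).resolve_left (sub_ne_zero.2 ha))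
  have hns : quadraticChar L (a : L) = -1 := by
    rw [quadraticChar_neg_one_iff_not_isSquare]
    rintro ⟨b, hb⟩
    have hb0 : b ≠ 0 := by rintro rfl; simp at hb
    rw [hb, ← sq, hsq b hb0] at ha
    exact ha rfl
  ext x
  rw [quadChar_apply]
  rcases quadraticChar_dichotomy x.ne_zero with hx | hx
  · obtain ⟨b, hb⟩ := (quadraticChar_one_iff_isSquare x.ne_zero).1 hx
    have hb0 : b ≠ 0 := by rintro rfl; simp at hb
    rw [hx, hb, ← sq, hsq b hb0]
    simp
  · have hax : quadraticChar L (a * x : L) = 1 := by rw [map_mul, hx, hns]; norm_num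
    obtain ⟨b, hb⟩ := (quadraticChar_one_iff_isSquare (mul_ne_zero a.ne_zero x.ne_zero)).1 hax
    have hb0 : b ≠ 0 := by
      rintro rfl
      simp at hb
    have h2 := hsq b hb0
    rw [sq, ← hb, map_mul, ha'] at h2
    rw [hx]
    push_cast
    linear_combination -h2

instance : Fintype (MulChar L QBar) := Fintype.ofFinite _

open Classical in
/-- The characters `χ` with `χ ^ D = 1`. -/
def torsionChars (L : Type*) [Field L] [Fintype L] (D : ℕ) : Finset (MulChar L QBar) :=
  Finset.univ.filter fun χ => χ ^ D = 1

theorem mem_torsionChars {D : ℕ} {χ : MulChar L QBar} : χ ∈ torsionChars L D ↔ χ ^ D = 1 := by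
  simp [torsionChars]

/-- The character group of a finite abelian group is isomorphic to the group itself. -/
theorem card_torsionChars [DecidableEq L] (D : ℕ) :
    (torsionChars L D).card = (Finset.univ.filter fun u : Lˣ => u ^ D = 1).card := by
  classical
  have : NeZero (Monoid.exponent Lˣ : QBar) := ⟨by
    exact_mod_cast Monoid.exponent_ne_zero_of_finite⟩
  obtain ⟨e⟩ := MulChar.mulEquiv_units L QBar
  refine Finset.card_bij (fun χ _ => e χ) (fun χ hχ => ?_) (fun _ _ _ _ h => e.injective h)
    (fun u hu => ?_)
  · rw [mem_torsionChars] at hχ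
    simp [← map_pow, hχ]
  · refine ⟨e.symm u, ?_, by simp⟩
    rw [mem_torsionChars, ← map_pow, (Finset.mem_filter.1 hu).2, map_one]

/-- Characters of the quotient of `Lˣ` by its D-th powers separate points, and they pull back to
characters killed by D. -/
theorem exists_torsionChar_apply_ne_one {D : ℕ} {s : Lˣ} (hs : ∀ u : Lˣ, u ^ D ≠ s) :
    ∃ χ ∈ torsionChars L D, χ (s : L) ≠ 1 := by
  classical
  have : NeZero (Monoid.exponent (Lˣ ⧸ (powMonoidHom D : Lˣ →* Lˣ).range) : QBar) := ⟨by
    exact_mod_cast Monoid.exponent_ne_zero_of_finite⟩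
  have hne : (QuotientGroup.mk s : Lˣ ⧸ (powMonoidHom D : Lˣ →* Lˣ).range) ≠ 1 := by
    rw [Ne, QuotientGroup.eq_one_iff]
    rintro ⟨u, hu⟩
    exact hs u hu
  obtain ⟨φ, hφ⟩ := CommGroup.exists_apply_ne_one_of_hasEnoughRootsOfUnity
    (Lˣ ⧸ (powMonoidHom D : Lˣ →* Lˣ).range) QBar hne
  refine ⟨MulChar.ofUnitHom (φ.comp (QuotientGroup.mk' _)), ?_, ?_⟩
  · rw [mem_torsionChars]
    ext u
    rw [MulChar.pow_apply_coe, MulChar.ofUnitHom_coe, MulChar.one_apply_coe,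
      ← Units.val_pow_eq_pow_val, ← map_pow]
    have : (QuotientGroup.mk' (powMonoidHom D : Lˣ →* Lˣ).range) (u ^ D) = 1 := by
      rw [QuotientGroup.mk'_apply, QuotientGroup.eq_one_iff]
      exact ⟨u, rfl⟩
    rw [MonoidHom.comp_apply, this, map_one, Units.val_one]
  · rw [MulChar.ofUnitHom_coe]
    intro h
    exact hφ (Units.ext h)

/-- Orthogonality. At a D-th power all terms are 1, and their number is that of the D-th roots of
unity, the size of a fibre. Otherwise multiplication by a character that is nontrivial at s shows
that the sum is 0. -/
theorem sum_torsionChars_apply [DecidableEq L] (D : ℕ) (s : Lˣ) :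
    ∑ χ ∈ torsionChars L D, χ (s : L) =
      ((Finset.univ.filter fun u : Lˣ => u ^ D = s).card : QBar) := by
  classical
  by_cases hs : ∃ u : Lˣ, u ^ D = s
  · obtain ⟨u₀, rfl⟩ := hs
    have h1 : ∀ χ ∈ torsionChars L D, χ ((u₀ ^ D : Lˣ) : L) = 1 := fun χ hχ => by
      rw [mem_torsionChars] at hχ
      rw [Units.val_pow_eq_pow_val, map_pow, ← MulChar.pow_apply_coe, hχ, MulChar.one_apply_coe]
    rw [Finset.sum_congr rfl h1, Finset.sum_const, nsmul_eq_mul, mul_one, card_torsionChars]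
    congr 1
    refine Finset.card_bij (fun u _ => u₀ * u) (fun u hu => ?_) (fun _ _ _ _ h => by simpa using h)
      (fun u hu => ⟨u₀⁻¹ * u, ?_, by simp⟩)
    · simp [mul_pow, (Finset.mem_filter.1 hu).2]
    · simp [mul_pow, (Finset.mem_filter.1 hu).2]
  · push Not at hs
    rw [Finset.filter_false_of_mem fun u _ => hs u, Finset.card_empty, Nat.cast_zero]
    obtain ⟨ψ, hψ, hψs⟩ := exists_torsionChar_apply_ne_one hs
    rw [mem_torsionChars] at hψ
    have : ψ (s : L) * ∑ χ ∈ torsionChars L D, χ (s : L) = ∑ χ ∈ torsionChars L D, χ (s : L) := by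
      rw [Finset.mul_sum]
      refine Finset.sum_bij (fun χ _ => ψ * χ) (fun χ hχ => ?_)
        (fun _ _ _ _ h => by simpa using h) (fun χ hχ => ⟨ψ⁻¹ * χ, ?_, by simp⟩)
        (fun χ _ => by simp)
      · rw [mem_torsionChars] at hχ ⊢
        rw [mul_pow, hψ, hχ, one_mul]
      · rw [mem_torsionChars] at hχ ⊢
        rw [mul_pow, inv_pow, hψ, hχ, inv_one, one_mul]
    have h0 : (ψ (s : L) - 1) * ∑ χ ∈ torsionChars L D, χ (s : L) = 0 := by
      rw [sub_mul, this, one_mul, sub_self]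
    exact (mul_eq_zero.1 h0).resolve_left (sub_ne_zero.2 hψs)

/-- Summation over `D`-th powers by means of the characters of order dividing `D`. -/
theorem sum_units_pow (D : ℕ) [DecidableEq L] (g : L → QBar) :
    ∑ u : Lˣ, g ((u : L) ^ D) = ∑ χ ∈ torsionChars L D, ∑ s : L, χ s * g s := by
  classical
  have h1 : ∀ χ : MulChar L QBar, ∑ s : L, χ s * g s = ∑ s : Lˣ, χ (s : L) * g s := by
    intro χ
    have : ∑ s : L, χ s * g s = ∑ s ∈ Finset.univ.map ⟨((↑) : Lˣ → L), Units.val_injective⟩,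
        χ s * g s := by
      symm
      refine Finset.sum_subset (Finset.subset_univ _) fun s _ hs => ?_
      have : s = 0 := by
        by_contra h
        exact hs (Finset.mem_map.2 ⟨Units.mk0 s h, Finset.mem_univ _, rfl⟩)
      rw [this, MulChar.map_zero, zero_mul]
    rw [this, Finset.sum_map]
    rfl
  rw [Finset.sum_congr rfl fun χ _ => h1 χ, Finset.sum_comm]
  have h2 : ∀ s : Lˣ, ∑ χ ∈ torsionChars L D, χ (s : L) * g s =
      ∑ u ∈ Finset.univ.filter fun u : Lˣ => u ^ D = s, g ((u : L) ^ D) := by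
    intro s
    rw [← Finset.sum_mul, sum_torsionChars_apply, ← nsmul_eq_mul, ← Finset.sum_const]
    refine Finset.sum_congr rfl fun u hu => ?_
    rw [← (Finset.mem_filter.1 hu).2, Units.val_pow_eq_pow_val]
  rw [Finset.sum_congr rfl fun s _ => h2 s]
  exact (Finset.sum_fiberwise (s := Finset.univ) (g := fun u : Lˣ => u ^ D)
    (f := fun u => g ((u : L) ^ D))).symm

/-- `B(χ) = χ²(4) J(χ, χ) J(λ χ², χ⁻¹)`. -/
def charB (χ : MulChar L QBar) : QBar :=
  (χ ^ 2) 4 * jacobiSum χ χ * jacobiSum (quadChar L * χ ^ 2) χ⁻¹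

variable [DecidableEq L]

theorem sum_quadChar_comp_sq (hL : ringChar L ≠ 2) (g : L → QBar) :
    ∑ y : L, g (y ^ 2) = ∑ s : L, (1 + quadChar L s) * g s := by
  rw [sum_comp_sq hL]
  simp only [quadChar_apply]

/-- Evaluate ∑ χ(1 - y²) in two ways: through s = y², and through y = 2u - 1, for which 1 - y² =
4u(1 - u). -/
theorem jacobiSum_quadChar (hL : ringChar L ≠ 2) {χ : MulChar L QBar} (hχ : χ ≠ 1) :
    jacobiSum χ (quadChar L) = χ 4 * jacobiSum χ χ := by
  have h2 : (2 : L) ≠ 0 := Ring.two_ne_zero hL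
  have h4 : (4 : L) ≠ 0 := by
    have : (4 : L) = 2 * 2 := by norm_num
    rw [this]
    exact mul_ne_zero h2 h2
  have e1 : ∑ y : L, χ (1 - y ^ 2) = jacobiSum χ (quadChar L) := by
    rw [sum_quadChar_comp_sq hL fun s => χ (1 - s)]
    simp only [add_mul, one_mul, Finset.sum_add_distrib]
    rw [jacobiSum_comm, jacobiSum]
    have : ∑ s : L, χ (1 - s) = 0 := by
      rw [← MulChar.sum_eq_zero_of_ne_one hχ]
      exact Fintype.sum_equiv (Equiv.subLeft 1) _ _ fun _ => rfl
    rw [this, zero_add]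
  have e2 : ∑ y : L, χ (1 - y ^ 2) = ∑ u : L, χ 4 * (χ u * χ (1 - u)) := by
    symm
    refine Fintype.sum_equiv ((Equiv.mulLeft₀ 2 h2).trans (Equiv.subRight 1)) _ _ fun u => ?_
    rw [← map_mul, ← map_mul]
    congr 1
    simp only [Equiv.trans_apply, equiv_mulLeft₀_apply, Equiv.subRight_apply]
    ring
  rw [← e1, e2, ← Finset.mul_sum, jacobiSum]

/-- The cubic x³ - s x (4 - x) is linear in s. For x different from 0 and 4, the substitution s = x²
w / (4 - x) turns it into x³ (1 - w), so the sum over s is J(χ, λ) (λχ²)(x) χ⁻¹(4 - x), and x = 4y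
gives the second Jacobi sum. At x = 4 the cubic has the constant value 64 = 8², which produces the
term ∑ χ(s). -/
theorem sum_char_mul_cubicSum (hL : ringChar L ≠ 2) (χ : MulChar L QBar) :
    ∑ s : L, χ s * (cubicSum s (-4 * s) : QBar) =
      ∑ s : L, χ s +
        χ 4 * jacobiSum χ (quadChar L) * jacobiSum (quadChar L * χ ^ 2) χ⁻¹ := by
  have h2 : (2 : L) ≠ 0 := Ring.two_ne_zero hL
  have h4 : (4 : L) ≠ 0 := by
    have : (4 : L) = 2 * 2 := by norm_num
    rw [this]
    exact mul_ne_zero h2 h2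
  have inner : ∀ x : L, ∑ s : L, χ s * quadChar L (x * (x ^ 2 + s * x + -4 * s)) =
      (if x = 4 then ∑ s : L, χ s else 0) +
        jacobiSum χ (quadChar L) * ((quadChar L * χ ^ 2) x * χ⁻¹ (4 - x)) := by
    intro x
    rcases eq_or_ne x 0 with rfl | hx0
    · simp [h4.symm, MulChar.map_zero]
    rcases eq_or_ne x 4 with rfl | hx4
    · simp only [if_true, sub_self, MulChar.map_zero, mul_zero, add_zero]
      refine Finset.sum_congr rfl fun s _ => ?_
      have : (4 : L) * (4 ^ 2 + s * 4 + -4 * s) = 8 * 8 := by ring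
      have h8 : (8 : L) ≠ 0 := by
        rw [show (8 : L) = 2 * 4 by norm_num]
        exact mul_ne_zero h2 h4
      rw [this, map_mul, quadChar_sq_apply h8, mul_one]
    · have h4x : 4 - x ≠ 0 := sub_ne_zero.2 hx4.symm
      rw [if_neg hx4, zero_add, jacobiSum, Finset.sum_mul]
      have hc : x ^ 2 / (4 - x) ≠ 0 := div_ne_zero (pow_ne_zero _ hx0) h4x
      symm
      refine Fintype.sum_equiv (Equiv.mulLeft₀ _ hc) _ _ fun w => ?_
      simp only [equiv_mulLeft₀_apply]
      have e1 : x * (x ^ 2 + x ^ 2 / (4 - x) * w * x + -4 * (x ^ 2 / (4 - x) * w)) =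
          x * (x * x) * (1 - w) := by
        field_simp
        ring
      have e2 : χ⁻¹ (4 - x) = χ (4 - x)⁻¹ := MulChar.inv_apply' χ _
      rw [e1, e2, div_eq_mul_inv]
      simp only [map_mul, MulChar.mul_apply, map_pow, MulChar.pow_apply' _ two_ne_zero]
      linear_combination -(χ w * quadChar L (1 - w) * quadChar L x * χ x ^ 2 * χ (4 - x)⁻¹) *
        quadChar_sq_apply hx0
  have hcub : ∀ s : L, (cubicSum s (-4 * s) : QBar) =
      ∑ x : L, quadChar L (x * (x ^ 2 + s * x + -4 * s)) := fun s => by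
    rw [cubicSum]
    push_cast
    exact Finset.sum_congr rfl fun x _ => (quadChar_apply _).symm
  have outer : ∑ x : L, (quadChar L * χ ^ 2) x * χ⁻¹ (4 - x) =
      χ 4 * jacobiSum (quadChar L * χ ^ 2) χ⁻¹ := by
    rw [jacobiSum, Finset.mul_sum]
    symm
    refine Fintype.sum_equiv (Equiv.mulLeft₀ 4 h4) _ _ fun y => ?_
    simp only [equiv_mulLeft₀_apply]
    have e : (4 : L) - 4 * y = 4 * (1 - y) := by ring
    have h41 : (4 : L) = 2 * 2 := by norm_num
    have hq : quadChar L (4 : L) = 1 := by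
      rw [h41, map_mul, quadChar_sq_apply h2]
    have hχ : χ 4 * χ⁻¹ 4 = 1 := by
      rw [← MulChar.mul_apply, mul_inv_cancel, MulChar.one_apply (isUnit_iff_ne_zero.2 h4)]
    rw [e, map_mul, map_mul]
    simp only [MulChar.mul_apply, MulChar.pow_apply' _ two_ne_zero, hq]
    linear_combination -(χ 4 * quadChar L y * χ y ^ 2 * χ⁻¹ (1 - y)) * hχ
  simp only [hcub, Finset.mul_sum]
  rw [Finset.sum_comm, Finset.sum_congr rfl fun x _ => inner x, Finset.sum_add_distrib,
    ← Finset.mul_sum, outer]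
  simp only [Finset.sum_ite_eq', Finset.mem_univ, if_true]
  ring

end CharSum

end KummerL

end

noncomputable section

namespace KummerL

/-! ### Contribution of each character, and the sum over the family -/

section FamilySum

variable {L : Type*} [Field L] [Fintype L]

theorem charB_quadChar (hL : ringChar L ≠ 2) : charB (quadChar L) = 1 := by
  have h2 : (2 : L) ≠ 0 := Ring.two_ne_zero hL
  have h4 : (4 : L) ≠ 0 := by
    have : (4 : L) = 2 * 2 := by norm_num
    rw [this]
    exact mul_ne_zero h2 h2
  have hJ := jacobiSum_nontrivial_inv (quadChar_ne_one hL)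
  rw [quadChar_inv] at hJ
  rw [charB, quadChar_sq, mul_one, quadChar_inv, hJ, MulChar.one_apply (isUnit_iff_ne_zero.2 h4)]
  have := quadChar_sq_apply (neg_ne_zero.2 (one_ne_zero (α := L)))
  linear_combination this

theorem torsionChars_two :
    open Classical in torsionChars L 2 = {1, quadChar L} := by
  classical
  ext χ
  rw [mem_torsionChars, Finset.mem_insert, Finset.mem_singleton]
  constructor
  · intro h
    by_cases h1 : χ = 1
    · exact Or.inl h1
    · exact Or.inr (eq_quadChar_of_sq_eq_one h h1)
  · rintro (rfl | rfl)
    · simp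
    · exact quadChar_sq

variable [DecidableEq L]

theorem sum_char_mul_cubicSum_of_ne_one (hL : ringChar L ≠ 2) {χ : MulChar L QBar} (hχ : χ ≠ 1) :
    ∑ s : L, χ s * (cubicSum s (-4 * s) : QBar) = charB χ := by
  rw [sum_char_mul_cubicSum hL, MulChar.sum_eq_zero_of_ne_one hχ, jacobiSum_quadChar hL hχ, charB,
    MulChar.pow_apply' _ two_ne_zero]
  ring

/-- The trivial character vanishes at 0, so both Jacobi sums are -1 and ∑ χ(s) is |L| - 1. -/
theorem sum_char_mul_cubicSum_one (hL : ringChar L ≠ 2) :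
    ∑ s : L, (1 : MulChar L QBar) s * (cubicSum s (-4 * s) : QBar) = Fintype.card L := by
  have h2 : (2 : L) ≠ 0 := Ring.two_ne_zero hL
  have h4 : (4 : L) ≠ 0 := by
    have : (4 : L) = 2 * 2 := by norm_num
    rw [this]
    exact mul_ne_zero h2 h2
  have hcard : ((Fintype.card Lˣ : ℕ) : QBar) + 1 = Fintype.card L := by
    have := Fintype.card_units L
    have := Fintype.card_pos (α := L)
    rw [← Nat.cast_succ]
    congr 1
    omega
  rw [sum_char_mul_cubicSum hL, MulChar.sum_one_eq_card_units,
    jacobiSum_one_nontrivial (quadChar_ne_one hL), one_pow, mul_one, inv_one, jacobiSum_comm,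
    jacobiSum_one_nontrivial (quadChar_ne_one hL), MulChar.one_apply (isUnit_iff_ne_zero.2 h4),
    ← hcard]
  ring

/-- Here λχ² is trivial, so the second Jacobi sum degenerates to -1. Moreover λ(-1) = χ(-1)² = 1, so
4 - s may be replaced by s - 4. -/
theorem charB_of_sq_eq_quadChar (hL : ringChar L ≠ 2) {χ : MulChar L QBar}
    (hχ : χ ^ 2 = quadChar L) :
    charB χ = -∑ s : L, χ s * quadChar L (s - 4) := by
  have h2 : (2 : L) ≠ 0 := Ring.two_ne_zero hL
  have h41 : (4 : L) = 2 * 2 := by norm_num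
  have h4 : (4 : L) ≠ 0 := by
    rw [h41]
    exact mul_ne_zero h2 h2
  have hχ1 : χ ≠ 1 := by
    rintro rfl
    exact quadChar_ne_one hL (by simpa using hχ.symm)
  have hneg : quadChar L (-1) = 1 := by
    rw [← hχ, MulChar.pow_apply' _ two_ne_zero, ← map_pow, neg_one_sq, map_one]
  have hq4 : quadChar L (4 : L) = 1 := by rw [h41, map_mul, quadChar_sq_apply h2]
  have e : ∑ s : L, χ s * quadChar L (s - 4) = χ 4 * jacobiSum χ (quadChar L) := by
    rw [jacobiSum, Finset.mul_sum]
    symm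
    refine Fintype.sum_equiv (Equiv.mulLeft₀ 4 h4) _ _ fun y => ?_
    simp only [equiv_mulLeft₀_apply]
    have : 4 * y - 4 = 4 * (-1 * (1 - y)) := by ring
    rw [this, map_mul, map_mul, map_mul, hneg, hq4]
    ring
  have hinv : χ⁻¹ ≠ 1 := by simpa using hχ1
  rw [e, jacobiSum_quadChar hL hχ1, charB, MulChar.pow_apply' _ two_ne_zero, hχ, ← sq, quadChar_sq,
    jacobiSum_one_nontrivial hinv]
  ring

/-- By orthogonality the sum is minus the difference of ∑ λ(u⁴ - 4) and ∑ λ(u² - 4) over units u.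
Writing u⁴ = (u²)² leaves ∑ λ(x) λ(x² - 4), the character sum of y² = x(x² - 4), which is the fibre
at t = 0 for even d. -/
theorem sum_charB_order_four (hL : ringChar L ≠ 2) :
    open Classical in ∑ χ ∈ torsionChars L 4 \ torsionChars L 2, charB χ =
      -(cubicSum (0 : L) (-4) : QBar) := by
  classical
  have hsub : torsionChars L 2 ⊆ torsionChars L 4 := fun χ hχ => by
    rw [mem_torsionChars] at hχ ⊢
    rw [show 4 = 2 * 2 from rfl, pow_mul, hχ, one_pow]
  have h1 : ∀ χ ∈ torsionChars L 4 \ torsionChars L 2,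
      charB χ = -∑ s : L, χ s * quadChar L (s - 4) := fun χ hχ => by
    rw [Finset.mem_sdiff, mem_torsionChars, mem_torsionChars] at hχ
    apply charB_of_sq_eq_quadChar hL
    refine eq_quadChar_of_sq_eq_one ?_ hχ.2
    rw [← pow_mul]
    exact hχ.1
  rw [Finset.sum_congr rfl h1, Finset.sum_neg_distrib,
    Finset.sum_sdiff_eq_sub hsub, ← sum_units_pow, ← sum_units_pow]
  congr 1
  have hun : ∀ g : L → QBar, ∑ u : Lˣ, g u = ∑ x : L, g x - g 0 := by
    intro g
    have : ∑ u : Lˣ, g u = ∑ x ∈ Finset.univ.map ⟨((↑) : Lˣ → L), Units.val_injective⟩, g x := by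
      rw [Finset.sum_map]
      rfl
    rw [this, eq_sub_iff_add_eq, ← Finset.sum_singleton g (0 : L), ← Finset.sum_union]
    · congr 1
      ext x
      simp only [Finset.mem_union, Finset.mem_map, Finset.mem_univ, true_and,
        Finset.mem_singleton, iff_true]
      by_cases hx : x = 0
      · exact Or.inr hx
      · exact Or.inl ⟨Units.mk0 x hx, rfl⟩
    · rw [Finset.disjoint_singleton_right]
      simp
  rw [hun fun u => quadChar L (u ^ 4 - 4), hun fun u => quadChar L (u ^ 2 - 4)]
  have h4 : ∑ x : L, quadChar L (x ^ 4 - 4) =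
      ∑ x : L, (1 + quadChar L x) * quadChar L (x ^ 2 - 4) := by
    rw [← sum_quadChar_comp_sq hL fun s => quadChar L (s ^ 2 - 4)]
    exact Finset.sum_congr rfl fun x _ => by ring_nf
  rw [h4]
  simp only [add_mul, one_mul, Finset.sum_add_distrib, cubicSum]
  push_cast
  have h5 : ∀ x : L, (quadraticChar L (x * (x ^ 2 + 0 * x + -4)) : QBar) =
      quadChar L x * quadChar L (x ^ 2 - 4) := fun x => by
    rw [← quadChar_apply, ← map_mul]
    congr 1
    ring
  rw [Finset.sum_congr rfl fun x _ => h5 x]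
  simp

/-- The sum of the point counts in the family `y² = x (x² + t^(2d) x - 4 t^(2d))`. -/
theorem sum_cubicSum_family (hL : ringChar L ≠ 2) (d : ℕ) :
    open Classical in ∑ u : Lˣ, (cubicSum ((u : L) ^ (2 * d)) (-4 * (u : L) ^ (2 * d)) : QBar) +
        (if Even d then (cubicSum (0 : L) (-4) : QBar) else 0) =
      Fintype.card L + 1 + ∑ χ ∈ torsionChars L (2 * d) \ torsionChars L 4, charB χ := by
  classical
  set G : MulChar L QBar → QBar := fun χ => ∑ s : L, χ s * (cubicSum s (-4 * s) : QBar) with hG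
  have hsum : ∑ u : Lˣ, (cubicSum ((u : L) ^ (2 * d)) (-4 * (u : L) ^ (2 * d)) : QBar) =
      ∑ χ ∈ torsionChars L (2 * d), G χ :=
    sum_units_pow (2 * d) fun s => (cubicSum s (-4 * s) : QBar)
  have hG1 : ∀ χ, χ ≠ 1 → G χ = charB χ := fun χ hχ => sum_char_mul_cubicSum_of_ne_one hL hχ
  have hone : ∀ D, (1 : MulChar L QBar) ∈ torsionChars L D := fun D => by
    rw [mem_torsionChars, one_pow]
  have h24 : torsionChars L 2 ⊆ torsionChars L 4 := fun χ hχ => by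
    rw [mem_torsionChars] at hχ ⊢
    rw [show 4 = 2 * 2 from rfl, pow_mul, hχ, one_pow]
  have h2d : torsionChars L 2 ⊆ torsionChars L (2 * d) := fun χ hχ => by
    rw [mem_torsionChars] at hχ ⊢
    rw [pow_mul, hχ, one_pow]
  have hT2 : ∑ χ ∈ torsionChars L 2, G χ = Fintype.card L + 1 := by
    rw [torsionChars_two, Finset.sum_pair (quadChar_ne_one hL).symm,
      hG1 _ (quadChar_ne_one hL), charB_quadChar hL]
    congr 1
    exact sum_char_mul_cubicSum_one hL
  have hT4 : ∀ s : Finset (MulChar L QBar), s ⊆ Finset.univ \ torsionChars L 2 →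
      ∑ χ ∈ s, G χ = ∑ χ ∈ s, charB χ := fun s hs =>
    Finset.sum_congr rfl fun χ hχ => hG1 χ (by
      rintro rfl
      exact (Finset.mem_sdiff.1 (hs hχ)).2 (hone 2))
  have hdiff : ∑ χ ∈ torsionChars L (2 * d) \ torsionChars L 4, G χ =
      ∑ χ ∈ torsionChars L (2 * d) \ torsionChars L 4, charB χ :=
    hT4 _ fun χ hχ => Finset.mem_sdiff.2
      ⟨Finset.mem_univ _, fun h => (Finset.mem_sdiff.1 hχ).2 (h24 h)⟩
  rw [hsum, ← hdiff, ← hT2]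
  -- For even d the characters of order four cancel the fibre at 0; for odd d there are none, since
  -- gcd(2d, 4) = 2.
  split_ifs with hd
  · have h4d : torsionChars L 4 ⊆ torsionChars L (2 * d) := fun χ hχ => by
      rw [mem_torsionChars] at hχ ⊢
      obtain ⟨e, rfl⟩ := hd
      rw [show 2 * (e + e) = 4 * e by ring, pow_mul, hχ, one_pow]
    have hfour : ∑ χ ∈ torsionChars L 4 \ torsionChars L 2, G χ =
        -(cubicSum (0 : L) (-4) : QBar) := by
      rw [hT4 _ (Finset.sdiff_subset_sdiff (Finset.subset_univ _) le_rfl),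
        sum_charB_order_four hL]
    rw [← Finset.sum_sdiff h4d, ← Finset.sum_sdiff h24, hfour]
    ring
  · have : torsionChars L (2 * d) \ torsionChars L 4 = torsionChars L (2 * d) \ torsionChars L 2 := by
      ext χ
      rw [Finset.mem_sdiff, Finset.mem_sdiff]
      refine and_congr_right fun h => not_congr ⟨fun h4 => ?_, fun h2 => h24 h2⟩
      rw [mem_torsionChars] at h h4 ⊢
      have := Nat.not_even_iff_odd.1 hd
      have hgcd : Nat.gcd (2 * d) 4 = 2 := by
        rw [show 4 = 2 * 2 from rfl, Nat.gcd_mul_left, (Nat.coprime_two_right.2 this).gcd_eq_one]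
      rw [← hgcd]
      exact pow_gcd_eq_one.2 ⟨h, h4⟩
    rw [this, add_zero, ← Finset.sum_sdiff h2d, add_comm]

end FamilySum

end KummerL

end

noncomputable section

namespace KummerL

/-! ### Minimal Weierstrass models -/

section Minimal

open WeierstrassCurve IsDiscreteValuationRing IsDedekindDomain.HeightOneSpectrum

/-- A change of variables gives a bijection between the affine points of two curves. -/
def affinePointsEquiv {k : Type*} [Field k] (W : WeierstrassCurve k) (C : VariableChange k) :
    {P : k × k // (C • W).toAffine.Equation P.1 P.2} ≃
      {P : k × k // W.toAffine.Equation P.1 P.2} :=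
  have hu : (C.u : k) ≠ 0 := C.u.ne_zero
  have key : ∀ x y : k, (C • W).toAffine.Equation x y ↔
      W.toAffine.Equation ((C.u : k) ^ 2 * x + C.r)
        ((C.u : k) ^ 3 * y + (C.u : k) ^ 2 * C.s * x + C.t) := by
    intro x y
    rw [Affine.equation_iff', Affine.equation_iff']
    simp only [variableChange_a₁, variableChange_a₂, variableChange_a₃, variableChange_a₄,
      variableChange_a₆, Units.val_inv_eq_inv_val]
    rw [← mul_right_inj' (pow_ne_zero 6 hu), mul_zero]
    refine Eq.congr ?_ rfl
    field_simp
    ring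
  { toFun P := ⟨((C.u : k) ^ 2 * P.1.1 + C.r,
      (C.u : k) ^ 3 * P.1.2 + (C.u : k) ^ 2 * C.s * P.1.1 + C.t), (key _ _).1 P.2⟩
    invFun P := ⟨((P.1.1 - C.r) / (C.u : k) ^ 2,
      (P.1.2 - C.t - C.s * (P.1.1 - C.r)) / (C.u : k) ^ 3), by
        rw [key]
        convert P.2 using 1
        · field_simp
          ring
        · field_simp
          ring⟩
    left_inv P := by
      ext
      · simp only
        field_simp
        ring
      · simp only
        field_simp
        ring
    right_inv P := by
      ext
      · simp only
        field_simp
        ring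
      · simp only
        field_simp
        ring }

theorem mem_range_of_mul_mem {R K : Type*} [CommRing R] [Field K] [Algebra R K] {x : K}
    {c : R} (hc : IsUnit c)
    (h : ∃ y : R, algebraMap R K y = algebraMap R K c * x) : ∃ y : R, algebraMap R K y = x := by
  obtain ⟨y, hy⟩ := h
  obtain ⟨c, rfl⟩ := hc
  refine ⟨((c⁻¹ : Rˣ) : R) * y, ?_⟩
  rw [map_mul, hy, ← mul_assoc, ← map_mul, Units.inv_mul, map_one, one_mul]

variable {R : Type*} [CommRing R] [IsDomain R] [IsDiscreteValuationRing R]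
  {K : Type*} [Field K] [Algebra R K] [IsFractionRing R K]

theorem valuation_Δ_le_of_isMinimal {W : WeierstrassCurve K} [IsMinimal R W]
    (C : VariableChange K) [h : IsIntegral R (C • W)] :
    (maximalIdeal R).valuation K (C • W).Δ ≤ (maximalIdeal R).valuation K W.Δ := by
  have hmax := (IsMinimal.val_Δ_maximal (R := R) (W := W))
  have hle : valuation_Δ_aux R (C • W) ≤ valuation_Δ_aux R W := by
    rcases le_total (valuation_Δ_aux R (C • W)) (valuation_Δ_aux R W) with h1 | h1
    · exact h1
    · have := hmax.2 (j := C) h (by simpa using h1)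
      simpa using this
  have hle' : (valuation_Δ_aux R (C • W) : WithZero (Multiplicative ℤ)) ≤ valuation_Δ_aux R W := hle
  rwa [valuation_Δ_aux_eq_of_isIntegral, valuation_Δ_aux_eq_of_isIntegral] at hle'

/-- Over a discrete valuation ring in which `2` is a unit, a change of variables from an integral
model with `c₄` a unit or the discriminant not divisible by `π ^ 12` to a minimal model is
integral. -/
theorem exists_integral_variableChange (h2 : IsUnit (2 : R)) {W₀ W₁ : WeierstrassCurve R}
    (hΔ : W₀.Δ ≠ 0) (h₀ : IsUnit W₀.c₄ ∨ W₀.Δ ∉ IsLocalRing.maximalIdeal R ^ 12)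
    {C : VariableChange K} (hC : C • W₀.map (algebraMap R K) = W₁.map (algebraMap R K))
    [IsMinimal R (W₁.map (algebraMap R K))] :
    ∃ C₀ : VariableChange R, C₀ • W₀ = W₁ := by
  have hinj : Function.Injective (algebraMap R K) := IsFractionRing.injective R K
  have hu0 : (C.u : K) ≠ 0 := C.u.ne_zero
  have hΔK : algebraMap R K W₀.Δ ≠ 0 := fun h => hΔ (hinj (by rw [h, map_zero]))
  have hΔ1 : algebraMap R K W₁.Δ = ((C.u : K)⁻¹) ^ 12 * algebraMap R K W₀.Δ := by
    rw [← map_Δ, ← map_Δ, ← hC, variableChange_Δ, Units.val_inv_eq_inv_val]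
  have hC' : C⁻¹ • W₁.map (algebraMap R K) = W₀.map (algebraMap R K) := by
    rw [← hC, inv_smul_smul]
  -- Minimality bounds the valuation of Δ(W₀) by that of Δ(W₁) = u⁻¹² Δ(W₀); in the multiplicative
  -- convention this says that u has valuation at most 1.
  have hu : ∃ u : R, algebraMap R K u = C.u := by
    have hint : IsIntegral R (C⁻¹ • W₁.map (algebraMap R K)) := by
      rw [hC']
      exact ⟨⟨W₀, rfl⟩⟩
    have hle := valuation_Δ_le_of_isMinimal (R := R) (W := W₁.map (algebraMap R K)) C⁻¹
    rw [hC', map_Δ, map_Δ, hΔ1, map_mul] at hle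
    have hpos : 0 < (maximalIdeal R).valuation K (algebraMap R K W₀.Δ) :=
      zero_lt_iff.2 ((Valuation.ne_zero_iff _).2 hΔK)
    have h1 : 1 ≤ (maximalIdeal R).valuation K ((C.u : K)⁻¹ ^ 12) := by
      by_contra hlt
      push Not at hlt
      exact absurd hle (not_le.2 (mul_lt_of_lt_one_left hpos hlt))
    rw [map_pow, map_inv₀, inv_pow] at h1
    have h3 : (maximalIdeal R).valuation K (C.u : K) ^ 12 ≤ 1 :=
      (one_le_inv₀ (zero_lt_iff.2 (pow_ne_zero _ ((Valuation.ne_zero_iff _).2 hu0)))).1 h1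
    exact exists_lift_of_le_one ((pow_le_one_iff (by norm_num)).1 h3)
  obtain ⟨u, hu⟩ := hu
  -- The relations c₄(W₀) = u⁴ c₄(W₁) and Δ(W₀) = u¹² Δ(W₁) exclude a non-unit u.
  have hunit : IsUnit u := by
    rcases h₀ with h₀ | h₀
    · have hc : algebraMap R K W₁.c₄ = ((C.u : K)⁻¹) ^ 4 * algebraMap R K W₀.c₄ := by
        rw [← map_c₄, ← map_c₄, ← hC, variableChange_c₄, Units.val_inv_eq_inv_val]
      have : W₀.c₄ = u ^ 4 * W₁.c₄ := by
        apply hinj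
        rw [map_mul, map_pow, hu, hc]
        field_simp
      rw [this] at h₀
      exact (isUnit_pow_iff (by norm_num)).1 (isUnit_of_mul_isUnit_left h₀)
    · by_contra hnu
      apply h₀
      have : W₀.Δ = u ^ 12 * W₁.Δ := by
        apply hinj
        rw [map_mul, map_pow, hu, hΔ1]
        field_simp
      rw [this]
      exact Ideal.mul_mem_right _ _ (Ideal.pow_mem_pow ((IsLocalRing.mem_maximalIdeal _).2 hnu) _)
  have hu4 : IsUnit (4 : R) := by
    rw [show (4 : R) = 2 * 2 by norm_num]
    exact h2.mul h2
  -- The transformation rule of b₆ is a cubic equation for r with leading coefficient 4, a unit; so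
  -- r is integral over the integrally closed ring `R`. After this a₁ and a₃ give 2s and 2t in `R`.
  have hr : ∃ r : R, algebraMap R K r = C.r := by
    have hb := congrArg WeierstrassCurve.b₆ hC
    rw [variableChange_b₆, map_b₆, map_b₆, map_b₂, map_b₄, Units.val_inv_eq_inv_val, ← hu] at hb
    have huK : algebraMap R K u ≠ 0 := by rw [hu]; exact hu0
    have hb' : algebraMap R K W₀.b₆ + 2 * C.r * algebraMap R K W₀.b₄ +
        C.r ^ 2 * algebraMap R K W₀.b₂ + 4 * C.r ^ 3 =
        algebraMap R K u ^ 6 * algebraMap R K W₁.b₆ := by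
      rw [← hb]
      field_simp
    obtain ⟨c, hc⟩ := hu4
    have hcK : (4 : K) * algebraMap R K ((c⁻¹ : Rˣ) : R) = 1 := by
      have : (4 : K) = algebraMap R K (c : R) := by rw [hc, map_ofNat]
      rw [this, ← map_mul, Units.mul_inv, map_one]
    have hint : _root_.IsIntegral R C.r := by
      let e : R := ((c⁻¹ : Rˣ) : R)
      let q : Polynomial R := Polynomial.C (e * W₀.b₂) * Polynomial.X ^ 2 +
        Polynomial.C (e * (2 * W₀.b₄)) * Polynomial.X +
          Polynomial.C (e * (W₀.b₆ - u ^ 6 * W₁.b₆))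
      refine ⟨Polynomial.X ^ 3 + q, Polynomial.monic_X_pow_add ?_, ?_⟩
      · refine lt_of_le_of_lt Polynomial.degree_quadratic_le ?_
        norm_num
      · simp only [q, Polynomial.eval₂_add, Polynomial.eval₂_mul, Polynomial.eval₂_C,
          Polynomial.eval₂_X_pow, Polynomial.eval₂_X]
        simp only [e, map_mul, map_sub, map_pow, map_ofNat]
        linear_combination algebraMap R K ((c⁻¹ : Rˣ) : R) * hb' - C.r ^ 3 * hcK
    exact IsIntegrallyClosed.isIntegral_iff.1 hint
  obtain ⟨r, hr⟩ := hr
  have hs : ∃ s : R, algebraMap R K s = C.s := by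
    apply mem_range_of_mul_mem h2
    have ha := congrArg WeierstrassCurve.a₁ hC
    rw [variableChange_a₁, map_a₁, map_a₁, Units.val_inv_eq_inv_val] at ha
    refine ⟨u * W₁.a₁ - W₀.a₁, ?_⟩
    rw [map_sub, map_mul, ← ha, hu, map_ofNat]
    field_simp
    ring
  obtain ⟨s, hs⟩ := hs
  have ht : ∃ t : R, algebraMap R K t = C.t := by
    apply mem_range_of_mul_mem h2
    have ha := congrArg WeierstrassCurve.a₃ hC
    rw [variableChange_a₃, map_a₁, map_a₃, map_a₃, Units.val_inv_eq_inv_val] at ha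
    refine ⟨u ^ 3 * W₁.a₃ - W₀.a₃ - r * W₀.a₁, ?_⟩
    rw [map_sub, map_sub, map_mul, map_mul, ← ha, map_pow, hu, hr, map_ofNat]
    field_simp
    ring
  obtain ⟨t, ht⟩ := ht
  refine ⟨⟨hunit.unit, r, s, t⟩, map_injective hinj ?_⟩
  simp only
  rw [← map_variableChange, ← hC]
  congr 1
  ext
  · simpa [VariableChange.map] using hu
  · simpa [VariableChange.map] using hr
  · simpa [VariableChange.map] using hs
  · simpa [VariableChange.map] using ht

/-- The reduction of a minimal model may be computed from any integral model with `c₄` a unit or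
the discriminant not divisible by `π ^ 12`. -/
theorem exists_variableChange_reduction_minimal (h2 : IsUnit (2 : R)) {W₀ : WeierstrassCurve R}
    (hΔ : W₀.Δ ≠ 0) (h₀ : IsUnit W₀.c₄ ∨ W₀.Δ ∉ IsLocalRing.maximalIdeal R ^ 12)
    {W : WeierstrassCurve K} {C : VariableChange K} (hC : C • W = W₀.map (algebraMap R K)) :
    ∃ C₁ : VariableChange (IsLocalRing.ResidueField R),
      (W.minimal R).reduction R = C₁ • W₀.map (IsLocalRing.residue R) := by
  set W₁ := integralModel R (W.minimal R) with hW₁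
  have hW₁K : W₁.map (algebraMap R K) = W.minimal R := baseChange_integralModel_eq R _
  have hmin : IsMinimal R (W₁.map (algebraMap R K)) := by
    rw [hW₁K]
    infer_instance
  obtain ⟨C₀, hC₀⟩ := exists_integral_variableChange h2 hΔ h₀ (W₁ := W₁)
    -- The passage from W₀ to the chosen minimal model goes back to W and then minimises.
    (C := (W.exists_isMinimal R).choose * C⁻¹) (by
      rw [hW₁K, mul_smul, ← hC, inv_smul_smul]
      rfl)
  exact ⟨C₀.map (IsLocalRing.residue R), by rw [map_variableChange, hC₀]; rfl⟩

end Minimal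

/-- The curve `y² = x (x² + a x + b)`. -/
def twoTorsionCurve {R : Type*} [CommRing R] (a b : R) : WeierstrassCurve R := ⟨0, a, 0, b, 0⟩

theorem twoTorsionCurve_Δ {R : Type*} [CommRing R] (a b : R) :
    (twoTorsionCurve a b).Δ = 16 * b ^ 2 * (a ^ 2 - 4 * b) := by
  simp only [twoTorsionCurve, WeierstrassCurve.Δ, WeierstrassCurve.b₂, WeierstrassCurve.b₄,
    WeierstrassCurve.b₆, WeierstrassCurve.b₈]
  ring

theorem twoTorsionCurve_c₄ {R : Type*} [CommRing R] (a b : R) :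
    (twoTorsionCurve a b).c₄ = 16 * (a ^ 2 - 3 * b) := by
  simp only [twoTorsionCurve, WeierstrassCurve.c₄, WeierstrassCurve.b₂, WeierstrassCurve.b₄]
  ring

theorem twoTorsionCurve_map {R S : Type*} [CommRing R] [CommRing S] (a b : R) (φ : R →+* S) :
    (twoTorsionCurve a b).map φ = twoTorsionCurve (φ a) (φ b) := by
  ext <;> simp [twoTorsionCurve]

theorem card_twoTorsionCurve {k : Type*} [Field k] [Fintype k] [DecidableEq k]
    (hk : ringChar k ≠ 2) (a b : k) :
    (Nat.card {P : k × k // (twoTorsionCurve a b).toAffine.Equation P.1 P.2} : ℤ) =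
      Fintype.card k + cubicSum a b := by
  classical
  have h1 : Nat.card {P : k × k // (twoTorsionCurve a b).toAffine.Equation P.1 P.2} =
      ∑ x : k, (Finset.univ.filter fun y : k => y ^ 2 = x * (x ^ 2 + a * x + b)).card := by
    rw [Nat.card_eq_fintype_card, Fintype.card_subtype, Finset.card_filter,
      Fintype.sum_prod_type]
    refine Finset.sum_congr rfl fun x _ => ?_
    rw [Finset.card_filter]
    refine Finset.sum_congr rfl fun y _ => ?_
    refine if_congr ?_ rfl rfl
    rw [WeierstrassCurve.Affine.equation_iff]
    simp only [twoTorsionCurve]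
    constructor <;> intro h <;> linear_combination h
  rw [h1]
  push_cast
  have h2 : ∀ x : k, ((Finset.univ.filter fun y : k => y ^ 2 = x * (x ^ 2 + a * x + b)).card : ℤ) =
      quadraticChar k (x * (x ^ 2 + a * x + b)) + 1 := by
    intro x
    rw [← quadraticChar_card_sqrts hk]
    congr 2
    ext y
    simp
  rw [Finset.sum_congr rfl fun x _ => h2 x, Finset.sum_add_distrib, cubicSum]
  simp
  ring

/-- The reductions of this model and of the minimal one differ by a change of variables over the
residue field, which preserves the number of affine points and the nonvanishing of Δ. The factor 16
in Δ and c₄ is a unit and is dropped from `h₀`. -/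
theorem Place.trace_and_good {F : Type*} [Field F] (v : Place F) [Fintype v.residueField]
    [DecidableEq v.residueField] (hk : ringChar v.residueField ≠ 2)
    {W : WeierstrassCurve (RatFunc F)} {a b : v.ring}
    (hΔ : 16 * b ^ 2 * (a ^ 2 - 4 * b) ≠ 0)
    (h₀ : IsLocalRing.residue v.ring (a ^ 2 - 3 * b) ≠ 0 ∨
      b ^ 2 * (a ^ 2 - 4 * b) ∉ IsLocalRing.maximalIdeal v.ring ^ 12)
    {C : WeierstrassCurve.VariableChange (RatFunc F)}
    (hC : C • W = twoTorsionCurve (a : RatFunc F) b) :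
    v.trace W = -cubicSum (IsLocalRing.residue v.ring a) (IsLocalRing.residue v.ring b) ∧
    ((W.minimal v.ring).HasGoodReduction v.ring ↔ IsLocalRing.residue v.ring b ≠ 0 ∧
      IsLocalRing.residue v.ring a ^ 2 - 4 * IsLocalRing.residue v.ring b ≠ 0) := by
  have h2k : (2 : v.residueField) ≠ 0 := Ring.two_ne_zero hk
  have hunit : ∀ x : v.ring, IsLocalRing.residue v.ring x ≠ 0 → IsUnit x := fun x hx => by
    rwa [IsLocalRing.residue_ne_zero_iff_isUnit] at hx
  have h2 : IsUnit (2 : v.ring) := hunit 2 (by rwa [map_ofNat])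
  have h16k : (16 : v.residueField) ≠ 0 := by
    rw [show (16 : v.residueField) = 2 ^ 4 by norm_num]
    exact pow_ne_zero _ h2k
  have h16 : IsUnit (16 : v.ring) := hunit 16 (by rwa [map_ofNat])
  obtain ⟨C₁, hC₁⟩ := exists_variableChange_reduction_minimal (K := RatFunc F) h2
    (W₀ := twoTorsionCurve a b) (by rwa [twoTorsionCurve_Δ]) (by
      rw [twoTorsionCurve_Δ, twoTorsionCurve_c₄]
      refine h₀.imp (fun h => h16.mul (hunit _ h)) (fun h hmem => h ?_)
      obtain ⟨c, hc⟩ := h16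
      have := Ideal.mul_mem_left _ ((c⁻¹ : v.ringˣ) : v.ring) hmem
      rw [← hc, mul_assoc, Units.inv_mul_cancel_left] at this
      exact this) (W := W) (C := C) (by rw [hC, twoTorsionCurve_map]; rfl)
  rw [twoTorsionCurve_map] at hC₁
  constructor
  · rw [Place.trace, Place.numPoints, hC₁, Nat.card_congr (affinePointsEquiv _ C₁)]
    push_cast
    rw [card_twoTorsionCurve hk, Nat.card_eq_fintype_card]
    ring
  · rw [WeierstrassCurve.hasGoodReduction_iff_isElliptic_reduction, hC₁,
      WeierstrassCurve.isElliptic_iff, WeierstrassCurve.variableChange_Δ, isUnit_iff_ne_zero,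
      twoTorsionCurve_Δ]
    simp [h16k]

end KummerL

end

noncomputable section

namespace KummerL
open Polynomial

/-! ### The places of `F(t)` -/

namespace Place

variable {F : Type*} [Field F] (v : Place F)

instance : Algebra F v.residueField := v.constHom.toAlgebra

theorem algebraMap_residueField (c : F) :
    algebraMap F v.residueField c = IsLocalRing.residue v.ring ⟨RatFunc.C c, v.const_mem c⟩ := rfl

theorem degree_eq_finrank : v.degree = Module.finrank F v.residueField := rfl

@[ext]
theorem ext' {v w : Place F} (h : v.ring = w.ring) : v = w := by
  cases v
  cases w
  simp only at h
  subst h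
  rfl

variable {v}

section Finite

variable (hX : RatFunc.X ∈ v.ring)

/-- The inclusion of `F[t]` in the valuation ring of a finite place. -/
def polyHom : F[X] →+* v.ring :=
  eval₂RingHom ((RatFunc.C : F →+* RatFunc F).codRestrict v.ring.toSubring v.const_mem)
    ⟨RatFunc.X, hX⟩

theorem coe_polyHom (g : F[X]) : (polyHom hX g : RatFunc F) = algebraMap F[X] (RatFunc F) g := by
  have : (v.ring.subtype).comp (polyHom hX) = algebraMap F[X] (RatFunc F) := by
    apply Polynomial.ringHom_ext
    · intro c
      simp [polyHom]
    · simp [polyHom]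
  exact DFunLike.congr_fun this g

/-- The image of `t` in the residue field of a finite place. -/
def coord : v.residueField := IsLocalRing.residue v.ring ⟨RatFunc.X, hX⟩

theorem residue_polyHom (g : F[X]) :
    IsLocalRing.residue v.ring (polyHom hX g) = aeval (coord hX) g := by
  have : (IsLocalRing.residue v.ring).comp (polyHom hX) =
      (aeval (coord hX) : F[X] →ₐ[F] v.residueField).toRingHom := by
    apply Polynomial.ringHom_ext
    · intro c
      simp [polyHom, algebraMap_residueField]
      rfl
    · simp [polyHom, coord]
  exact DFunLike.congr_fun this g

theorem coe_polyHom_num_eq (x : RatFunc F) :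
    (polyHom hX x.num : RatFunc F) = x * polyHom hX x.denom := by
  rw [coe_polyHom, coe_polyHom]
  have h : algebraMap F[X] (RatFunc F) x.denom ≠ 0 := RatFunc.algebraMap_ne_zero x.denom_ne_zero
  nth_rw 2 [← RatFunc.num_div_denom x]
  field_simp

theorem aeval_denom_ne_zero {x : RatFunc F} (hx : x ∈ v.ring) :
    aeval (coord hX) x.denom ≠ 0 := by
  intro h
  obtain ⟨a, b, hab⟩ := RatFunc.isCoprime_num_denom x
  have h1 : polyHom hX x.num = (⟨x, hx⟩ : v.ring) * polyHom hX x.denom :=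
    Subtype.ext (coe_polyHom_num_eq hX x)
  have h2 := congrArg (IsLocalRing.residue v.ring) h1
  rw [map_mul, residue_polyHom, residue_polyHom, h, mul_zero] at h2
  have h3 := congrArg (aeval (coord hX)) hab
  rw [map_add, map_mul, map_mul, h, h2, mul_zero, mul_zero, add_zero, map_one] at h3
  exact zero_ne_one h3

/-- Numerator and denominator are coprime, so they cannot both vanish at the image of t. If the
denominator does not vanish there, it is a unit of the valuation ring. -/
theorem mem_ring_iff (x : RatFunc F) : x ∈ v.ring ↔ aeval (coord hX) x.denom ≠ 0 := by
  refine ⟨aeval_denom_ne_zero hX, fun h => ?_⟩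
  rw [← residue_polyHom, IsLocalRing.residue_ne_zero_iff_isUnit] at h
  obtain ⟨u, hu⟩ := h
  have : x = (polyHom hX x.num * ((u⁻¹ : v.ringˣ) : v.ring) : v.ring) := by
    have h1 : ((u : v.ring) : RatFunc F) * ((u⁻¹ : v.ringˣ) : v.ring) = 1 := by
      exact_mod_cast congrArg Subtype.val (Units.mul_inv u)
    have h2 := coe_polyHom_num_eq hX x
    rw [← hu] at h2
    push_cast
    rw [h2]
    linear_combination -x * h1
  rw [this]
  exact Subtype.mem _

theorem residue_eq (x : v.ring) : IsLocalRing.residue v.ring x =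
    aeval (coord hX) (x : RatFunc F).num / aeval (coord hX) (x : RatFunc F).denom := by
  rw [eq_div_iff (aeval_denom_ne_zero hX x.2), ← residue_polyHom, ← residue_polyHom, ← map_mul]
  congr 1
  exact Subtype.ext (coe_polyHom_num_eq hX x).symm

/-- A uniformiser is a nonzero rational function with residue 0, so its numerator is a nonzero
polynomial vanishing at the image of t. -/
theorem isIntegral_coord : IsIntegral F (coord hX) := by
  obtain ⟨ϖ, hϖ⟩ := IsDiscreteValuationRing.exists_irreducible v.ring
  have h0 : (ϖ : RatFunc F) ≠ 0 := fun h => hϖ.ne_zero (Subtype.ext h)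
  have hm : IsLocalRing.residue v.ring ϖ = 0 := by
    rw [IsLocalRing.residue_eq_zero_iff, IsLocalRing.mem_maximalIdeal]
    exact hϖ.not_isUnit
  rw [residue_eq hX, div_eq_zero_iff, or_iff_left (aeval_denom_ne_zero hX ϖ.2)] at hm
  exact IsAlgebraic.isIntegral ⟨(ϖ : RatFunc F).num, RatFunc.num_ne_zero h0, hm⟩

/-- Every residue is a quotient of two polynomials in the image of t, and these form a field because
this image is algebraic. -/
theorem adjoin_coord : Algebra.adjoin F {coord hX} = ⊤ := by
  rw [eq_top_iff]
  rintro z -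
  obtain ⟨x, rfl⟩ := IsLocalRing.residue_surjective z
  have hK : (Algebra.adjoin F {coord hX}) = (IntermediateField.adjoin F {coord hX}).toSubalgebra :=
    (IntermediateField.adjoin_simple_toSubalgebra_of_isAlgebraic
      (isIntegral_coord hX).isAlgebraic).symm
  rw [hK, residue_eq hX]
  have hmem : ∀ g : F[X], aeval (coord hX) g ∈ IntermediateField.adjoin F {coord hX} := fun g =>
    IntermediateField.algebra_adjoin_le_adjoin F _ (aeval_mem_adjoin_singleton F _)
  exact (IntermediateField.mem_toSubalgebra _ _).2 (div_mem (hmem _) (hmem _))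

/-- The power basis of the residue field of a finite place given by the image of `t`. -/
def powerBasis : PowerBasis F v.residueField :=
  PowerBasis.ofAdjoinEqTop (isIntegral_coord hX) (adjoin_coord hX)

theorem powerBasis_gen : (powerBasis hX).gen = coord hX :=
  PowerBasis.ofAdjoinEqTop_gen _ _

/-- The monic irreducible polynomial of a finite place. -/
def poly : F[X] := minpoly F (coord hX)

theorem monic_poly : (poly hX).Monic := minpoly.monic (isIntegral_coord hX)

theorem irreducible_poly : Irreducible (poly hX) := minpoly.irreducible (isIntegral_coord hX)

theorem degree_eq_natDegree : v.degree = (poly hX).natDegree := by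
  rw [degree_eq_finrank, (powerBasis hX).finrank, ← (powerBasis hX).natDegree_minpoly,
    powerBasis_gen, poly]

theorem finite_residueField_of_mem [Finite F] (hX : RatFunc.X ∈ v.ring) : Finite v.residueField := by
  have := (powerBasis hX).finite
  exact Module.finite_of_finite F

theorem aeval_coord_eq_zero_iff (g : F[X]) : aeval (coord hX) g = 0 ↔ poly hX ∣ g :=
  ⟨fun h => minpoly.dvd F _ h, fun ⟨q, hq⟩ => by rw [hq, map_mul, poly, minpoly.aeval, zero_mul]⟩

theorem eq_of_poly_eq {w : Place F} (hX' : RatFunc.X ∈ w.ring) (h : poly hX = poly hX') :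
    v = w := by
  apply ext'
  ext x
  rw [mem_ring_iff hX, mem_ring_iff hX', Ne, Ne, aeval_coord_eq_zero_iff, aeval_coord_eq_zero_iff,
    h]

/-- The embedding of the residue field of a finite place given by a root of its polynomial. -/
def residueLift {L : Type*} [Field L] [Algebra F L] {τ : L} (hτ : minpoly F τ = poly hX) :
    v.residueField →ₐ[F] L :=
  (powerBasis hX).lift τ (by rw [powerBasis_gen, ← poly, ← hτ, minpoly.aeval])

theorem residueLift_coord {L : Type*} [Field L] [Algebra F L] {τ : L}
    (hτ : minpoly F τ = poly hX) : residueLift hX hτ (coord hX) = τ := by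
  have h : residueLift hX hτ (powerBasis hX).gen = τ := (powerBasis hX).lift_gen τ _
  rwa [powerBasis_gen] at h

end Finite

open IsDedekindDomain in
/-- The place attached to an irreducible polynomial. -/
def ofIrreducible {π : F[X]} (hπ : Irreducible π) : Place F where
  ring := (HeightOneSpectrum.valuation (RatFunc F)
    (⟨Ideal.span {π}, (PrincipalIdealRing.isMaximal_of_irreducible hπ).isPrime,
      by simpa using hπ.ne_zero⟩ : HeightOneSpectrum F[X])).valuationSubring
  isDVR := Valuation.valuationSubring_isDiscreteValuationRing _
  const_mem c := by
    rw [Valuation.mem_valuationSubring_iff, ← RatFunc.algebraMap_C]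
    exact HeightOneSpectrum.valuation_le_one _ _

theorem X_mem_ofIrreducible {π : F[X]} (hπ : Irreducible π) :
    RatFunc.X ∈ (ofIrreducible hπ).ring := by
  rw [ofIrreducible, Valuation.mem_valuationSubring_iff, ← RatFunc.algebraMap_X]
  exact IsDedekindDomain.HeightOneSpectrum.valuation_le_one _ _

theorem poly_ofIrreducible {π : F[X]} (hπ : Irreducible π) (hm : π.Monic) :
    poly (X_mem_ofIrreducible hπ) = π := by
  symm
  apply minpoly.eq_of_irreducible_of_monic hπ _ hm
  rw [← residue_polyHom, IsLocalRing.residue_eq_zero_iff, IsLocalRing.mem_maximalIdeal,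
    mem_nonunits_iff]
  intro hu
  obtain ⟨u, hu⟩ := hu
  have h1 : ((u : (ofIrreducible hπ).ring) : RatFunc F) *
      ((u⁻¹ : (ofIrreducible hπ).ringˣ) : (ofIrreducible hπ).ring) = 1 := by
    exact_mod_cast congrArg Subtype.val (Units.mul_inv u)
  rw [hu, coe_polyHom] at h1
  set P : IsDedekindDomain.HeightOneSpectrum F[X] :=
    ⟨Ideal.span {π}, (PrincipalIdealRing.isMaximal_of_irreducible hπ).isPrime,
      by simpa using hπ.ne_zero⟩
  have h2 : P.valuation (RatFunc F) (algebraMap F[X] (RatFunc F) π) < 1 := by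
    rw [IsDedekindDomain.HeightOneSpectrum.valuation_lt_one_iff_mem]
    exact Ideal.mem_span_singleton_self π
  have h3 : P.valuation (RatFunc F)
      (((u⁻¹ : (ofIrreducible hπ).ringˣ) : (ofIrreducible hπ).ring) : RatFunc F) ≤ 1 :=
    Subtype.mem ((u⁻¹ : (ofIrreducible hπ).ringˣ) : (ofIrreducible hπ).ring)
  have h4 := congrArg (P.valuation (RatFunc F)) h1
  rw [map_mul, map_one] at h4
  exact (mul_lt_one_of_lt_of_le h2 h3).ne h4

section Infinity

theorem isTrivialOn (v : Place F) : v.ring.valuation.IsTrivialOn F := by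
  constructor
  intro c hc
  have h1 : v.ring.valuation (RatFunc.C c) ≤ 1 := (v.ring.valuation_le_one_iff _).2 (v.const_mem c)
  have h2 : v.ring.valuation (RatFunc.C c⁻¹) ≤ 1 :=
    (v.ring.valuation_le_one_iff _).2 (v.const_mem _)
  rw [RatFunc.algebraMap_eq_C]
  refine le_antisymm h1 ?_
  rw [map_inv₀, map_inv₀] at h2
  have hne : v.ring.valuation (RatFunc.C c) ≠ 0 := by
    rw [Valuation.ne_zero_iff]
    simpa using hc
  exact (inv_le_one₀ (zero_lt_iff.2 hne)).1 h2

theorem one_lt_valuation_X {v : Place F} (hX : RatFunc.X ∉ v.ring) :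
    1 < v.ring.valuation (RatFunc.X : RatFunc F) := by
  rw [← not_le, v.ring.valuation_le_one_iff]
  exact hX

/-- A valuation trivial on constants with |t| > 1 is x ↦ |t|^(deg x), so its ring is determined by
the degree alone. -/
theorem mem_ring_iff_intDegree {v : Place F} (hX : RatFunc.X ∉ v.ring) {x : RatFunc F}
    (hx : x ≠ 0) : x ∈ v.ring ↔ x.intDegree ≤ 0 := by
  have := v.isTrivialOn
  rw [← v.ring.valuation_le_one_iff,
    RatFunc.valuation_eq_valuation_X_zpow_intDegree_of_one_lt_valuation_X (one_lt_valuation_X hX)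
      hx]
  exact zpow_le_one_iff_right₀ (one_lt_valuation_X hX)

theorem eq_of_X_notMem {v w : Place F} (hv : RatFunc.X ∉ v.ring) (hw : RatFunc.X ∉ w.ring) :
    v = w := by
  apply ext'
  ext x
  rcases eq_or_ne x 0 with rfl | hx
  · simp
  · rw [mem_ring_iff_intDegree hv hx, mem_ring_iff_intDegree hw hx]

open Classical in
/-- The place at infinity. -/
def infinity (F : Type*) [Field F] : Place F where
  ring := (RatFunc.inftyValuation F).valuationSubring
  isDVR := Valuation.valuationSubring_isDiscreteValuationRing _
  const_mem c := by
    rw [Valuation.mem_valuationSubring_iff]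
    rcases eq_or_ne c 0 with rfl | hc
    · simp
    · rw [RatFunc.inftyValuation.C F hc]

theorem X_notMem_infinity : RatFunc.X ∉ (infinity F).ring := by
  classical
  rw [infinity, Valuation.mem_valuationSubring_iff, RatFunc.inftyValuation.X, not_le]
  rw [← WithZero.exp_zero, WithZero.exp_lt_exp]
  exact zero_lt_one

theorem algebraMap_bijective_of_X_notMem {v : Place F} (hX : RatFunc.X ∉ v.ring) :
    Function.Bijective (algebraMap F v.residueField) := by
  refine ⟨(algebraMap F v.residueField).injective, fun z => ?_⟩
  obtain ⟨x, rfl⟩ := IsLocalRing.residue_surjective z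
  have htriv := v.isTrivialOn
  have hlt := one_lt_valuation_X hX
  have hres : ∀ y : v.ring, v.ring.valuation (y : RatFunc F) < 1 →
      IsLocalRing.residue v.ring y = 0 := fun y hy => by
    rw [IsLocalRing.residue_eq_zero_iff]
    exact (v.ring.valuation_lt_one_iff y).2 hy
  rcases eq_or_ne (x : RatFunc F) 0 with h0 | h0
  · exact ⟨0, by rw [map_zero, show x = 0 from Subtype.ext h0, map_zero]⟩
  have hdeg := (mem_ring_iff_intDegree hX h0).1 x.2
  rcases lt_or_eq_of_le hdeg with hneg | hz
  · refine ⟨0, ?_⟩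
    rw [map_zero, hres]
    rw [RatFunc.valuation_eq_valuation_X_zpow_intDegree_of_one_lt_valuation_X hlt h0]
    exact (zpow_lt_one_iff_right₀ hlt).2 hneg
  · set g := (x : RatFunc F).num
    set h := (x : RatFunc F).denom
    have hg0 : g ≠ 0 := RatFunc.num_ne_zero h0
    have hh0 : h ≠ 0 := RatFunc.denom_ne_zero _
    have hdegeq : g.natDegree = h.natDegree := by
      have h4 : ((x : RatFunc F).num.natDegree : ℤ) - (x : RatFunc F).denom.natDegree = 0 := hz
      change (x : RatFunc F).num.natDegree = (x : RatFunc F).denom.natDegree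
      omega
    -- The denominator h is monic of the same degree as g, so c is the value of g/h at infinity: c h
    -- - g has smaller degree than h.
    set c := g.leadingCoeff
    refine ⟨c, ?_⟩
    rw [algebraMap_residueField, ← sub_eq_zero, ← map_sub]
    apply hres
    have hhK : algebraMap F[X] (RatFunc F) h ≠ 0 := RatFunc.algebraMap_ne_zero hh0
    have e : (((⟨RatFunc.C c, v.const_mem c⟩ : v.ring) - x : v.ring) : RatFunc F) =
        algebraMap F[X] (RatFunc F) (C c * h - g) / algebraMap F[X] (RatFunc F) h := by
      change RatFunc.C c - (x : RatFunc F) = _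
      rw [map_sub, map_mul, RatFunc.algebraMap_C, eq_div_iff hhK, sub_mul]
      congr 1
      conv_lhs => rw [← RatFunc.num_div_denom (x : RatFunc F)]
      exact div_mul_cancel₀ _ hhK
    rw [e, map_div₀]
    rcases eq_or_ne (C c * h - g) 0 with h3 | h3
    · rw [h3]
      simp
    · have hd : (C c * h - g).natDegree < h.natDegree := by
        have hc0 : c ≠ 0 := leadingCoeff_ne_zero.2 hg0
        have hd1 : (C c * h).degree = g.degree := by
          rw [degree_C_mul hc0, Polynomial.degree_eq_natDegree hh0,
            Polynomial.degree_eq_natDegree hg0, hdegeq]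
        have hlc : (C c * h).leadingCoeff = g.leadingCoeff := by
          rw [leadingCoeff_mul, leadingCoeff_C, (RatFunc.monic_denom _).leadingCoeff, mul_one]
        have := degree_sub_lt_left hd1 (mul_ne_zero (C_ne_zero.2 hc0) hh0) hlc
        rw [degree_C_mul hc0] at this
        exact natDegree_lt_natDegree h3 this
      have hval : ∀ q : F[X], q ≠ 0 → v.ring.valuation (algebraMap F[X] (RatFunc F) q) =
          v.ring.valuation (RatFunc.X : RatFunc F) ^ q.natDegree := fun q hq => by
        rw [RatFunc.valuation_eq_valuation_X_zpow_intDegree_of_one_lt_valuation_X hlt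
          (RatFunc.algebraMap_ne_zero hq), RatFunc.intDegree_polynomial, zpow_natCast]
      rw [hval _ h3, hval _ hh0, div_lt_one₀ (pow_pos (zero_lt_one.trans hlt) _)]
      exact pow_lt_pow_right₀ hlt hd

theorem degree_infinity {v : Place F} (hX : RatFunc.X ∉ v.ring) : v.degree = 1 := by
  rw [degree_eq_finrank]
  exact (LinearEquiv.finrank_eq (LinearEquiv.ofBijective (Algebra.linearMap F v.residueField)
    (algebraMap_bijective_of_X_notMem hX))).symm.trans (Module.finrank_self F)

end Infinity

end Place

end KummerL

end

noncomputable section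

namespace KummerL

/-! ### The Euler factors -/

section CubicSum

variable {k : Type*} [Field k] [Fintype k] [DecidableEq k]

/-- The square factor is invisible to λ except at x = -c, so the sum is ∑ λ(x + g) = 0 without its
term at -c. -/
theorem sum_quadraticChar_mul_sq (hk : ringChar k ≠ 2) (g c : k) :
    ∑ x : k, quadraticChar k ((x + g) * (x + c) ^ 2) = -quadraticChar k (g - c) := by
  have h1 : ∀ x : k, quadraticChar k ((x + g) * (x + c) ^ 2) =
      quadraticChar k (x + g) - if x = -c then quadraticChar k (g - c) else 0 := by
    intro x
    split_ifs with h
    · rw [h, neg_add_cancel, zero_pow two_ne_zero, mul_zero, MulChar.map_zero, neg_add_eq_sub, sub_self]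
    · have : x + c ≠ 0 := fun h' => h (eq_neg_of_add_eq_zero_left h')
      rw [map_mul, quadraticChar_sq_one' this, mul_one, sub_zero]
  simp_rw [h1]
  rw [Finset.sum_sub_distrib, Finset.sum_ite_eq' Finset.univ, if_pos (Finset.mem_univ _),
    Fintype.sum_equiv (Equiv.addRight g) (fun x => quadraticChar k (x + g)) (quadraticChar k)
      (fun x => rfl), quadraticChar_sum_zero hk, zero_sub]

theorem cubicSum_of_eq_zero (hk : ringChar k ≠ 2) (a : k) : cubicSum a 0 = -quadraticChar k a := by
  rw [cubicSum, ← sub_zero a, ← sum_quadraticChar_mul_sq hk a 0]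
  refine Finset.sum_congr rfl fun x _ => ?_
  congr 1
  ring

theorem cubicSum_of_sq_eq (hk : ringChar k ≠ 2) {a b : k} (h : a ^ 2 - 4 * b = 0) :
    cubicSum a b = -quadraticChar k (-a / 2) := by
  have h2 : (2 : k) ≠ 0 := Ring.two_ne_zero hk
  have hb : b = (a / 2) ^ 2 := by
    have : (4 : k) ≠ 0 := by rw [show (4 : k) = 2 * 2 by norm_num]; exact mul_ne_zero h2 h2
    field_simp
    linear_combination -h
  rw [cubicSum, show -a / 2 = 0 - a / 2 by ring, ← sum_quadraticChar_mul_sq hk 0 (a / 2), hb]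
  refine Finset.sum_congr rfl fun x _ => ?_
  congr 1
  field_simp
  ring

/-- For a singular cubic -S is λ of an element of k, and on k the quadratic character of L is the
power of that of k with exponent [L : k]. This agrees with the logarithmic derivative of a linear
Euler factor. -/
theorem cubicSum_algebraMap_of_singular (hk : ringChar k ≠ 2) {a b : k}
    (h : ¬(b ≠ 0 ∧ a ^ 2 - 4 * b ≠ 0)) (L : Type*) [Field L] [Fintype L] [DecidableEq L]
    [Algebra k L] : cubicSum (algebraMap k L a) (algebraMap k L b) =
      -(-cubicSum a b) ^ Module.finrank k L := by
  have hL : ringChar L ≠ 2 := by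
    rwa [← Algebra.ringChar_eq k L]
  have hchar : ∀ c : k, quadraticChar L (algebraMap k L c) =
      quadraticChar k c ^ Module.finrank k L := fun c => by
    rw [← normChar_quadraticChar hk L, normChar_apply, Algebra.norm_algebraMap, map_pow]
  by_cases hb : b = 0
  · rw [hb, map_zero, cubicSum_of_eq_zero hL, cubicSum_of_eq_zero hk, hchar, neg_neg]
  · have hab : a ^ 2 - 4 * b = 0 := by
      by_contra h'
      exact h ⟨hb, h'⟩
    rw [cubicSum_of_sq_eq hk hab, cubicSum_of_sq_eq hL (by
      rw [← map_zero (algebraMap k L), ← hab, map_sub, map_mul, map_pow, map_ofNat]), neg_neg,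
      ← hchar, map_div₀ (algebraMap k L), map_neg (algebraMap k L), map_ofNat (algebraMap k L)]

end CubicSum

namespace Place

open PowerSeries

variable {F : Type*} [Field F] (v : Place F)

/-- The curve `W` has a minimal model at `v` with reduction `y² = x (x² + α x + β)`, as far as the
Euler factor can tell. -/
def ReducesTo [Fintype v.residueField] [DecidableEq v.residueField]
    (W : WeierstrassCurve (RatFunc F)) (α β : v.residueField) : Prop :=
  v.trace W = -cubicSum α β ∧
    ((W.minimal v.ring).HasGoodReduction v.ring ↔ β ≠ 0 ∧ α ^ 2 - 4 * β ≠ 0)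

theorem invOfUnit_expand (e : ℕ) (he : e ≠ 0) {A : PowerSeries ℤ} (hA : constantCoeff A = 1) :
    invOfUnit (expand e he A) 1 = expand e he (invOfUnit A 1) := by
  have h0 : constantCoeff (expand e he A) = 1 := by
    rw [← coeff_zero_eq_constantCoeff_apply, coeff_expand, if_pos (dvd_zero e), Nat.zero_div,
      coeff_zero_eq_constantCoeff_apply, hA]
  have h1 : expand e he A * invOfUnit (expand e he A) 1 = 1 := mul_invOfUnit _ _ (by simpa using h0)
  have h2 : expand e he A * expand e he (invOfUnit A 1) = 1 := by
    rw [← map_mul, mul_invOfUnit _ _ (by simpa using hA), map_one]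
  calc _ = expand e he A * expand e he (invOfUnit A 1) * invOfUnit (expand e he A) 1 := by
        rw [h2, one_mul]
    _ = expand e he A * invOfUnit (expand e he A) 1 * expand e he (invOfUnit A 1) := by ring
    _ = _ := by rw [h1, one_mul]

open Classical in
/-- The denominator of the Euler factor at `v` as a polynomial in `T ^ deg v`. -/
def eulerDenom (W : WeierstrassCurve (RatFunc F)) : PowerSeries ℤ :=
  if (W.minimal v.ring).HasGoodReduction v.ring then
    1 - C (v.trace W) * X + C (Nat.card v.residueField : ℤ) * X ^ 2
  else 1 - C (v.trace W) * X

theorem constantCoeff_eulerDenom (W : WeierstrassCurve (RatFunc F)) :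
    constantCoeff (v.eulerDenom W) = 1 := by
  unfold eulerDenom
  split_ifs <;> simp

theorem eulerFactor_eq_expand (W : WeierstrassCurve (RatFunc F)) (he : v.degree ≠ 0) :
    v.eulerFactor W = expand v.degree he (invOfUnit (v.eulerDenom W) 1) := by
  rw [← invOfUnit_expand _ _ (v.constantCoeff_eulerDenom W), eulerFactor, eulerDenom]
  split_ifs <;> simp [expand_X, ← pow_mul, mul_comm]

theorem constantCoeff_eulerFactor (W : WeierstrassCurve (RatFunc F)) (he : v.degree ≠ 0) :
    constantCoeff (v.eulerFactor W) = 1 := by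
  rw [v.eulerFactor_eq_expand W he, ← coeff_zero_eq_constantCoeff_apply, coeff_expand,
    if_pos (dvd_zero _), Nat.zero_div, coeff_zero_eq_constantCoeff_apply, constantCoeff_invOfUnit]
  simp

theorem coeff_eulerFactor_eq_zero (W : WeierstrassCurve (RatFunc F)) (he : v.degree ≠ 0) {n : ℕ}
    (hn : ¬v.degree ∣ n) : coeff n (v.eulerFactor W) = 0 := by
  rw [v.eulerFactor_eq_expand W he, coeff_expand, if_neg hn]

-- The denominator has point counts over extensions of the residue field as logarithmic derivative:
-- by Newton's identities at a good place, by a geometric progression at a bad one. Inverting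
-- changes the sign, and substituting T^(deg v) produces the factor deg v.
variable {v} in
theorem ReducesTo.exists_hasLogDeriv [Fintype v.residueField] [DecidableEq v.residueField]
    (hk : ringChar v.residueField ≠ 2) {W : WeierstrassCurve (RatFunc F)} {α β : v.residueField}
    (h : v.ReducesTo W α β) (he : v.degree ≠ 0) :
    ∃ S : PowerSeries ℤ, HasLogDeriv (v.eulerFactor W) S ∧
      (∀ n, ¬v.degree ∣ n → coeff n S = 0) ∧
      ∀ (L : Type) [Field L] [Fintype L] [DecidableEq L] [Algebra v.residueField L],
        coeff (v.degree * Module.finrank v.residueField L) S =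
          -(v.degree * cubicSum (algebraMap v.residueField L α) (algebraMap v.residueField L β)) := by
  obtain ⟨S, hS, hSL⟩ : ∃ S : PowerSeries ℤ, HasLogDeriv (v.eulerDenom W) S ∧
      ∀ (L : Type) [Field L] [Fintype L] [DecidableEq L] [Algebra v.residueField L],
        coeff (Module.finrank v.residueField L) S =
          cubicSum (algebraMap v.residueField L α) (algebraMap v.residueField L β) := by
    by_cases hg : β ≠ 0 ∧ α ^ 2 - 4 * β ≠ 0
    · obtain ⟨S, hS, hSL⟩ := hasLogDeriv_cubic hk hg.1 hg.2
      refine ⟨S, ?_, hSL⟩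
      rwa [eulerDenom, if_pos (h.2.2 hg), h.1, Nat.card_eq_fintype_card]
    · refine ⟨PowerSeries.mk fun m => if m = 0 then 0 else -(-cubicSum α β) ^ m, ?_, fun L _ _ _ _ => ?_⟩
      · rw [eulerDenom, if_neg (mt h.2.1 hg), h.1]
        exact hasLogDeriv_one_sub _
      · have : Module.Finite v.residueField L := Module.Finite.of_finite
        rw [coeff_mk, if_neg Module.finrank_pos.ne', cubicSum_algebraMap_of_singular hk hg]
  refine ⟨(v.degree : PowerSeries ℤ) * expand v.degree he (-S), ?_, fun n hn => ?_,
    fun L _ _ _ _ => ?_⟩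
  · rw [v.eulerFactor_eq_expand W he]
    exact (hS.of_mul_eq_one (mul_invOfUnit _ _
      (by simpa using v.constantCoeff_eulerDenom W))).expand _ he
  · rw [show (v.degree : PowerSeries ℤ) = C (v.degree : ℤ) by simp, coeff_C_mul, coeff_expand,
      if_neg hn, mul_zero]
  · rw [show (v.degree : PowerSeries ℤ) = C (v.degree : ℤ) by simp, coeff_C_mul, coeff_expand,
      if_pos (dvd_mul_right _ _), Nat.mul_div_cancel_left _ (Nat.pos_of_ne_zero he), map_neg, hSL,
      mul_neg]

end Place

/-! ### Local models of `E_d` at all places -/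

section CurveE

variable {F : Type*} [Field F] {d : ℕ} 

theorem X_pow_add_ne_zero (hd : d ≠ 0) (c : F) : (RatFunc.X : RatFunc F) ^ d + RatFunc.C c ≠ 0 := by
  have := RatFunc.algebraMap_ne_zero (K := F) (Polynomial.X_pow_add_C_ne_zero (Nat.pos_of_ne_zero hd) c)
  simpa using this

theorem curveE_Δ_ne_zero (hF : ringChar F ≠ 2) (hd : d ≠ 0) : (curveE F d).Δ ≠ 0 := by
  have h2 : (2 : RatFunc F) ≠ 0 := by
    have : (2 : F) ≠ 0 := Ring.two_ne_zero hF
    intro h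
    apply this
    apply (RatFunc.C : F →+* RatFunc F).injective
    rw [map_ofNat, map_zero, h]
  have hX : (RatFunc.X : RatFunc F) ≠ 0 := RatFunc.X_ne_zero
  have h16 := X_pow_add_ne_zero (mul_ne_zero two_ne_zero hd) (16 : F)
  rw [map_ofNat] at h16
  have : (curveE F d).Δ = 2 ^ 8 * RatFunc.X ^ (6 * d) * (RatFunc.X ^ (2 * d) + 16) := by
    simp only [curveE, WeierstrassCurve.Δ, WeierstrassCurve.b₂, WeierstrassCurve.b₄,
      WeierstrassCurve.b₆, WeierstrassCurve.b₈]
    ring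
  rw [this]
  exact mul_ne_zero (mul_ne_zero (pow_ne_zero _ h2) (pow_ne_zero _ hX)) h16

theorem curveE_smul (u : (RatFunc F)ˣ) :
    (⟨u, 0, 0, 0⟩ : WeierstrassCurve.VariableChange (RatFunc F)) • curveE F d =
      twoTorsionCurve (((u⁻¹ : (RatFunc F)ˣ) : RatFunc F) ^ 2 * RatFunc.X ^ (2 * d))
        (((u⁻¹ : (RatFunc F)ˣ) : RatFunc F) ^ 4 * (-4 * RatFunc.X ^ (2 * d))) := by
  rw [WeierstrassCurve.variableChange_def, twoTorsionCurve, curveE]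
  ext <;> simp

theorem Place.reducesTo_curveE (v : Place F) [Fintype v.residueField] [DecidableEq v.residueField]
    (hF : ringChar F ≠ 2) (hd : d ≠ 0) (u : (RatFunc F)ˣ) {a b : v.ring}
    (ha : (a : RatFunc F) = ((u⁻¹ : (RatFunc F)ˣ) : RatFunc F) ^ 2 * RatFunc.X ^ (2 * d))
    (hb : (b : RatFunc F) = ((u⁻¹ : (RatFunc F)ˣ) : RatFunc F) ^ 4 * (-4 * RatFunc.X ^ (2 * d)))
    (h₀ : IsLocalRing.residue v.ring (a ^ 2 - 3 * b) ≠ 0 ∨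
      b ^ 2 * (a ^ 2 - 4 * b) ∉ IsLocalRing.maximalIdeal v.ring ^ 12) :
    v.ReducesTo (curveE F d) (IsLocalRing.residue v.ring a) (IsLocalRing.residue v.ring b) := by
  have hC := curveE_smul (d := d) u
  rw [← ha, ← hb] at hC
  refine v.trace_and_good ?_ ?_ h₀ hC
  · rwa [← Algebra.ringChar_eq F v.residueField]
  · intro h
    have h1 := congrArg WeierstrassCurve.Δ hC
    rw [WeierstrassCurve.variableChange_Δ, twoTorsionCurve_Δ] at h1
    have h2 : (16 * (b : RatFunc F) ^ 2 * ((a : RatFunc F) ^ 2 - 4 * b)) = 0 := by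
      exact congrArg Subtype.val h
    rw [h2] at h1
    exact mul_ne_zero (pow_ne_zero _ (Units.ne_zero _)) (curveE_Δ_ne_zero hF hd) h1

namespace Place

variable {v : Place F}

theorem two_ne_zero_residueField (hF : ringChar F ≠ 2) : (2 : v.residueField) ≠ 0 := by
  apply Ring.two_ne_zero
  rwa [← Algebra.ringChar_eq F v.residueField]

theorem notMem_maximalIdeal_pow {x : v.ring} (hx : IsLocalRing.residue v.ring x ≠ 0) {n : ℕ}
    (hn : n ≠ 0) : x ∉ IsLocalRing.maximalIdeal v.ring ^ n := fun h =>
  hx ((IsLocalRing.residue_eq_zero_iff x).2 (Ideal.pow_le_self hn h))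

theorem maximalIdeal_eq_span_of_coord_eq_zero (hX : RatFunc.X ∈ v.ring) (h0 : coord hX = 0) :
    IsLocalRing.maximalIdeal v.ring = Ideal.span {⟨RatFunc.X, hX⟩} := by
  apply le_antisymm
  · intro x hx
    rw [← IsLocalRing.residue_eq_zero_iff, residue_eq hX, div_eq_zero_iff,
      or_iff_left (aeval_denom_ne_zero hX x.2), h0] at hx
    obtain ⟨g, hg⟩ : Polynomial.X ∣ (x : RatFunc F).num := by
      rw [Polynomial.X_dvd_iff]
      have := hx
      rw [Polynomial.aeval_def, Polynomial.eval₂_at_zero, ← map_zero (algebraMap F v.residueField)] at this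
      exact (algebraMap F v.residueField).injective this
    rw [Ideal.mem_span_singleton]
    have hu := aeval_denom_ne_zero hX x.2
    rw [← residue_polyHom, IsLocalRing.residue_ne_zero_iff_isUnit] at hu
    have h1 : x * polyHom hX (x : RatFunc F).denom = ⟨RatFunc.X, hX⟩ * polyHom hX g := by
      apply Subtype.ext
      have := coe_polyHom_num_eq hX x
      rw [hg, map_mul] at this
      push_cast at this ⊢
      rw [← this]
      simp [coe_polyHom]
    exact (hu.dvd_mul_right).1 (h1 ▸ dvd_mul_right _ _)
  · rw [Ideal.span_singleton_le_iff_mem, ← IsLocalRing.residue_eq_zero_iff]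
    exact h0

variable [Fintype v.residueField] [DecidableEq v.residueField]

theorem reducesTo_of_coord_ne_zero (hF : ringChar F ≠ 2) (hd : d ≠ 0) (hX : RatFunc.X ∈ v.ring)
    (h0 : coord hX ≠ 0) :
    v.ReducesTo (curveE F d) (coord hX ^ (2 * d)) (-4 * coord hX ^ (2 * d)) := by
  have h2 := two_ne_zero_residueField (v := v) hF
  have key := v.reducesTo_curveE hF hd 1 (a := ⟨RatFunc.X, hX⟩ ^ (2 * d))
    (b := -4 * ⟨RatFunc.X, hX⟩ ^ (2 * d)) (by simp) (by
      change (-4 : RatFunc F) * RatFunc.X ^ (2 * d) = _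
      simp) ?_
  · rw [map_pow, map_mul, map_neg, map_ofNat, map_pow] at key
    exact key
  · by_cases h : coord hX ^ (2 * d) = -12
    · right
      apply notMem_maximalIdeal_pow _ (by norm_num)
      simp only [map_mul, map_sub, map_pow, map_neg, map_ofNat]
      change (-4 * coord hX ^ (2 * d)) ^ 2 * ((coord hX ^ (2 * d)) ^ 2 -
        4 * (-4 * coord hX ^ (2 * d))) ≠ 0
      have e : (-4 * coord hX ^ (2 * d)) ^ 2 * ((coord hX ^ (2 * d)) ^ 2 -
        4 * (-4 * coord hX ^ (2 * d))) = 2 ^ 6 * (coord hX ^ (2 * d)) ^ 3 := by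
        linear_combination 16 * (coord hX ^ (2 * d)) ^ 3 * h
      rw [e]
      exact mul_ne_zero (pow_ne_zero _ h2) (pow_ne_zero _ (pow_ne_zero _ h0))
    · left
      simp only [map_mul, map_sub, map_pow, map_neg, map_ofNat]
      change (coord hX ^ (2 * d)) ^ 2 - 3 * (-4 * coord hX ^ (2 * d)) ≠ 0
      rw [show (coord hX ^ (2 * d)) ^ 2 - 3 * (-4 * coord hX ^ (2 * d)) =
        coord hX ^ (2 * d) * (coord hX ^ (2 * d) - -12) by ring]
      exact mul_ne_zero (pow_ne_zero _ h0) (sub_ne_zero.2 h)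

/-- With d = 2e, scaling by u = t^e gives y² = x(x² + t^(2e) x - 4), which has good reduction at t =
0. -/
theorem reducesTo_of_coord_eq_zero_of_even (hF : ringChar F ≠ 2) (hd : d ≠ 0)
    (hX : RatFunc.X ∈ v.ring) (h0 : coord hX = 0) (hev : Even d) :
    v.ReducesTo (curveE F d) 0 (-4) := by
  have h2 := two_ne_zero_residueField (v := v) hF
  obtain ⟨e, rfl⟩ := hev
  have he : e ≠ 0 := by rintro rfl; simp at hd
  have hX0 : (RatFunc.X : RatFunc F) ≠ 0 := RatFunc.X_ne_zero
  have hr : IsLocalRing.residue v.ring ⟨RatFunc.X, hX⟩ = 0 := h0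
  have key := v.reducesTo_curveE hF hd (Units.mk0 _ hX0 ^ e) (a := ⟨RatFunc.X, hX⟩ ^ (2 * e))
    (b := -4) (by simp; field_simp; ring) (by
      change (-4 : RatFunc F) = _
      simp
      field_simp
      ring) ?_
  · rw [map_pow, map_neg, map_ofNat, hr, zero_pow (mul_ne_zero two_ne_zero he)] at key
    exact key
  · right
    apply notMem_maximalIdeal_pow _ (by norm_num)
    simp only [map_mul, map_sub, map_pow, map_neg, map_ofNat, hr]
    rw [zero_pow (mul_ne_zero two_ne_zero he)]
    have : ((-4) ^ 2 * (0 ^ 2 - 4 * -4) : v.residueField) = 2 ^ 8 := by norm_num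
    rw [this]
    exact pow_ne_zero _ h2

/-- With d = 2e + 1, scaling by u = t^e gives y² = x(x² + t^(2e+2) x - 4t²). Its discriminant has
order 6 < 12 at t = 0, so it can replace a minimal model; the reduction y² = x³ is additive. -/
theorem reducesTo_of_coord_eq_zero_of_odd (hF : ringChar F ≠ 2) (hd : d ≠ 0)
    (hX : RatFunc.X ∈ v.ring) (h0 : coord hX = 0) (hodd : ¬Even d) :
    v.ReducesTo (curveE F d) 0 0 := by
  have h2 := two_ne_zero_residueField (v := v) hF
  obtain ⟨e, rfl⟩ := Nat.not_even_iff_odd.1 hodd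
  have hX0 : (RatFunc.X : RatFunc F) ≠ 0 := RatFunc.X_ne_zero
  set t : v.ring := ⟨RatFunc.X, hX⟩ with ht
  have hr : IsLocalRing.residue v.ring t = 0 := h0
  have key := v.reducesTo_curveE hF hd (Units.mk0 _ hX0 ^ e) (a := t ^ (2 * e + 2))
    (b := -4 * t ^ 2) (by simp [t]; field_simp; ring) (by
      change (-4 : RatFunc F) * RatFunc.X ^ 2 = _
      simp
      field_simp
      ring) ?_
  · rw [map_pow, map_mul, map_pow, hr, zero_pow (by omega), zero_pow (by omega), mul_zero] at key
    exact key
  · right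
    rw [maximalIdeal_eq_span_of_coord_eq_zero hX h0, Ideal.span_singleton_pow,
      Ideal.mem_span_singleton, ← ht]
    rintro ⟨c, hc⟩
    have ht0 : t ≠ 0 := fun h => hX0 (congrArg Subtype.val h)
    have h1 : 16 * (t ^ (4 * e + 2) + 16) = t ^ 6 * c := by
      apply mul_left_cancel₀ (pow_ne_zero 6 ht0)
      linear_combination hc
    have h3 := congrArg (IsLocalRing.residue v.ring) h1
    simp only [map_mul, map_add, map_pow, map_ofNat, hr] at h3
    rw [zero_pow (by omega), zero_pow (by omega), zero_mul, zero_add] at h3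
    apply pow_ne_zero 8 h2
    rw [← h3]
    norm_num

/-- Scaling by u = t^d gives y² = x(x² + x - 4t^(-2d)), which reduces at infinity to the split node
y² = x²(x + 1). Here c₄ is a unit, although Δ is highly divisible. -/
theorem reducesTo_of_X_notMem (hF : ringChar F ≠ 2) (hd : d ≠ 0) (hX : RatFunc.X ∉ v.ring) :
    v.ReducesTo (curveE F d) 1 0 := by
  have hX0 : (RatFunc.X : RatFunc F) ≠ 0 := RatFunc.X_ne_zero
  have hlt : v.ring.valuation (RatFunc.X⁻¹ : RatFunc F) < 1 := by
    rw [map_inv₀]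
    exact inv_lt_one_of_one_lt₀ (one_lt_valuation_X hX)
  have hmem : (RatFunc.X⁻¹ : RatFunc F) ∈ v.ring := (v.ring.valuation_le_one_iff _).1 hlt.le
  have hr : IsLocalRing.residue v.ring ⟨RatFunc.X⁻¹, hmem⟩ = 0 := by
    rw [IsLocalRing.residue_eq_zero_iff]
    exact (v.ring.valuation_lt_one_iff _).2 hlt
  have key := v.reducesTo_curveE hF hd (Units.mk0 _ hX0 ^ d) (a := 1)
    (b := -4 * ⟨RatFunc.X⁻¹, hmem⟩ ^ (2 * d)) (by simp; field_simp; ring) (by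
      change (-4 : RatFunc F) * (RatFunc.X⁻¹) ^ (2 * d) = _
      simp
      field_simp
      ring) ?_
  · rw [map_one, map_mul, map_pow, hr, zero_pow (by omega), mul_zero] at key
    exact key
  · left
    simp only [map_mul, map_sub, map_pow, map_neg, map_ofNat, hr, map_one]
    rw [zero_pow (by omega)]
    simp

end Place

end CurveE

end KummerL

end

noncomputable section

namespace KummerL

/-! ### The logarithmic derivative of the `L`-function -/

/-- The sum over `x` of the quadratic character of the cubic defining a minimal model of the curve
`E_d` at a point `t = τ` of the affine line. -/
def fiberSum {L : Type*} [Field L] [Fintype L] [DecidableEq L] (d : ℕ) (τ : L) : ℤ :=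
  if τ = 0 then (if Even d then cubicSum (0 : L) (-4) else 0)
  else cubicSum (τ ^ (2 * d)) (-4 * τ ^ (2 * d))

open Classical in
/-- The characters of `L` with `χ ^ (2 d) = 1` and `χ ^ 4 ≠ 1`. -/
def familyChars (L : Type*) [Field L] [Fintype L] (d : ℕ) : Finset (MulChar L QBar) :=
  torsionChars L (2 * d) \ torsionChars L 4

theorem mem_familyChars {L : Type*} [Field L] [Fintype L] {d : ℕ} {χ : MulChar L QBar} :
    χ ∈ familyChars L d ↔ χ ^ (2 * d) = 1 ∧ χ ^ 4 ≠ 1 := by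
  classical
  rw [familyChars, Finset.mem_sdiff, mem_torsionChars, mem_torsionChars]

theorem sum_fiberSum {L : Type*} [Field L] [Fintype L] [DecidableEq L] (hL : ringChar L ≠ 2)
    (d : ℕ) : ∑ τ : L, (fiberSum d τ : QBar) =
      Fintype.card L + 1 + ∑ χ ∈ familyChars L d, charB χ := by
  have key := sum_cubicSum_family hL d
  rw [← Finset.add_sum_erase _ _ (Finset.mem_univ (0 : L)), add_comm]
  convert key using 2
  · rw [← Finset.filter_ne', Finset.sum_subtype (p := fun x : L => x ≠ 0) _ (by simp)]
    refine (Fintype.sum_equiv unitsEquivNeZero _ _ fun u => ?_).symm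
    change _ = (fiberSum d (u : L) : QBar)
    rw [fiberSum, if_neg u.ne_zero]
  · rw [fiberSum, if_pos rfl]
    split_ifs
    · congr!
    · simp
  · rw [familyChars]

namespace Place

open PowerSeries

variable {F : Type*} [Field F] {v : Place F}

open Classical in
/-- The place attached to a polynomial (the place at infinity if it is not irreducible). -/
def ofPolynomial (π : Polynomial F) : Place F :=
  if h : Irreducible π then ofIrreducible h else infinity F

theorem X_mem_ofPolynomial {π : Polynomial F} (h : Irreducible π) :
    RatFunc.X ∈ (ofPolynomial π).ring := by
  rw [ofPolynomial, dif_pos h]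
  exact X_mem_ofIrreducible h

theorem poly_ofPolynomial {π : Polynomial F} (h : Irreducible π) (hm : π.Monic) :
    poly (X_mem_ofPolynomial h) = π := by
  have h1 : ofPolynomial π = ofIrreducible h := by rw [ofPolynomial, dif_pos h]
  have : ∀ (w : Place F) (hw : RatFunc.X ∈ w.ring), w = ofIrreducible h → poly hw = π := by
    rintro _ hw rfl
    exact poly_ofIrreducible h hm
  exact this _ _ h1

theorem degree_ofPolynomial {π : Polynomial F} (h : Irreducible π) (hm : π.Monic) :
    (ofPolynomial π).degree = π.natDegree := by
  rw [degree_eq_natDegree (X_mem_ofPolynomial h), poly_ofPolynomial h hm]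

variable [Finite F]

theorem finite_residueField (v : Place F) : Finite v.residueField := by
  by_cases hX : RatFunc.X ∈ v.ring
  · exact finite_residueField_of_mem hX
  · exact Finite.of_surjective _ (algebraMap_bijective_of_X_notMem hX).2

theorem degree_ne_zero (v : Place F) : v.degree ≠ 0 := by
  have := v.finite_residueField
  have : Module.Finite F v.residueField := Module.Finite.of_finite
  rw [degree_eq_finrank]
  exact Module.finrank_pos.ne'

/-- A root τ in L of the polynomial of a finite place embeds the residue field in L and carries the
reduced cubic to the fibre at τ, so the local terms become expressions in τ alone, for every type of
reduction. At infinity the split node contributes 1 in every degree. -/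
theorem exists_hasLogDeriv_eulerFactor (hF : ringChar F ≠ 2) {d : ℕ} (hd : d ≠ 0) (v : Place F) :
    ∃ S : PowerSeries ℤ, HasLogDeriv (v.eulerFactor (curveE F d)) S ∧
      (∀ n, ¬v.degree ∣ n → coeff n S = 0) ∧
      (∀ (hX : RatFunc.X ∈ v.ring) (L : Type) [Field L] [Fintype L] [DecidableEq L] [Algebra F L]
        (τ : L), minpoly F τ = poly hX →
        coeff (Module.finrank F L) S = -(v.degree * fiberSum d τ)) ∧
      (RatFunc.X ∉ v.ring → ∀ (L : Type) [Field L] [Finite L] [Algebra F L],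
        coeff (Module.finrank F L) S = 1) := by
  classical
  have := v.finite_residueField
  have := Fintype.ofFinite v.residueField
  have hk : ringChar v.residueField ≠ 2 := by rwa [← Algebra.ringChar_eq F v.residueField]
  have hdeg := v.degree_ne_zero
  by_cases hX : RatFunc.X ∈ v.ring
  · obtain ⟨α, β, h, hαβ⟩ : ∃ α β : v.residueField, v.ReducesTo (curveE F d) α β ∧
        ∀ (L : Type) [Field L] [Fintype L] [DecidableEq L] (φ : v.residueField →+* L),
          cubicSum (φ α) (φ β) = fiberSum d (φ (coord hX)) := by
      by_cases h0 : coord hX = 0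
      · by_cases hev : Even d
        · refine ⟨_, _, reducesTo_of_coord_eq_zero_of_even hF hd hX h0 hev, fun L _ _ _ φ => ?_⟩
          rw [fiberSum, if_pos (by rw [h0, map_zero]), if_pos hev, map_zero, map_neg, map_ofNat]
        · refine ⟨_, _, reducesTo_of_coord_eq_zero_of_odd hF hd hX h0 hev, fun L _ _ _ φ => ?_⟩
          have hL : ringChar L ≠ 2 := by
            let _ : Algebra v.residueField L := φ.toAlgebra
            rwa [← Algebra.ringChar_eq v.residueField L]
          rw [fiberSum, if_pos (by rw [h0, map_zero]), if_neg hev, map_zero,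
            cubicSum_of_eq_zero hL, MulChar.map_zero, neg_zero]
      · refine ⟨_, _, reducesTo_of_coord_ne_zero hF hd hX h0, fun L _ _ _ φ => ?_⟩
        rw [fiberSum, if_neg (by rwa [_root_.map_eq_zero]), map_pow, map_mul, map_neg, map_ofNat, map_pow]
    obtain ⟨S, hS, hS0, hSL⟩ := h.exists_hasLogDeriv hk hdeg
    refine ⟨S, hS, hS0, fun _ L _ _ _ _ τ hτ => ?_, fun h' => absurd hX h'⟩
    let φ := residueLift hX hτ
    let _ : Algebra v.residueField L := φ.toRingHom.toAlgebra
    have : IsScalarTower F v.residueField L := IsScalarTower.of_algebraMap_eq fun c =>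
      (φ.commutes c).symm
    have hm := Module.finrank_mul_finrank F v.residueField L
    rw [← hm, ← degree_eq_finrank, hSL L]
    have h3 := hαβ L φ.toRingHom
    rw [show φ.toRingHom (coord hX) = τ from residueLift_coord hX hτ] at h3
    rw [← h3]
    rfl
  · obtain ⟨S, hS, hS0, hSL⟩ := (reducesTo_of_X_notMem hF hd hX).exists_hasLogDeriv hk hdeg
    refine ⟨S, hS, hS0, fun h' => absurd h' hX, fun _ L _ _ _ => ?_⟩
    have := Fintype.ofFinite L
    let e := RingEquiv.ofBijective (algebraMap F v.residueField)
      (algebraMap_bijective_of_X_notMem hX)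
    let _ : Algebra v.residueField L := ((algebraMap F L).comp e.symm.toRingHom).toAlgebra
    have : IsScalarTower F v.residueField L := IsScalarTower.of_algebraMap_eq fun c => by
      change algebraMap F L c = algebraMap F L (e.symm (e c))
      rw [e.symm_apply_apply]
    have hm := Module.finrank_mul_finrank F v.residueField L
    have hL : ringChar L ≠ 2 := by rwa [← Algebra.ringChar_eq F L]
    rw [← hm, ← degree_eq_finrank, hSL L, degree_infinity hX, map_one, map_zero,
      cubicSum_of_eq_zero hL]
    simp

open Classical in
variable (F) in
/-- The places of degree at most `N`, together with the place at infinity. -/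
def upTo (N : ℕ) : Finset (Place F) :=
  insert (infinity F) ((irreduciblesUpTo F N).image ofPolynomial)

theorem mem_upTo {N : ℕ} (h : v.degree ≤ N) : v ∈ upTo F N := by
  classical
  rw [upTo, Finset.mem_insert, Finset.mem_image]
  by_cases hX : RatFunc.X ∈ v.ring
  · right
    refine ⟨poly hX, ?_, ?_⟩
    · rw [mem_irreduciblesUpTo, ← degree_eq_natDegree hX]
      exact ⟨monic_poly hX, irreducible_poly hX, h⟩
    · exact eq_of_poly_eq (X_mem_ofPolynomial (irreducible_poly hX)) hX
        (poly_ofPolynomial (irreducible_poly hX) (monic_poly hX))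
  · left
    exact eq_of_X_notMem hX X_notMem_infinity

theorem sum_upTo {M : Type*} [AddCommMonoid M] (N : ℕ) (g : Place F → M) :
    ∑ v ∈ upTo F N, g v = g (infinity F) + ∑ π ∈ irreduciblesUpTo F N, g (ofPolynomial π) := by
  classical
  rw [upTo, Finset.sum_insert, Finset.sum_image]
  · intro a ha b hb hab
    rw [Finset.mem_coe, mem_irreduciblesUpTo] at ha hb
    rw [← poly_ofPolynomial ha.2.1 ha.1, ← poly_ofPolynomial hb.2.1 hb.1]
    congr!
  · rw [Finset.mem_image]
    rintro ⟨π, hπ, h⟩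
    rw [mem_irreduciblesUpTo] at hπ
    exact X_notMem_infinity (h ▸ X_mem_ofPolynomial hπ.2.1)

/-- The Euler factor of a place of degree above N is 1 modulo T^(N+1). Hence each coefficient of the
partial products is eventually constant, which gives convergence of the Euler product. -/
theorem coeff_prod_eulerFactor_eq (W : WeierstrassCurve (RatFunc F)) {N n : ℕ} (hn : n ≤ N)
    {T : Finset (Place F)} (hT : upTo F N ⊆ T) :
    coeff n (∏ v ∈ T, v.eulerFactor W) = coeff n (∏ v ∈ upTo F N, v.eulerFactor W) := by
  classical
  rw [← Finset.prod_sdiff hT]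
  have h : X ^ (N + 1) ∣ (∏ v ∈ T \ upTo F N, v.eulerFactor W) - 1 := by
    refine Finset.prod_induction _ (fun A : PowerSeries ℤ => X ^ (N + 1) ∣ A - 1) ?_ ?_ ?_
    · intro a b ha hb
      rw [show a * b - 1 = a * (b - 1) + (a - 1) by ring]
      exact dvd_add (hb.mul_left _) ha
    · simp
    · intro v hv
      rw [Finset.mem_sdiff] at hv
      have hdeg : N < v.degree := by
        by_contra! h
        exact hv.2 (mem_upTo h)
      rw [X_pow_dvd_iff]
      intro m hm
      rw [map_sub, coeff_one]
      split_ifs with h0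
      · rw [h0, coeff_zero_eq_constantCoeff_apply, v.constantCoeff_eulerFactor W v.degree_ne_zero,
          sub_self]
      · rw [v.coeff_eulerFactor_eq_zero W v.degree_ne_zero, sub_zero]
        intro hdvd
        have := Nat.le_of_dvd (Nat.pos_of_ne_zero h0) hdvd
        omega
  obtain ⟨B, hB⟩ := h
  rw [sub_eq_iff_eq_add.1 hB, add_mul, one_mul, map_add, mul_assoc, coeff_X_pow_mul',
    if_neg (by omega), zero_add]

theorem hasProd_eulerFactor (W : WeierstrassCurve (RatFunc F)) :
    HasProd (fun v : Place F => v.eulerFactor W)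
      (PowerSeries.mk fun n => coeff n (∏ v ∈ upTo F n, v.eulerFactor W)) := by
  rw [HasProd, SummationFilter.unconditional_filter,
    PowerSeries.WithPiTopology.tendsto_iff_coeff_tendsto]
  intro n
  rw [coeff_mk]
  refine tendsto_const_nhds.congr' ?_
  filter_upwards [Filter.eventually_ge_atTop (upTo F n)] with T hT
  exact (coeff_prod_eulerFactor_eq W le_rfl hT).symm

end Place

open PowerSeries

variable {F : Type*} [Field F] [Finite F]

theorem coeff_LFunction (W : WeierstrassCurve (RatFunc F)) {n N : ℕ} (hn : n ≤ N) :
    coeff n (LFunction W) = coeff n (∏ v ∈ Place.upTo F N, v.eulerFactor W) := by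
  rw [LFunction, (Place.hasProd_eulerFactor W).tprod_eq, coeff_mk]
  refine (Place.coeff_prod_eulerFactor_eq W le_rfl ?_).symm
  intro v hv
  classical
  rw [Place.upTo, Finset.mem_insert, Finset.mem_image] at hv ⊢
  refine hv.imp id ?_
  rintro ⟨π, hπ, h⟩
  rw [mem_irreduciblesUpTo] at hπ
  exact ⟨π, mem_irreduciblesUpTo.2 ⟨hπ.1, hπ.2.1, hπ.2.2.trans hn⟩, h⟩

/-- The local terms of the logarithmic derivative of the `L`-function add up to a sum over the
points of the projective line over the extension of `F` of degree `m`. -/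
theorem sum_coeff_eq_sum_fiberSum {d m N : ℕ} (hm : m ≠ 0) (hmN : m ≤ N) {S : Place F → PowerSeries ℤ}
    (h0 : ∀ v n, ¬v.degree ∣ n → coeff n (S v) = 0)
    {L : Type} [Field L] [Fintype L] [DecidableEq L] [Algebra F L] (hL : Module.finrank F L = m)
    (hfin : ∀ (v : Place F) (hX : RatFunc.X ∈ v.ring) (τ : L), minpoly F τ = Place.poly hX →
        coeff m (S v) = -(v.degree * fiberSum d τ))
    (hinf : ∀ v : Place F, RatFunc.X ∉ v.ring → coeff m (S v) = 1) :
    ∑ v ∈ Place.upTo F N, ((coeff m (S v) : ℤ) : QBar) = 1 - ∑ τ : L, (fiberSum d τ : QBar) := by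
  rw [Place.sum_upTo, hinf _ Place.X_notMem_infinity, Int.cast_one, sub_eq_add_neg]
  congr 1
  -- Division by deg π compensates the deg π points τ with minimal polynomial π.
  let φ : Polynomial F → QBar := fun π =>
    ((coeff m (S (Place.ofPolynomial π)) : ℤ) : QBar) / (π.natDegree : QBar)
  have h1 : ∀ τ : L, φ (minpoly F τ) = -(fiberSum d τ : QBar) := by
    intro τ
    have hint : IsIntegral F τ := Algebra.IsIntegral.isIntegral τ
    have hirr := minpoly.irreducible hint
    have hdeg : ((minpoly F τ).natDegree : QBar) ≠ 0 := by
      exact_mod_cast hirr.natDegree_pos.ne'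
    have := hfin _ (Place.X_mem_ofPolynomial hirr) τ
      (Place.poly_ofPolynomial hirr (minpoly.monic hint)).symm
    simp only [φ]
    rw [this, Place.degree_ofPolynomial hirr (minpoly.monic hint), div_eq_iff hdeg]
    push_cast
    ring
  have h2 := sum_minpoly_eq (L := L) φ
  simp_rw [h1] at h2
  rw [Finset.sum_neg_distrib, hL] at h2
  rw [h2]
  have hsub : irreduciblesDvd F m ⊆ irreduciblesUpTo F N := fun π hπ => by
    rw [mem_irreduciblesDvd hm] at hπ
    exact mem_irreduciblesUpTo.2 ⟨hπ.1, hπ.2.1,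
      (Nat.le_of_dvd (Nat.pos_of_ne_zero hm) hπ.2.2).trans hmN⟩
  rw [← Finset.sum_subset hsub]
  · refine Finset.sum_congr rfl fun π hπ => ?_
    rw [mem_irreduciblesDvd hm] at hπ
    have hdeg : (π.natDegree : QBar) ≠ 0 := by exact_mod_cast hπ.2.1.natDegree_pos.ne'
    simp only [φ]
    rw [mul_div_cancel₀ _ hdeg]
  · intro π hπ hπ'
    rw [mem_irreduciblesUpTo] at hπ
    rw [mem_irreduciblesDvd hm] at hπ'
    rw [h0, Int.cast_zero]
    rw [Place.degree_ofPolynomial hπ.2.1 hπ.1]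
    exact fun h => hπ' ⟨hπ.1, hπ.2.1, h⟩

/-- The `L`-function of `E_d` is determined by the sums of the algebraic numbers `charB χ` over all
finite extensions of `F`. -/
theorem LFunction_map_eq (hF : ringChar F ≠ 2) {d : ℕ} (hd : d ≠ 0) {B T : PowerSeries QBar}
    (hB : HasLogDeriv B T) (hB0 : constantCoeff B = 1)
    (h : ∀ m, m ≠ 0 → ∃ (L : Type) (_ : Field L) (_ : Fintype L) (_ : Algebra F L),
      Module.finrank F L = m ∧ coeff m T = -(Fintype.card L : QBar) -
        ∑ χ ∈ familyChars L d, charB χ) :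
    (LFunction (curveE F d)).map (Int.castRingHom QBar) = B := by
  classical
  choose S hS hS0 hfin hinf using Place.exists_hasLogDeriv_eulerFactor hF hd
  ext N
  have hA := (HasLogDeriv.prod (Place.upTo F N) fun v _ => hS v).map (Int.castRingHom QBar)
  have hA0 : constantCoeff ((∏ v ∈ Place.upTo F N, v.eulerFactor (curveE F d)).map
      (Int.castRingHom QBar)) = 1 := by
    rw [← coeff_zero_eq_constantCoeff_apply, coeff_map, coeff_zero_eq_constantCoeff_apply, map_prod,
      Finset.prod_eq_one fun v _ => v.constantCoeff_eulerFactor _ v.degree_ne_zero, map_one]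
  rw [coeff_map, coeff_LFunction _ le_rfl, ← coeff_map]
  -- Up to T^N the L-function agrees with a finite product, so no logarithmic derivative of an
  -- infinite product is needed.
  refine hA.coeff_unique hB hA0 hB0 (N := N) (fun m hmN => ?_) N le_rfl
  rcases eq_or_ne m 0 with rfl | hm
  · rw [hA.coeff_zero hA0, hB.coeff_zero hB0]
  obtain ⟨L, _, _, _, hL, hT⟩ := h m hm
  have key := sum_coeff_eq_sum_fiberSum (d := d) hm hmN hS0 hL
    (fun v hX τ hτ => hL ▸ hfin v hX L τ hτ) (fun v hX => hL ▸ hinf v hX L)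
  have hL2 : ringChar L ≠ 2 := by rwa [← Algebra.ringChar_eq F L]
  rw [sum_fiberSum hL2] at key
  rw [hT, coeff_map, map_sum, map_sum]
  simp only [eq_intCast]
  rw [key]
  ring

end KummerL

end

noncomputable section

namespace KummerL

/-! ### The numbers `charB χ` in extensions, and split characters -/

section Lift

variable {k : Type*} [Field k] [Fintype k]

theorem normChar_quadChar (hk : ringChar k ≠ 2) (L : Type*) [Field L] [Fintype L] [Algebra k L]
    [FiniteDimensional k L] : normChar L (quadChar k) = quadChar L := by
  classical
  apply MulChar.ext'
  intro x
  rw [normChar_apply, quadChar_apply, quadChar_apply, ← normChar_quadraticChar hk L,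
    normChar_apply]

/-- Hasse–Davenport for both Jacobi sums, with the two signs cancelling. The condition χ⁴ ≠ 1 makes
χ² and λχ, the products of the characters involved, nontrivial. -/
theorem charB_normChar (hk : ringChar k ≠ 2) {χ : MulChar k QBar} (hχ : χ ^ 4 ≠ 1)
    (L : Type*) [Field L] [Fintype L] [Algebra k L] [FiniteDimensional k L] :
    charB (normChar L χ) = charB χ ^ Module.finrank k L := by
  have h1 : χ * χ ≠ 1 := fun h => hχ (by
    rw [show 4 = 2 * 2 by norm_num, pow_mul, sq χ, h, one_pow])
  have h2 : quadChar k * χ ^ 2 * χ⁻¹ ≠ 1 := fun h => h1 (by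
    rw [sq, mul_assoc, mul_inv_cancel_right] at h
    have h3 : χ = (quadChar k)⁻¹ := eq_inv_of_mul_eq_one_right h
    rw [quadChar_inv] at h3
    rw [← sq, h3, quadChar_sq])
  have e1 := neg_jacobiSum_normChar (L := L) χ χ h1
  have e2 := neg_jacobiSum_normChar (L := L) _ _ h2
  rw [normChar_mul, normChar_quadChar hk, normChar_pow, normChar_inv] at e2
  have e3 : (normChar L χ ^ 2) 4 = (χ ^ 2) 4 ^ Module.finrank k L := by
    rw [← normChar_pow, normChar_apply, ← map_ofNat (algebraMap k L) 4, Algebra.norm_algebraMap,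
      map_pow]
  have e4 : ∀ a b c : QBar, a * b * c = a * -b * -c := fun a b c => by ring
  rw [charB, charB, e4 _ (jacobiSum _ _), e4 _ (jacobiSum χ χ), e1, e2, e3, mul_pow, mul_pow]

/-- The p^f-th power of a character is its composition with a Frobenius automorphism, which permutes
the summation variable and fixes 1 and 4; λ is unchanged since p^f is odd. -/
theorem charB_pow_char_pow (p : ℕ) [Fact p.Prime] [CharP k p] (hp : p ≠ 2)
    (χ : MulChar k QBar) (f : ℕ) : charB (χ ^ p ^ f) = charB χ := by
  have hpos : p ^ f ≠ 0 := pow_ne_zero _ (Fact.out : p.Prime).ne_zero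
  have hval : ∀ (ψ : MulChar k QBar) (x : k), (ψ ^ p ^ f) x = ψ (iterateFrobeniusEquiv k p f x) := by
    intro ψ x
    rw [MulChar.pow_apply' _ hpos, iterateFrobeniusEquiv_apply, iterateFrobenius_def, map_pow]
  have hJ : ∀ ψ₁ ψ₂ : MulChar k QBar, jacobiSum (ψ₁ ^ p ^ f) (ψ₂ ^ p ^ f) = jacobiSum ψ₁ ψ₂ := by
    intro ψ₁ ψ₂
    refine Fintype.sum_equiv (iterateFrobeniusEquiv k p f).toEquiv _ _ fun x => ?_
    rw [hval, hval, map_sub, map_one]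
    rfl
  have hodd : Odd (p ^ f) := ((Fact.out : p.Prime).odd_of_ne_two hp).pow
  have hlam : quadChar k ^ p ^ f = quadChar k := by
    obtain ⟨e, he⟩ := hodd
    rw [he, pow_succ, pow_mul, quadChar_sq, one_pow, one_mul]
  rw [charB, charB, hJ, pow_right_comm, hval, map_ofNat]
  congr 1
  nth_rw 1 [← hlam]
  rw [← mul_pow, ← inv_pow, hJ]

end Lift

/-- A finite field of order `p ^ f` embeds in every field of order `p ^ (f * m)`. -/
theorem exists_algebra_of_card {F : Type*} [Field F] [Fintype F] {p f m : ℕ} [Fact p.Prime]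
    (hF : Fintype.card F = p ^ f) (hf : f ≠ 0) (L : Type*) [Field L] [Fintype L]
    (hL : Fintype.card L = p ^ (f * m)) : ∃ _ : Algebra F L, Module.finrank F L = m := by
  have hp : p.Prime := Fact.out
  have := charP_of_card_eq_prime_pow hF
  have := charP_of_card_eq_prime_pow hL
  let _ : Algebra (ZMod p) F := ZMod.algebra F p
  let _ : Algebra (ZMod p) L := ZMod.algebra L p
  have h1 : Module.finrank (ZMod p) F = f := Nat.pow_right_injective hp.two_le
    ((FiniteField.pow_finrank_eq_card p F).trans hF)
  have h2 : Module.finrank (ZMod p) L = f * m := Nat.pow_right_injective hp.two_le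
    ((FiniteField.pow_finrank_eq_card p L).trans hL)
  obtain ⟨φ⟩ := FiniteField.nonempty_algHom_of_finrank_dvd (F := ZMod p) (K := F) (L := L)
    (by rw [h1, h2]; exact dvd_mul_right f m)
  let alg : Algebra F L := φ.toRingHom.toAlgebra
  refine ⟨alg, ?_⟩
  have h3 := Module.card_eq_pow_finrank (K := F) (V := L)
  rw [hL, hF, ← pow_mul] at h3
  exact (Nat.eq_of_mul_eq_mul_left (Nat.pos_of_ne_zero hf)
    (Nat.pow_right_injective hp.two_le h3)).symm

/-! ### Logarithmic derivatives of the products, and the case of a character of order 2d on `F` -/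

section Split

open PowerSeries

/-- The norm lifts of the D powers of χ are distinct, and L has at most D characters killed by D
because `Lˣ` is cyclic. -/
theorem eq_normChar_pow {F : Type*} [Field F] [Fintype F] {D : ℕ} {χ : MulChar F QBar} (hD : D ≠ 0)
    (hχ : orderOf χ = D) {L : Type*} [Field L] [Fintype L] [Algebra F L] [FiniteDimensional F L]
    {ψ : MulChar L QBar} (hψ : ψ ^ D = 1) : ∃ n < D, normChar L (χ ^ n) = ψ := by
  classical
  have hinj : Set.InjOn (fun n => normChar L (χ ^ n)) (Finset.range D) := by
    intro a ha b hb hab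
    have := normChar_injective hab
    exact pow_injOn_Iio_orderOf (by simpa [hχ] using ha) (by simpa [hχ] using hb) this
  have hsub : (Finset.range D).image (fun n => normChar L (χ ^ n)) ⊆ torsionChars L D := by
    intro ψ hψ
    obtain ⟨n, -, rfl⟩ := Finset.mem_image.1 hψ
    rw [mem_torsionChars, ← normChar_pow, ← pow_mul, mul_comm, pow_mul, ← hχ, pow_orderOf_eq_one,
      one_pow, normChar_one]
  have hcard : (torsionChars L D).card ≤
      ((Finset.range D).image (fun n => normChar L (χ ^ n))).card := by
    rw [Finset.card_image_of_injOn hinj, Finset.card_range, card_torsionChars]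
    exact IsCyclic.card_pow_eq_one_le (Nat.pos_of_ne_zero hD)
  have := Finset.eq_of_subset_of_card_le hsub hcard
  have hmem : ψ ∈ torsionChars L D := mem_torsionChars.2 hψ
  rw [← this, Finset.mem_image] at hmem
  obtain ⟨n, hn, h⟩ := hmem
  exact ⟨n, Finset.mem_range.1 hn, h⟩

theorem sumB_eq_charB {F : Type*} [Field F] [Fintype F] {d : ℕ} (hd : d ≠ 0) {χ : MulChar F QBar}
    (hχ : orderOf χ = 2 * d) (n : ℕ) : sumB d χ n = charB (χ ^ n) := by
  have hlam : χ ^ d = quadChar F := by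
    apply eq_quadChar_of_sq_eq_one
    · rw [← pow_mul, mul_comm, ← hχ, pow_orderOf_eq_one]
    · apply pow_ne_one_of_lt_orderOf hd
      rw [hχ]
      omega
  rw [sumB, charB, ← hlam, jacobiSum, jacobiSum, mul_assoc, Finset.sum_mul_sum, ← pow_mul,
    mul_comm n 2, ← pow_add, add_comm d]
  congr 1
  refine Finset.sum_congr rfl fun u _ => Finset.sum_congr rfl fun v _ => ?_
  rw [map_mul]
  ring

/-- The excluded indices are the solutions of 4n = 0 modulo 2d, that is, those with (χ^n)⁴ = 1.
Avoiding division treats odd d, where d/2 and 3d/2 are not integers, in the same statement. -/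
theorem dvd_four_mul_iff {d n : ℕ} (hn : n < 2 * d) :
    2 * d ∣ 4 * n ↔ n = 0 ∨ 2 * n = d ∨ n = d ∨ 2 * n = 3 * d := by
  constructor
  · rintro ⟨c, hc⟩
    have h1 : 2 * n = d * c := by
      have : 2 * (2 * n) = 2 * (d * c) := by rw [← mul_assoc, ← mul_assoc]; exact hc
      omega
    have hc4 : c < 4 := by
      by_contra! h
      have := Nat.mul_le_mul_left d h
      omega
    interval_cases c <;> omega
  · rintro (h | h | h | h)
    · simp [h]
    · exact ⟨1, by omega⟩
    · exact ⟨2, by omega⟩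
    · exact ⟨3, by omega⟩

theorem constantCoeff_prod_one_sub {ι : Type*} (s : Finset ι) (q : QBar) (b : ι → QBar)
    {e : ι → ℕ} (he : ∀ i ∈ s, e i ≠ 0) :
    constantCoeff ((1 - C q * X) * ∏ i ∈ s, (1 - C (b i) * X ^ e i)) = 1 := by
  rw [map_mul, map_prod, Finset.prod_eq_one, mul_one]
  · simp
  · intro i hi
    simp [he i hi]

theorem hasLogDeriv_one_sub_pow (b : QBar) {e : ℕ} (he : e ≠ 0) :
    HasLogDeriv (1 - C b * X ^ e)
      (PowerSeries.mk fun m => if e ∣ m ∧ m ≠ 0 then -(e * b ^ (m / e)) else 0) := by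
  have h := (hasLogDeriv_one_sub b).expand e he
  have e1 : expand e he (1 - C b * X) = 1 - C b * X ^ e := by
    rw [map_sub, map_mul, map_one, expand_X, expand_C]
  rw [e1] at h
  convert h using 1
  ext m
  rw [show (e : PowerSeries QBar) = C (e : QBar) by simp, coeff_C_mul, coeff_mk, coeff_expand]
  by_cases hm : e ∣ m
  · obtain ⟨c, rfl⟩ := hm
    rw [if_pos (dvd_mul_right e c), Nat.mul_div_cancel_left _ (Nat.pos_of_ne_zero he), coeff_mk]
    by_cases hc : c = 0
    · simp [hc]
    · rw [if_pos ⟨dvd_mul_right e c, mul_ne_zero he hc⟩, if_neg hc]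
      ring
  · rw [if_neg hm, if_neg (fun h => hm h.1), mul_zero]

theorem hasLogDeriv_prod_one_sub {ι : Type*} (s : Finset ι) (q : QBar) (b : ι → QBar)
    {e : ι → ℕ} (he : ∀ i ∈ s, e i ≠ 0) :
    ∃ T, HasLogDeriv ((1 - C q * X) * ∏ i ∈ s, (1 - C (b i) * X ^ e i)) T ∧
      ∀ m, m ≠ 0 → coeff m T =
        -q ^ m - ∑ i ∈ s, if e i ∣ m then e i * b i ^ (m / e i) else 0 := by
  refine ⟨_, (hasLogDeriv_one_sub q).mul (HasLogDeriv.prod s fun i hi =>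
    hasLogDeriv_one_sub_pow (b i) (he i hi)), fun m hm => ?_⟩
  rw [map_add, coeff_mk, if_neg hm, map_sum, sub_eq_add_neg, ← Finset.sum_neg_distrib]
  congr 1
  refine Finset.sum_congr rfl fun i _ => ?_
  rw [coeff_mk]
  by_cases h : e i ∣ m
  · rw [if_pos ⟨h, hm⟩, if_pos h]
  · rw [if_neg h, if_neg (fun h' => h h'.1), neg_zero]

variable {F : Type*} [Field F] [Fintype F]

/-- Over the extension of degree m every relevant character is the norm lift of a unique χ^n with 4n
nonzero modulo 2d, so its B is the m-th power of B(n). -/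
theorem LFunction_eq_of_orderOf_eq {p f d : ℕ} [Fact p.Prime] (hf : f ≠ 0)
    (hF : Fintype.card F = p ^ f) (hp : ringChar F ≠ 2) (hd : d ≠ 0) {χ : MulChar F QBar}
    (hχ : orderOf χ = 2 * d) :
    (LFunction (curveE F d)).map (Int.castRingHom QBar) =
      (1 - C ((p : QBar) ^ f) * X) * ∏ n ∈ (Finset.Icc 1 (2 * d - 1)).filter
        (fun n => 2 * n ≠ d ∧ n ≠ d ∧ 2 * n ≠ 3 * d), (1 - C (sumB d χ n) * X) := by
  set s := (Finset.Icc 1 (2 * d - 1)).filter (fun n => 2 * n ≠ d ∧ n ≠ d ∧ 2 * n ≠ 3 * d) with hs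
  have hmem : ∀ n, n ∈ s ↔ n < 2 * d ∧ ¬2 * d ∣ 4 * n := by
    intro n
    rw [hs, Finset.mem_filter, Finset.mem_Icc]
    constructor
    · rintro ⟨h1, h2⟩
      have hlt : n < 2 * d := by omega
      refine ⟨hlt, ?_⟩
      rw [dvd_four_mul_iff hlt]
      omega
    · rintro ⟨h1, h2⟩
      rw [dvd_four_mul_iff h1] at h2
      omega
  obtain ⟨T, hT, hcoeff⟩ := hasLogDeriv_prod_one_sub s ((p : QBar) ^ f) (sumB d χ)
    (e := fun _ => 1) (fun _ _ => one_ne_zero)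
  have h0 := constantCoeff_prod_one_sub s ((p : QBar) ^ f) (sumB d χ)
    (e := fun _ => 1) (fun _ _ => one_ne_zero)
  simp only [pow_one] at hT h0
  refine LFunction_map_eq hp hd hT h0 fun m hm => ?_
  have hfm : f * m ≠ 0 := mul_ne_zero hf hm
  let _ : Fintype (GaloisField p (f * m)) := Fintype.ofFinite _
  have hcard : Fintype.card (GaloisField p (f * m)) = p ^ (f * m) := by
    rw [← Nat.card_eq_fintype_card, GaloisField.card p _ hfm]
  obtain ⟨alg, hfr⟩ := exists_algebra_of_card hF hf (GaloisField p (f * m)) hcard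
  have : FiniteDimensional F (GaloisField p (f * m)) := Module.Finite.of_finite
  refine ⟨GaloisField p (f * m), inferInstance, inferInstance, alg, hfr, ?_⟩
  rw [hcoeff m hm, hcard]
  push_cast
  rw [← pow_mul]
  congr 1
  refine Finset.sum_bij (fun n _ => normChar (GaloisField p (f * m)) (χ ^ n)) ?_ ?_ ?_ ?_
  · intro n hn
    rw [hmem] at hn
    rw [mem_familyChars, ← normChar_pow, ← normChar_pow, ← pow_mul, ← pow_mul, mul_comm n,
      mul_comm n]
    constructor
    · rw [pow_mul, ← hχ, pow_orderOf_eq_one, one_pow, normChar_one]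
    · rw [← normChar_one (k := F), normChar_injective.ne_iff, Ne, ← orderOf_dvd_iff_pow_eq_one, hχ]
      exact hn.2
  · intro a ha b hb hab
    rw [hmem] at ha hb
    exact pow_injOn_Iio_orderOf (by simpa [hχ] using ha.1) (by simpa [hχ] using hb.1)
      (normChar_injective hab)
  · intro ψ hψ
    rw [mem_familyChars] at hψ
    obtain ⟨n, hn, h⟩ := eq_normChar_pow (mul_ne_zero two_ne_zero hd) hχ hψ.1
    refine ⟨n, ?_, h⟩
    rw [hmem]
    refine ⟨hn, fun hdvd => hψ.2 ?_⟩
    rw [← h, ← normChar_pow, ← pow_mul, mul_comm n, orderOf_dvd_iff_pow_eq_one.1 (hχ ▸ hdvd),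
      normChar_one]
  · intro n hn
    rw [hmem] at hn
    rw [if_pos (one_dvd m), Nat.div_one, one_mul, sumB_eq_charB hd hχ,
      charB_normChar hp _, hfr]
    rw [← pow_mul, Ne, ← orderOf_dvd_iff_pow_eq_one, hχ, mul_comm n]
    exact hn.2

end Split

end KummerL

end

noncomputable section

namespace KummerL

/-! ### Orbits of multiplication by `q` -/

section Orbit

theorem iterate_mul_left_apply {q D : ℕ} (n : ZMod D) (k : ℕ) :
    (fun x => (q : ZMod D) * x)^[k] n = (q : ZMod D) ^ k * n := by
  rw [mul_left_iterate]

theorem isPeriodicPt_mul_left {q D : ℕ} (hq : q.Coprime D) (n : ZMod D) :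
    Function.IsPeriodicPt (fun x => (q : ZMod D) * x) D.totient n := by
  rw [Function.IsPeriodicPt, Function.IsFixedPt, iterate_mul_left_apply]
  have := congrArg Units.val (ZMod.pow_totient (ZMod.unitOfCoprime q hq))
  rw [Units.val_pow_eq_pow_val, ZMod.coe_unitOfCoprime, Units.val_one] at this
  rw [this, one_mul]

variable {q D : ℕ} [NeZero D]

theorem mem_orbit {n m : ZMod D} : m ∈ orbit q n ↔ ∃ k : ℕ, m = (q : ZMod D) ^ k * n := by
  simp [orbit]

theorem minimalPeriod_mul_left_pos (hq : q.Coprime D) (n : ZMod D) :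
    0 < Function.minimalPeriod (fun x => (q : ZMod D) * x) n :=
  (isPeriodicPt_mul_left hq n).minimalPeriod_pos (Nat.totient_pos.2 (NeZero.pos D))

/-- Because q is prime to D, multiplication by q is periodic, so the forward orbit is a full cycle.
-/
theorem card_orbit (hq : q.Coprime D) (n : ZMod D) :
    (orbit q n).card = Function.minimalPeriod (fun x => (q : ZMod D) * x) n := by
  classical
  have h : orbit q n = (Finset.range (Function.minimalPeriod (fun x => (q : ZMod D) * x) n)).image
      fun k => (fun x => (q : ZMod D) * x)^[k] n := by
    ext m
    rw [mem_orbit, Finset.mem_image]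
    constructor
    · rintro ⟨k, rfl⟩
      refine ⟨k % Function.minimalPeriod (fun x => (q : ZMod D) * x) n,
        Finset.mem_range.2 (Nat.mod_lt _ (minimalPeriod_mul_left_pos hq n)), ?_⟩
      rw [Function.iterate_mod_minimalPeriod_eq, iterate_mul_left_apply]
    · rintro ⟨k, -, rfl⟩
      exact ⟨k, iterate_mul_left_apply n k⟩
  rw [h, Finset.card_image_of_injOn, Finset.card_range]
  intro a ha b hb hab
  exact Function.iterate_injOn_Iio_minimalPeriod (by simpa using ha) (by simpa using hb) hab

theorem card_orbit_dvd_iff (hq : q.Coprime D) (n : ZMod D) (m : ℕ) :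
    (orbit q n).card ∣ m ↔ (q : ZMod D) ^ m * n = n := by
  rw [card_orbit hq, ← Function.isPeriodicPt_iff_minimalPeriod_dvd, Function.IsPeriodicPt,
    Function.IsFixedPt, iterate_mul_left_apply]

theorem self_mem_orbit (n : ZMod D) : n ∈ orbit q n := mem_orbit.2 ⟨0, by simp⟩

theorem orbit_eq_of_mem (hq : q.Coprime D) {n m : ZMod D} (h : m ∈ orbit q n) :
    orbit q m = orbit q n := by
  obtain ⟨k, rfl⟩ := mem_orbit.1 h
  ext x
  rw [mem_orbit, mem_orbit]
  constructor
  · rintro ⟨j, rfl⟩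
    exact ⟨j + k, by rw [pow_add, mul_assoc]⟩
  · rintro ⟨j, rfl⟩
    -- The inverse of q^k acts as q^(kφ(D) - k).
    have hper := (isPeriodicPt_mul_left hq n).const_mul k
    rw [Function.IsPeriodicPt, Function.IsFixedPt, iterate_mul_left_apply] at hper
    have hle : k ≤ k * D.totient := Nat.le_mul_of_pos_right _ (Nat.totient_pos.2 (NeZero.pos D))
    refine ⟨j + (k * D.totient - k), ?_⟩
    rw [← mul_assoc, ← pow_add, add_assoc, Nat.sub_add_cancel hle, pow_add, mul_assoc, hper]

theorem sum_orbits {M : Type*} [Semiring M] (hq : q.Coprime D) {Z : Finset (ZMod D)}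
    (hZ : ∀ n ∈ Z, (q : ZMod D) * n ∈ Z) {rep : Finset (ZMod D) → ZMod D}
    (hrep : ∀ o ∈ orbits q Z, rep o ∈ o) {g : ZMod D → M}
    (hg : ∀ n ∈ Z, g ((q : ZMod D) * n) = g n) :
    ∑ o ∈ orbits q Z, (o.card : M) * g (rep o) = ∑ n ∈ Z, g n := by
  classical
  have hstab : ∀ n ∈ Z, ∀ k : ℕ, (q : ZMod D) ^ k * n ∈ Z ∧ g ((q : ZMod D) ^ k * n) = g n := by
    intro n hn k
    induction k with
    | zero => simpa using hn
    | succ k ih =>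
      rw [pow_succ', mul_assoc]
      exact ⟨hZ _ ih.1, (hg _ ih.1).trans ih.2⟩
  rw [← Finset.sum_fiberwise_of_maps_to (s := Z) (t := orbits q Z) (g := orbit q)
    (fun n hn => Finset.mem_image_of_mem _ hn)]
  refine Finset.sum_congr rfl fun o ho => ?_
  obtain ⟨n, hn, rfl⟩ := Finset.mem_image.1 ho
  have h1 : Z.filter (fun x => orbit q x = orbit q n) = orbit q n := by
    ext x
    rw [Finset.mem_filter]
    constructor
    · rintro ⟨-, hx⟩
      rw [← hx]
      exact self_mem_orbit x
    · intro hx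
      refine ⟨?_, orbit_eq_of_mem hq hx⟩
      obtain ⟨k, rfl⟩ := mem_orbit.1 hx
      exact (hstab n hn k).1
  have h2 : ∀ x ∈ orbit q n, g x = g n := fun x hx => by
    obtain ⟨k, rfl⟩ := mem_orbit.1 hx
    exact (hstab n hn k).2
  rw [h1, Finset.sum_congr rfl h2, Finset.sum_const, nsmul_eq_mul, h2 _ (hrep _ ho)]

theorem mem_indexSet {d : ℕ} [NeZero d] (n : ZMod (2 * d)) :
    n ∈ indexSet d ↔ 4 * n ≠ 0 := by
  have hd : 0 < d := NeZero.pos d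
  have hval : n.val < 2 * d := ZMod.val_lt n
  have h4 : 4 * n = 0 ↔ 2 * d ∣ 4 * n.val := by
    rw [← ZMod.natCast_eq_zero_iff, Nat.cast_mul, ZMod.natCast_zmod_val, Nat.cast_ofNat]
  have heq : ∀ a : ℕ, a < 2 * d → (n = (a : ZMod (2 * d)) ↔ n.val = a) := by
    intro a ha
    constructor
    · rintro rfl
      exact ZMod.val_cast_of_lt ha
    · intro h
      rw [← h, ZMod.natCast_zmod_val]
  rw [Ne, h4, dvd_four_mul_iff hval, indexSet]
  have h0 : n = 0 ↔ n.val = 0 := (ZMod.val_eq_zero n).symm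
  split_ifs with hev
  · obtain ⟨e, rfl⟩ := hev
    simp only [Finset.mem_compl, Finset.mem_insert, Finset.mem_singleton]
    rw [h0, heq _ (by omega), heq _ (by omega), heq _ (by omega)]
    omega
  · rw [Nat.not_even_iff_odd] at hev
    obtain ⟨e, rfl⟩ := hev
    simp only [Finset.mem_compl, Finset.mem_insert, Finset.mem_singleton]
    rw [h0, heq _ (by omega)]
    omega

end Orbit

/-! ### The Teichmüller character -/

attribute [local instance] Ideal.Quotient.field

section Teichmuller

variable (p : ℕ) [hp : Fact p.Prime] (P : Ideal ZBar) [P.IsMaximal] [CharP (ZBar ⧸ P) p]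

theorem mem_finiteSubfield {m : ℕ} {x : ZBar ⧸ P} : x ∈ finiteSubfield p P m ↔ x ^ p ^ m = x := by
  simp [finiteSubfield, RingHom.mem_eqLocusField, iterateFrobenius_def]

theorem finiteSubfield_le {m n : ℕ} (h : m ∣ n) : finiteSubfield p P m ≤ finiteSubfield p P n := by
  obtain ⟨r, rfl⟩ := h
  intro x hx
  rw [mem_finiteSubfield] at hx ⊢
  induction r with
  | zero => simp
  | succ r ih => rw [Nat.mul_succ, pow_add, pow_mul, ih, hx]

theorem coprime_pow_sub_one (m : ℕ) [NeZero m] : (p ^ m - 1).Coprime p := by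
  refine Nat.Coprime.symm ((Nat.Prime.coprime_iff_not_dvd hp.out).2 fun h => ?_)
  have h1 : p ∣ p ^ m := dvd_pow_self p (NeZero.ne m)
  have h2 := (Nat.dvd_sub_iff_right (Nat.one_le_pow _ _ hp.out.pos) h1).1 h
  exact hp.out.one_lt.ne' (Nat.dvd_one.1 h2)

theorem one_lt_char_pow (m : ℕ) [NeZero m] : 1 < p ^ m :=
  Nat.one_lt_pow (NeZero.ne m) hp.out.one_lt

/-- Above, count roots of X^(p^m) - X. Below, a primitive root of unity of order p^m - 1 in `ZBar`
stays primitive after reduction, as its order is prime to p. -/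
theorem card_finiteSubfield (m : ℕ) [NeZero m] :
    Fintype.card (finiteSubfield p P m) = p ^ m := by
  have h1 := one_lt_char_pow p m
  have hM : 0 < p ^ m - 1 := by omega
  have : NeZero (p ^ m - 1) := ⟨hM.ne'⟩
  apply le_antisymm
  · have hsub : (finiteSubfield p P m : Set (ZBar ⧸ P)) ⊆
        (Polynomial.X ^ p ^ m - Polynomial.X : Polynomial (ZBar ⧸ P)).rootSet (ZBar ⧸ P) := by
      intro x hx
      rw [Polynomial.mem_rootSet]
      exact ⟨FiniteField.X_pow_card_sub_X_ne_zero _ h1, by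
        simp [(mem_finiteSubfield p P).1 hx]⟩
    rw [← Nat.card_eq_fintype_card]
    calc Nat.card (finiteSubfield p P m) = (finiteSubfield p P m : Set (ZBar ⧸ P)).ncard := rfl
      _ ≤ _ := Set.ncard_le_ncard hsub (Polynomial.rootSet_finite _ _)
      _ ≤ (Polynomial.X ^ p ^ m - Polynomial.X : Polynomial (ZBar ⧸ P)).natDegree :=
          Polynomial.ncard_rootSet_le _ _
      _ = p ^ m := FiniteField.X_pow_card_sub_X_natDegree_eq _ h1
  · obtain ⟨ω, hω⟩ := HasEnoughRootsOfUnity.exists_primitiveRoot QBar (p ^ m - 1)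
    let ω' : ZBar := ⟨ω, hω.isIntegral hM⟩
    have hω' : IsPrimitiveRoot ω' (p ^ m - 1) :=
      IsPrimitiveRoot.of_map_of_injective (f := (integralClosure ℤ QBar).val)
        (by simpa [ω'] using hω) Subtype.val_injective
    let ζ : primeToRoots p := ⟨hω'.isUnit hM.ne' |>.unit, p ^ m - 1, coprime_pow_sub_one p m, by
      ext1
      simpa using hω'.pow_eq_one⟩
    have hζ : IsPrimitiveRoot ζ (p ^ m - 1) := by
      apply IsPrimitiveRoot.of_map_of_injective (f := (Units.coeHom ZBar).comp (primeToRoots p).subtype)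
      · exact hω'
      · exact Units.val_injective.comp Subtype.val_injective
    have hη : IsPrimitiveRoot (reductionHom p P ζ) (p ^ m - 1) :=
      hζ.map_of_injective (reductionHom_injective p P)
    have hη' : IsPrimitiveRoot ((reductionHom p P ζ : (ZBar ⧸ P)ˣ) : ZBar ⧸ P) (p ^ m - 1) :=
      IsPrimitiveRoot.coe_units_iff.2 hη
    have hmem : ((reductionHom p P ζ : (ZBar ⧸ P)ˣ) : ZBar ⧸ P) ∈ finiteSubfield p P m := by
      rw [mem_finiteSubfield]
      conv_lhs => rw [← Nat.sub_add_cancel h1.le]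
      rw [pow_succ, hη'.pow_eq_one, one_mul]
    let y : finiteSubfield p P m := ⟨_, hmem⟩
    have hy : IsPrimitiveRoot y (p ^ m - 1) :=
      IsPrimitiveRoot.of_map_of_injective (f := (finiteSubfield p P m).subtype) hη'
        Subtype.val_injective
    have hyu := (hy.isUnit_unit hM.ne')
    classical
    have h2 : p ^ m - 1 ≤ Fintype.card (finiteSubfield p P m)ˣ := by
      rw [hyu.eq_orderOf]
      exact orderOf_le_card_univ
    rw [Fintype.card_units] at h2
    have := Fintype.card_pos (α := finiteSubfield p P m)
    omega

theorem teichmuller_coe (u : (ZBar ⧸ P)ˣ) : teichmuller p P u =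
    ((((reductionEquiv p P).symm u : ZBarˣ) : ZBar) : QBar) := by
  rw [teichmuller, MulChar.ofUnitHom_coe]
  rfl

theorem teichmuller_injective_units {u w : (ZBar ⧸ P)ˣ}
    (h : teichmuller p P u = teichmuller p P w) : u = w := by
  rw [teichmuller_coe, teichmuller_coe] at h
  exact (reductionEquiv p P).symm.injective (Subtype.ext (Units.ext (Subtype.ext h)))

theorem teichmullerOn_apply (m : ℕ) (x : finiteSubfield p P m) :
    teichmullerOn p P m x = teichmuller p P (x : ZBar ⧸ P) := by
  rcases eq_or_ne x 0 with rfl | hx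
  · rw [MulChar.map_zero, ZeroMemClass.coe_zero, MulChar.map_zero]
  · lift x to (finiteSubfield p P m)ˣ using hx.isUnit
    rw [teichmullerOn, MulChar.ofUnitHom_coe]
    rfl

/-- The Teichmüller character is injective on units, so its value at a generator has full order. -/
theorem orderOf_teichmullerOn (m : ℕ) [NeZero m] : orderOf (teichmullerOn p P m) = p ^ m - 1 := by
  classical
  have hcard : Fintype.card (finiteSubfield p P m)ˣ = p ^ m - 1 := by
    rw [Fintype.card_units, card_finiteSubfield]
  apply Nat.dvd_antisymm
  · rw [← hcard]
    exact orderOf_dvd_of_pow_eq_one (MulChar.pow_card_eq_one _)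
  · obtain ⟨g, hg⟩ := IsCyclic.exists_generator (α := (finiteSubfield p P m)ˣ)
    have hord := orderOf_eq_card_of_forall_mem_zpowers hg
    rw [Nat.card_eq_fintype_card, hcard] at hord
    rw [← hord]
    apply orderOf_dvd_of_pow_eq_one
    have h1 : ((teichmullerOn p P m) ^ orderOf (teichmullerOn p P m)) (g : finiteSubfield p P m) = 1 := by
      rw [pow_orderOf_eq_one, MulChar.one_apply_coe]
    rw [MulChar.pow_apply_coe, ← map_pow, teichmullerOn_apply] at h1
    set k := orderOf (teichmullerOn p P m)
    have h2 : Units.map (finiteSubfield p P m).subtype.toMonoidHom (g ^ k) = 1 := by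
      apply teichmuller_injective_units p P
      rw [Units.val_one, map_one, ← h1]
      rfl
    have h3 := congrArg Units.val h2
    ext1
    exact Subtype.ext h3

theorem exists_eq_teichmullerOn_pow (m : ℕ) [NeZero m] (χ : MulChar (finiteSubfield p P m) QBar) :
    ∃ a < p ^ m - 1, teichmullerOn p P m ^ a = χ := by
  classical
  have hM : 0 < p ^ m - 1 := by have := one_lt_char_pow p m; omega
  have hcard : Nat.card (MulChar (finiteSubfield p P m) QBar) = p ^ m - 1 := by
    have : NeZero (Monoid.exponent (finiteSubfield p P m)ˣ : QBar) := ⟨by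
      exact_mod_cast Monoid.exponent_ne_zero_of_finite⟩
    rw [MulChar.card_eq_card_units_of_hasEnoughRootsOfUnity, Nat.card_eq_fintype_card,
      Fintype.card_units, card_finiteSubfield]
  have hmem : χ ∈ Submonoid.powers (teichmullerOn p P m) := by
    rw [mem_powers_iff_mem_zpowers, Subgroup.eq_top_of_card_eq (Subgroup.zpowers _)
      (by rw [Nat.card_zpowers, orderOf_teichmullerOn, hcard])]
    exact Subgroup.mem_top χ
  obtain ⟨a, ha⟩ := hmem
  refine ⟨a % (p ^ m - 1), Nat.mod_lt _ hM, ?_⟩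
  rw [← orderOf_teichmullerOn p P m, pow_mod_orderOf]
  exact ha

end Teichmuller

end KummerL

end

noncomputable section

namespace KummerL
attribute [local instance] Ideal.Quotient.field

/-- The norm is the power map with exponent (|L| - 1)/(|k| - 1), so θ ∘ N is the corresponding power
of any Θ extending θ. -/
theorem charB_pow_of_algebraMap {k L : Type*} [Field k] [Fintype k] [Field L] [Fintype L]
    [Algebra k L] (hk : ringChar k ≠ 2) {θ : MulChar k QBar} {Θ : MulChar L QBar}
    (hΘ : ∀ y : k, Θ (algebraMap k L y) = θ y) {a r : ℕ} (ha : (θ ^ a) ^ 4 ≠ 1)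
    (hr : Fintype.card L = Fintype.card k ^ r) :
    charB (Θ ^ (a * ((Fintype.card L - 1) / (Fintype.card k - 1)))) = charB (θ ^ a) ^ r := by
  have : FiniteDimensional k L := Module.Finite.of_finite
  have hfr : Module.finrank k L = r := by
    rw [Module.card_eq_pow_finrank (K := k) (V := L)] at hr
    exact Nat.pow_right_injective Fintype.one_lt_card hr
  have hnorm : normChar L θ = Θ ^ ((Fintype.card L - 1) / (Fintype.card k - 1)) := by
    ext x
    rw [normChar_apply, MulChar.pow_apply_coe, ← map_pow, ← hΘ, FiniteField.algebraMap_norm_eq_pow,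
      Nat.card_eq_fintype_card, Nat.card_eq_fintype_card]
  rw [← hfr, ← charB_normChar hk ha L, normChar_pow, hnorm, ← pow_mul, mul_comm a]

theorem coe_subfield_inclusion {K : Type*} [Field K] {S T : Subfield K} (h : S ≤ T) (y : S) :
    (Subfield.inclusion h y : K) = y := rfl

/-! ### Characters of order dividing 2d indexed by `ZMod (2 * d)`, and the product over orbits -/

section Beta

variable (p : ℕ) [hp : Fact p.Prime] (P : Ideal ZBar) [P.IsMaximal] [CharP (ZBar ⧸ P) p]

theorem ringChar_finiteSubfield_ne_two (hp2 : p ≠ 2) (m : ℕ) :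
    ringChar (finiteSubfield p P m) ≠ 2 := by
  have : CharP (finiteSubfield p P m) p := inferInstance
  rwa [ringChar.eq (finiteSubfield p P m) p]

theorem teichmullerOn_congr {m n : ℕ} {x : finiteSubfield p P m} {y : finiteSubfield p P n}
    (h : (x : ZBar ⧸ P) = y) : teichmullerOn p P m x = teichmullerOn p P n y := by
  rw [teichmullerOn_apply, teichmullerOn_apply, h]

theorem charB_teichmullerOn_pow (hp2 : p ≠ 2) {k n r : ℕ} [NeZero k] [NeZero n] (hn : n = k * r)
    {a : ℕ} (ha : (teichmullerOn p P k ^ a) ^ 4 ≠ 1) :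
    charB (teichmullerOn p P n ^ (a * ((p ^ n - 1) / (p ^ k - 1)))) =
      charB (teichmullerOn p P k ^ a) ^ r := by
  have hle := finiteSubfield_le p P (Dvd.intro r hn.symm)
  let _ : Algebra (finiteSubfield p P k) (finiteSubfield p P n) :=
    (Subfield.inclusion hle).toAlgebra
  have h := charB_pow_of_algebraMap (ringChar_finiteSubfield_ne_two p P hp2 k)
    (Θ := teichmullerOn p P n) (fun y => teichmullerOn_congr p P (coe_subfield_inclusion hle y)) ha
    (r := r) (by rw [card_finiteSubfield, card_finiteSubfield, hn, pow_mul])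
  rwa [card_finiteSubfield, card_finiteSubfield] at h

/-- The exponent of the character of order dividing `2d` of the field with `q ^ m` elements attached
to `n ∈ ℤ/2dℤ`. -/
def torsionExp (q d m : ℕ) (n : ZMod (2 * d)) : ℕ := (q ^ m - 1) * n.val / (2 * d)

theorem torsionExp_mul {q d m : ℕ} [NeZero d] (hq : q ≠ 0) {n : ZMod (2 * d)}
    (hn : (q : ZMod (2 * d)) ^ m * n = n) :
    torsionExp q d m n * (2 * d) = (q ^ m - 1) * n.val := by
  apply Nat.div_mul_cancel
  rw [← ZMod.natCast_eq_zero_iff, Nat.cast_mul, ZMod.natCast_zmod_val,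
    Nat.cast_sub (Nat.one_le_pow _ _ (Nat.pos_of_ne_zero hq)), Nat.cast_pow, Nat.cast_one, sub_mul,
    hn, one_mul, sub_self]

variable (f d m : ℕ) [NeZero f] [NeZero d] [NeZero m]

/-- The value of `charB` at the character of order dividing `2d` of the field with `q ^ m` elements
attached to `n ∈ ℤ/2dℤ`, where `q = p ^ f`. -/
def torsionB (n : ZMod (2 * d)) : QBar :=
  charB (teichmullerOn p P (f * m) ^ torsionExp (p ^ f) d m n)

theorem beta_eq_torsionB {n : ZMod (2 * d)} (h : (orbit (p ^ f) n).card = m) :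
    beta p P f d n = torsionB p P f d m n := by
  subst h
  rw [beta, torsionB, charB, jac, jac]
  change (thetaChar p P f d n ^ 2) 4 * _ * _ = (thetaChar p P f d n ^ 2) 4 *
    jacobiSum (thetaChar p P f d n) (thetaChar p P f d n) *
    jacobiSum (quadChar _ * thetaChar p P f d n ^ 2) (thetaChar p P f d n)⁻¹
  ring

variable {f d m}

/-- The Teichmüller character has order q^m - 1 and the exponent is (q^m - 1) n / 2d, so the c-th
power is trivial exactly when 2d divides cn. -/
theorem pow_torsionExp_eq_one_iff {n : ZMod (2 * d)} (hn : ((p ^ f : ℕ) : ZMod (2 * d)) ^ m * n = n)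
    (c : ℕ) : (teichmullerOn p P (f * m) ^ torsionExp (p ^ f) d m n) ^ c = 1 ↔
      (c : ZMod (2 * d)) * n = 0 := by
  have hE := torsionExp_mul (pow_ne_zero f hp.out.ne_zero) hn
  have hd : 0 < 2 * d := Nat.mul_pos two_pos (NeZero.pos d)
  have hM : 0 < p ^ (f * m) - 1 := by have := one_lt_char_pow p (f * m); omega
  rw [← pow_mul] at hE
  rw [← pow_mul, ← orderOf_dvd_iff_pow_eq_one, orderOf_teichmullerOn,
    ← ZMod.natCast_zmod_val n, ← Nat.cast_mul, ZMod.natCast_eq_zero_iff, ZMod.natCast_zmod_val,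
    ← Nat.mul_dvd_mul_iff_right hd, ← Nat.mul_dvd_mul_iff_left hM (b := 2 * d)]
  rw [show torsionExp (p ^ f) d m n * c * (2 * d) = (p ^ (f * m) - 1) * (c * n.val) by
    rw [mul_right_comm, hE]; ring]

/-- The exponent at level m is the one at level ℓ times (q^m - 1)/(q^ℓ - 1), so the character at
level m is a norm lift. -/
theorem torsionB_pow (hp2 : p ≠ 2) {ℓ r : ℕ} [NeZero ℓ] (hm : m = ℓ * r) {n : ZMod (2 * d)}
    (hn : ((p ^ f : ℕ) : ZMod (2 * d)) ^ ℓ * n = n) (h4 : 4 * n ≠ 0) :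
    torsionB p P f d ℓ n ^ r = torsionB p P f d m n := by
  have hd : 0 < 2 * d := Nat.mul_pos two_pos (NeZero.pos d)
  rw [torsionB, torsionB, ← charB_teichmullerOn_pow p P hp2 (n := f * m)
    (by rw [hm, mul_assoc])]
  · congr 2
    have hdvd : p ^ (f * ℓ) - 1 ∣ p ^ (f * m) - 1 := by
      rw [hm, ← mul_assoc, pow_mul p (f * ℓ)]
      exact Nat.sub_one_dvd_pow_sub_one _ _ 
    have hE := torsionExp_mul (pow_ne_zero f hp.out.ne_zero) hn
    obtain ⟨c, hc⟩ := hdvd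
    have hM : 0 < p ^ (f * ℓ) - 1 := by have := one_lt_char_pow p (f * ℓ); omega
    rw [hc, Nat.mul_div_cancel_left _ hM]
    symm
    rw [torsionExp, ← pow_mul, hc]
    rw [← pow_mul] at hE
    apply Nat.div_eq_of_eq_mul_left hd
    rw [mul_right_comm, ← hE]
    ring
  · rw [Ne, pow_torsionExp_eq_one_iff p P hn]
    exact_mod_cast h4

/-- Modulo q^m - 1 the exponent attached to qn is q times the one attached to n; the two characters
thus differ by a power of Frobenius. -/
theorem torsionB_mul (hp2 : p ≠ 2) {n : ZMod (2 * d)}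
    (hn : ((p ^ f : ℕ) : ZMod (2 * d)) ^ m * n = n) :
    torsionB p P f d m ((p ^ f : ℕ) * n) = torsionB p P f d m n := by
  have hd : 0 < 2 * d := Nat.mul_pos two_pos (NeZero.pos d)
  have hq := pow_ne_zero f hp.out.ne_zero
  have hn' : ((p ^ f : ℕ) : ZMod (2 * d)) ^ m * ((p ^ f : ℕ) * n) = (p ^ f : ℕ) * n := by
    rw [mul_left_comm, hn]
  have hE := torsionExp_mul hq hn
  have hE' := torsionExp_mul hq hn'
  have hval : ((p ^ f : ℕ) * n : ZMod (2 * d)).val = p ^ f * n.val % (2 * d) := by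
    rw [← ZMod.val_natCast, Nat.cast_mul, ZMod.natCast_zmod_val]
  have hdiv := Nat.div_add_mod (p ^ f * n.val) (2 * d)
  rw [← hval] at hdiv
  have key : torsionExp (p ^ f) d m n * p ^ f = ((p ^ f) ^ m - 1) * (p ^ f * n.val / (2 * d)) +
      torsionExp (p ^ f) d m ((p ^ f : ℕ) * n) := by
    apply Nat.eq_of_mul_eq_mul_right hd
    rw [mul_right_comm, hE, add_mul, hE', mul_assoc, mul_comm n.val]
    nth_rw 1 [← hdiv]
    ring
  have : CharP (finiteSubfield p P (f * m)) p := inferInstance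
  rw [torsionB, torsionB, ← charB_pow_char_pow p hp2
    (teichmullerOn p P (f * m) ^ torsionExp (p ^ f) d m n) f, ← pow_mul,
    key, pow_add, ← pow_mul p f m, pow_mul _ (p ^ (f * m) - 1), ← orderOf_teichmullerOn p P,
    pow_orderOf_eq_one, one_pow, one_mul]

theorem sum_charB_familyChars :
    ∑ χ ∈ familyChars (finiteSubfield p P (f * m)) d, charB χ =
      ∑ n ∈ indexSet d, if ((p ^ f : ℕ) : ZMod (2 * d)) ^ m * n = n then torsionB p P f d m n
        else 0 := by
  have hd : 0 < 2 * d := Nat.mul_pos two_pos (NeZero.pos d)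
  have hM : 0 < p ^ (f * m) - 1 := by have := one_lt_char_pow p (f * m); omega
  have hq := pow_ne_zero f hp.out.ne_zero
  rw [← Finset.sum_filter]
  symm
  refine Finset.sum_bij (fun n _ => teichmullerOn p P (f * m) ^ torsionExp (p ^ f) d m n)
    ?_ ?_ ?_ ?_
  · intro n hn
    rw [Finset.mem_filter, mem_indexSet] at hn
    rw [mem_familyChars, Ne, pow_torsionExp_eq_one_iff p P hn.2, pow_torsionExp_eq_one_iff p P hn.2]
    refine ⟨by rw [ZMod.natCast_self, zero_mul], ?_⟩
    exact_mod_cast hn.1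
  · intro a ha b hb hab
    rw [Finset.mem_filter] at ha hb
    have hlt : ∀ n : ZMod (2 * d), ((p ^ f : ℕ) : ZMod (2 * d)) ^ m * n = n →
        torsionExp (p ^ f) d m n < orderOf (teichmullerOn p P (f * m)) := by
      intro n hn
      rw [orderOf_teichmullerOn, ← Nat.mul_lt_mul_right hd, torsionExp_mul hq hn, ← pow_mul]
      exact Nat.mul_lt_mul_of_pos_left (ZMod.val_lt n) hM
    have h1 := pow_injOn_Iio_orderOf (hlt a ha.2) (hlt b hb.2) hab
    have h2 := congrArg (· * (2 * d)) h1
    simp only [torsionExp_mul hq ha.2, torsionExp_mul hq hb.2] at h2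
    rw [← pow_mul] at h2
    exact ZMod.val_injective _ (Nat.eq_of_mul_eq_mul_left hM h2)
  · intro χ hχ
    rw [mem_familyChars] at hχ
    obtain ⟨a, ha, rfl⟩ := exists_eq_teichmullerOn_pow p P (f * m) χ
    have h1 := hχ.1
    rw [← pow_mul, ← orderOf_dvd_iff_pow_eq_one, orderOf_teichmullerOn] at h1
    obtain ⟨c, hc⟩ := h1
    have hlt : c < 2 * d := by
      rw [← Nat.mul_lt_mul_left hM, ← hc]
      exact Nat.mul_lt_mul_of_pos_right ha hd
    have hval : (c : ZMod (2 * d)).val = c := ZMod.val_cast_of_lt hlt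
    have hfix : ((p ^ f : ℕ) : ZMod (2 * d)) ^ m * c = c := by
      have h2 := congrArg (Nat.cast : ℕ → ZMod (2 * d)) hc
      rw [Nat.cast_mul, ZMod.natCast_self, mul_zero, Nat.cast_mul,
        Nat.cast_sub (one_lt_char_pow p (f * m)).le, Nat.cast_one, pow_mul, Nat.cast_pow] at h2
      linear_combination -h2
    have hexp : torsionExp (p ^ f) d m (c : ZMod (2 * d)) = a := by
      rw [torsionExp, hval, ← pow_mul, ← hc, Nat.mul_div_cancel _ hd]
    refine ⟨c, ?_, by rw [hexp]⟩
    rw [Finset.mem_filter, mem_indexSet]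
    refine ⟨fun h => hχ.2 ?_, hfix⟩
    rw [← hexp, pow_torsionExp_eq_one_iff p P hfix]
    exact_mod_cast h
  · intro n _
    rfl

open PowerSeries

/-- The length of the orbit of n divides m exactly when q^m n = n. Such an orbit accounts for |o|
characters over the extension of degree m, all with B equal to β(n)^(m/|o|), which is the
contribution of its factor. -/
theorem LFunction_eq_prod_orbits {F : Type*} [Field F] [Fintype F] (hF : Fintype.card F = p ^ f)
    (hp2 : p ≠ 2) (hd : d.Coprime (p ^ f)) {rep : Finset (ZMod (2 * d)) → ZMod (2 * d)}
    (hrep : ∀ o ∈ orbits (p ^ f) (indexSet d), rep o ∈ o) :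
    (LFunction (curveE F d)).map (Int.castRingHom QBar) =
      (1 - C ((p : QBar) ^ f) * X) * ∏ o ∈ orbits (p ^ f) (indexSet d),
        (1 - C (beta p P f d (rep o)) * X ^ o.card) := by
  have hchar := charP_of_card_eq_prime_pow hF
  have hF2 : ringChar F ≠ 2 := by rwa [ringChar.eq F p]
  have hq : (p ^ f).Coprime (2 * d) := Nat.Coprime.mul_right
    (Nat.Coprime.pow_left _ ((Nat.coprime_primes hp.out Nat.prime_two).2 hp2)) hd.symm
  have hcard : ∀ o ∈ orbits (p ^ f) (indexSet d), o.card ≠ 0 := fun o ho =>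
    (Finset.card_pos.2 ⟨_, hrep o ho⟩).ne'
  obtain ⟨T, hT, hcoeff⟩ := hasLogDeriv_prod_one_sub (orbits (p ^ f) (indexSet d)) ((p : QBar) ^ f)
    (fun o => beta p P f d (rep o)) hcard
  refine LFunction_map_eq hF2 (NeZero.ne d) hT (constantCoeff_prod_one_sub _ _ _ hcard)
    fun m hm => ?_
  have : NeZero m := ⟨hm⟩
  obtain ⟨alg, hfr⟩ := exists_algebra_of_card (m := m) hF (NeZero.ne f)
    (finiteSubfield p P (f * m)) (card_finiteSubfield p P (f * m))
  refine ⟨finiteSubfield p P (f * m), inferInstance, inferInstance, alg, hfr, ?_⟩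
  rw [hcoeff m hm, card_finiteSubfield, sum_charB_familyChars]
  push_cast
  rw [← pow_mul]
  congr 1
  have hunit : IsUnit ((p ^ f : ℕ) : ZMod (2 * d)) := (ZMod.isUnit_iff_coprime _ _).2 hq
  have hstab : ∀ n ∈ indexSet d, ((p ^ f : ℕ) : ZMod (2 * d)) * n ∈ indexSet d := by
    intro n hn
    rw [mem_indexSet] at hn ⊢
    rw [mul_left_comm]
    exact fun h => hn (hunit.mul_right_eq_zero.1 h)
  have hinv : ∀ n ∈ indexSet d,
      (if ((p ^ f : ℕ) : ZMod (2 * d)) ^ m * ((p ^ f : ℕ) * n) = (p ^ f : ℕ) * n then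
        torsionB p P f d m ((p ^ f : ℕ) * n) else 0) =
      if ((p ^ f : ℕ) : ZMod (2 * d)) ^ m * n = n then torsionB p P f d m n else 0 := by
    intro n _
    rw [mul_left_comm]
    by_cases h : ((p ^ f : ℕ) : ZMod (2 * d)) ^ m * n = n
    · rw [if_pos h, if_pos (by rw [h]), torsionB_mul p P hp2 h]
    · rw [if_neg h, if_neg (mt hunit.mul_right_inj.1 h)]
  have key := sum_orbits hq hstab hrep (g := fun n =>
    if ((p ^ f : ℕ) : ZMod (2 * d)) ^ m * n = n then torsionB p P f d m n else 0) hinv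
  push_cast at key
  rw [← key]
  refine Finset.sum_congr rfl fun o ho => ?_
  have ho' : rep o ∈ indexSet d ∧ (orbit (p ^ f) (rep o)).card = o.card := by
    obtain ⟨n, hn, rfl⟩ := Finset.mem_image.1 ho
    have h1 := hrep _ ho
    refine ⟨?_, by rw [orbit_eq_of_mem hq h1]⟩
    obtain ⟨k, hk⟩ := mem_orbit.1 h1
    rw [hk, mem_indexSet, mul_left_comm]
    rw [mem_indexSet] at hn
    exact fun h => hn ((hunit.pow k).mul_right_eq_zero.1 h)
  have : NeZero o.card := ⟨hcard o ho⟩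
  have hdvd := card_orbit_dvd_iff hq (rep o) m
  have hfix := (card_orbit_dvd_iff hq (rep o) o.card).1 (by rw [ho'.2])
  rw [ho'.2] at hdvd
  by_cases h : o.card ∣ m
  · have h' := hdvd.1 h
    push_cast at h'
    rw [if_pos h, if_pos h', beta_eq_torsionB p P f d o.card ho'.2,
      torsionB_pow p P hp2 (Nat.mul_div_cancel' h).symm hfix ((mem_indexSet _).1 ho'.1)]
  · have h' := mt hdvd.2 h
    push_cast at h'
    rw [if_neg h, if_neg h', mul_zero]

end Beta

end KummerL

end

theorem theorem3p1 {F : Type*} [Field F] [Fintype F] (p f : ℕ) [Fact p.Prime] [NeZero f]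
    (hF : Fintype.card F = p ^ f) (hp : p ≠ 2) (d : ℕ) [NeZero d] (hd : d.Coprime (p ^ f)) :
    Multipliable (fun v : KummerL.Place F => v.eulerFactor (KummerL.curveE F d)) ∧
    (∀ (P : Ideal KummerL.ZBar) [P.IsMaximal] [CharP (KummerL.ZBar ⧸ P) p]
      (rep : Finset (ZMod (2 * d)) → ZMod (2 * d)),
      (∀ o ∈ KummerL.orbits (p ^ f) (KummerL.indexSet d), rep o ∈ o) →
      (KummerL.LFunction (KummerL.curveE F d)).map (Int.castRingHom KummerL.QBar) =
        (1 - PowerSeries.C ((p : KummerL.QBar) ^ f) * PowerSeries.X) *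
          ∏ o ∈ KummerL.orbits (p ^ f) (KummerL.indexSet d),
            (1 - PowerSeries.C (KummerL.beta p P f d (rep o)) * PowerSeries.X ^ o.card)) ∧
    (∀ χ : MulChar F KummerL.QBar, 2 * d ∣ p ^ f - 1 → orderOf χ = 2 * d →
      (KummerL.LFunction (KummerL.curveE F d)).map (Int.castRingHom KummerL.QBar) =
        (1 - PowerSeries.C ((p : KummerL.QBar) ^ f) * PowerSeries.X) *
          ∏ n ∈ (Finset.Icc 1 (2 * d - 1)).filter
              (fun n => 2 * n ≠ d ∧ n ≠ d ∧ 2 * n ≠ 3 * d),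
            (1 - PowerSeries.C (KummerL.sumB d χ n) * PowerSeries.X)) := by
  have hchar := charP_of_card_eq_prime_pow hF
  have hF2 : ringChar F ≠ 2 := by rwa [ringChar.eq F p]
  refine ⟨(KummerL.Place.hasProd_eulerFactor _).multipliable, ?_, ?_⟩
  · intro P _ _ rep hrep
    exact KummerL.LFunction_eq_prod_orbits p P hF hp hd hrep
  · intro χ _ hχ
    exact KummerL.LFunction_eq_of_orderOf_eq (NeZero.ne f) hF hF2 (NeZero.ne d) hχ
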